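/- Let $d \ge 3$ and let $\rho : \mathbb{R}^d \to \mathbb{R}$. Write $\omega(k) = |k|$ and $\hat\rho(k) = (2\pi)^{-d/2}\int_{\mathbb{R}^d} \rho(x) e^{-ik\cdot x}\,dx$. Assume (A.1) $\rho \in L^1(\mathbb{R}^d)$ and $\hat\rho/\omega^{1/2},\ \hat\rho/\omega \in L^2(\mathbb{R}^d)$; (A.2) $\hat\rho/\omega^{3/2} \in L^2(\mathbb{R}^d)$, $\hat\rho \in L^1(\mathbb{R}^d)$ and $\hat\rho/\omega^2 \in L^1(\mathbb{R}^d)$. Let $\mathcal{F} = \bigoplus_{n\ge 0} L^2_{\mathrm{sym}}(\mathbb{R}^{dn})$ be the boson Fock space, with inner product linear in the second argument. For $f \in L^2(\mathbb{R}^d)$ let $a(f)$ and $a^\dagger(f)$ be the operators $$(a(f)\Psi)^{(n)}(k_1,\dots,k_n) = \sqrt{n+1}\int \overline{f(k)}\,\Psi^{(n+1)}(k,k_1,\dots,k_n)\,dk ,$$ $$(a^\dagger(f)\Psi)^{(n)}(k_1,\dots,k_n) = \tfrac{1}{\sqrt n}\sum_{j=1}^n f(k_j)\Psi^{(n-1)}(k_1,\dots,k_{j-1},k_{j+1},\dots,k_n)\quad(n\ge1),\qquad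 (a^\dagger(f)\Psi)^{(0)}=0,$$ on their maximal domains, and put $\phi_S(f) = \frac{1}{\sqrt2}(a(f)+a^\dagger(f))$, $\pi_S(f) = \frac{i}{\sqrt2}(-a(f)+a^\dagger(f))$. Let $H_0 = d\Gamma(\omega)$, that is, $(H_0\Psi)^{(n)}(k_1,\dots,k_n) = \big(\sum_{j}|k_j|\big)\Psi^{(n)}(k_1,\dots,k_n)$, and $$H = H_0 - \phi_S(\hat\rho/\sqrt\omega), \qquad U = \exp\!\big(-i\,\overline{\pi_S(\hat\rho/\omega^{3/2})}\big).$$ Let $a(k)$ be the kernel of the annihilation operator, $(a(k)\Psi)^{(n)}(k_1,\dots,k_n) = \sqrt{n+1}\,\Psi^{(n+1)}(k,k_1,\dots,k_n)$, and define $$F_{\Phi,\Psi}(t,k) = (\Phi, e^{itH}a(k)e^{-itH}\Psi),$$ $$\phi_{\Phi,\Psi}(t,x) = \frac{1}{(2\pi)^{d/2}}\int_{\mathbb{R}^d} \frac{1}{\sqrt{2\omega(k)}}\Big(F_{\Phi,\Psi}(t,k)e^{ik\cdot x} + \overline{F_{\Psi,\Phi}(t,k)}\,e^{-ik\cdot x}\Big)\,dk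 .$$ Then the unitary groups generated by $H$ and by $\overline{\pi_S(\hat\rho/\omega^{3/2})}$ exist (these operators are self-adjoint), and for all $\Phi,\Psi$ in the domain of $H_0^{d/2+2}$ with $(\Phi,\Psi)=1$ the form $\phi_{U\Phi,U\Psi}$ is well defined (for every $t$ the vectors $a(k)e^{-itH}U\Psi$ and $a(k)e^{-itH}U\Phi$ lie in $\mathcal{F}$ for almost every $k$, and the integral converges absolutely for all $(t,x)$), is twice continuously differentiable on $\mathbb{R}\times\mathbb{R}^d$, and satisfies $$(\partial_t^2 - \Delta)\,\phi_{U\Phi,U\Psi}(t,x) = \rho(x)$$ for all $t$, for almost every $x$ and for every $x$ at which $\rho$ is continuous. In particular, if $\Psi$ is in the domain of $H_0^{d/2+2}$ and $\|\Psi\|=1$, then $\phi_{U\Psi,U\Psi}$ is such a solution. -/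

import Mathlib

open MeasureTheory Filter Topology
open scoped ComplexConjugate InnerProductSpace ContDiff

noncomputable section

namespace VanHove

/-! ### The boson Fock space over `L²(ℝᵈ)` -/

/-- The space `ℝᵈ` with its Euclidean norm (used both for positions and for momenta). -/
abbrev Space (d : ℕ) : Type := EuclideanSpace ℝ (Fin d)

/-- `L²(ℝᵈⁿ)`, the functions of `n` momenta. -/
abbrev L2n (d n : ℕ) : Type := Lp ℂ 2 (volume : Measure (Fin n → Space d))

theorem measurePreserving_perm (d : ℕ) {n : ℕ} (σ : Equiv.Perm (Fin n)) :
    MeasurePreserving (fun (k : Fin n → Space d) i => k (σ i)) volume volume := by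
  have h := volume_preserving_arrowCongr' (α₁ := Fin n) (α₂ := Fin n) (β₁ := Space d)
    (β₂ := Space d) σ.symm (MeasurableEquiv.refl _) (MeasurePreserving.id _)
  exact h

/-- `L²_sym(ℝᵈⁿ)`: the vectors of `L²(ℝᵈⁿ)` that are almost everywhere invariant under all
permutations of the `n` momenta. For `n = 0` this is `L²` of a point, that is `ℂ`. -/
def SymL2 (d n : ℕ) : Submodule ℂ (L2n d n) where
  carrier := {f | ∀ σ : Equiv.Perm (Fin n), (fun k => f (fun i => k (σ i))) =ᵐ[volume] f}
  zero_mem' := by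
    intro σ
    have h0 := Lp.coeFn_zero ℂ 2 (volume : Measure (Fin n → Space d))
    have h1 := (measurePreserving_perm d σ).quasiMeasurePreserving.ae h0
    filter_upwards [h0, h1] with k hk hk1
    rw [hk1, hk]; rfl
  add_mem' := by
    intro f g hf hg σ
    have h0 := Lp.coeFn_add f g
    have h1 := (measurePreserving_perm d σ).quasiMeasurePreserving.ae h0
    filter_upwards [h0, h1, hf σ, hg σ] with k hk hk1 h2 h3
    rw [hk1, hk, Pi.add_apply, Pi.add_apply, h2, h3]
  smul_mem' := by
    intro c f hf σ
    have h0 := Lp.coeFn_smul c f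
    have h1 := (measurePreserving_perm d σ).quasiMeasurePreserving.ae h0
    filter_upwards [h0, h1, hf σ] with k hk hk1 h2
    rw [hk1, hk, Pi.smul_apply, Pi.smul_apply, h2]

/-- The boson Fock space `⨁ₙ L²_sym(ℝᵈⁿ)` (Hilbert space direct sum). -/
abbrev Fock (d : ℕ) : Type := lp (fun n => SymL2 d n) 2

/-- The `n`-particle component `Ψ⁽ⁿ⁾` of a Fock vector, as a function of the `n` momenta. -/
def comp {d : ℕ} (Ψ : Fock d) (n : ℕ) : (Fin n → Space d) → ℂ :=
  ((Ψ n : SymL2 d n) : L2n d n)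

theorem comp_add {d : ℕ} (Ψ Φ : Fock d) (n : ℕ) :
    comp (Ψ + Φ) n =ᵐ[volume] fun k => comp Ψ n k + comp Φ n k :=
  Lp.coeFn_add ((Ψ n : SymL2 d n) : L2n d n) ((Φ n : SymL2 d n) : L2n d n)

theorem comp_smul {d : ℕ} (c : ℂ) (Ψ : Fock d) (n : ℕ) :
    comp (c • Ψ) n =ᵐ[volume] fun k => c * comp Ψ n k :=
  Lp.coeFn_smul c ((Ψ n : SymL2 d n) : L2n d n)

theorem comp_zero {d : ℕ} (n : ℕ) : comp (0 : Fock d) n =ᵐ[volume] fun _ => 0 :=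
  Lp.coeFn_zero ℂ 2 (volume : Measure (Fin n → Space d))

theorem comp_memLp {d : ℕ} (Ψ : Fock d) (n : ℕ) : MemLp (comp Ψ n) 2 volume :=
  Lp.memLp ((Ψ n : SymL2 d n) : L2n d n)

theorem fock_ext {d : ℕ} {Ψ Φ : Fock d} (h : ∀ n, comp Ψ n =ᵐ[volume] comp Φ n) : Ψ = Φ := by
  apply lp.ext
  funext n
  exact Subtype.ext (Lp.ext (h n))

/-! ### Measure-theoretic helper facts on adding and removing a momentum -/

theorem measurePreserving_cons (d n : ℕ) :
    MeasurePreserving (fun p : (Fin n → Space d) × Space d =>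
      (Fin.cons p.2 p.1 : Fin (n + 1) → Space d)) volume volume := by
  have h := (volume_preserving_piFinSuccAbove (fun _ : Fin (n + 1) => Space d) 0).symm
  have h2 := h.comp (Measure.measurePreserving_swap
    (μ := (volume : Measure (Fin n → Space d))) (ν := (volume : Measure (Space d))))
  have h3 : (fun p : (Fin n → Space d) × Space d =>
      (Fin.cons p.2 p.1 : Fin (n + 1) → Space d)) =
      (MeasurableEquiv.piFinSuccAbove (fun _ : Fin (n + 1) => Space d) 0).symm ∘ Prod.swap := by
    funext p
    simp [MeasurableEquiv.piFinSuccAbove, Fin.insertNthEquiv, Fin.insertNth_zero']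
  rw [h3]
  exact h2

theorem quasiMeasurePreserving_remove (d n : ℕ) (j : Fin (n + 1)) :
    Measure.QuasiMeasurePreserving (fun (k : Fin (n + 1) → Space d) i => k (j.succAbove i))
      volume volume := by
  have h := (volume_preserving_piFinSuccAbove (fun _ : Fin (n + 1) => Space d) j)
  exact (Measure.quasiMeasurePreserving_snd (μ := (volume : Measure (Space d)))
    (ν := (volume : Measure (Fin n → Space d)))).comp h.quasiMeasurePreserving

theorem ae_cons {d n : ℕ} {P : (Fin (n + 1) → Space d) → Prop} (h : ∀ᵐ k, P k) :
    ∀ᵐ k : Fin n → Space d, ∀ᵐ q : Space d, P (Fin.cons q k) :=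
  Measure.ae_ae_of_ae_prod ((measurePreserving_cons d n).quasiMeasurePreserving.ae h)

theorem integrable_slice {d n : ℕ} (f : Lp ℂ 2 (volume : Measure (Space d))) (Ψ : Fock d) :
    ∀ᵐ k : Fin n → Space d,
      Integrable (fun q : Space d => conj (f q) * comp Ψ (n + 1) (Fin.cons q k)) := by
  have h1 : MemLp (fun p : (Fin n → Space d) × Space d =>
      comp Ψ (n + 1) (Fin.cons p.2 p.1)) 2 (volume.prod volume) :=
    (comp_memLp Ψ (n + 1)).comp_measurePreserving (measurePreserving_cons d n)
  have h2 := ((memLp_two_iff_integrable_sq_norm h1.1).1 h1).prod_right_ae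
  have h3 := h1.1.prodMk_left
  have hf : MemLp (fun q => conj (f q)) 2 (volume : Measure (Space d)) := (Lp.memLp f).star
  filter_upwards [h2, h3] with k hk hk3
  exact hf.integrable_mul ((memLp_two_iff_integrable_sq_norm hk3).2 hk)

/-! ### Operators on the Fock space

Unbounded operators are Mathlib's partially defined linear maps. Each of them is given by its
graph, on its maximal domain: `Ψ` lies in the domain if and only if the formula for the components
defines a vector `Θ` of the Fock space. -/

/-- The graph of the annihilation operator `a(f)`:
`(a(f) Ψ)⁽ⁿ⁾(k₁,…,kₙ) = √(n+1) ∫ f(q)^* Ψ⁽ⁿ⁺¹⁾(q,k₁,…,kₙ) dq`. -/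
def annihilationGraph {d : ℕ} (f : Lp ℂ 2 (volume : Measure (Space d))) :
    Submodule ℂ (Fock d × Fock d) where
  carrier := {p | ∀ n, comp p.2 n =ᵐ[volume] fun k =>
    (Real.sqrt (n + 1) : ℂ) * ∫ q : Space d, conj (f q) * comp p.1 (n + 1) (Fin.cons q k)}
  zero_mem' := by
    intro n
    filter_upwards [comp_zero (d := d) n, ae_cons (comp_zero (d := d) (n + 1))] with k h1 h2
    have h3 : ∫ q : Space d, conj (f q) * comp (0 : Fock d) (n + 1) (Fin.cons q k) = 0 := by
      rw [integral_congr_ae (g := fun _ => 0) (by filter_upwards [h2] with q hq; rw [hq, mul_zero]),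
        integral_zero]
    simp only [Prod.fst_zero, Prod.snd_zero]
    rw [h1, h3, mul_zero]
  add_mem' := by
    rintro ⟨Ψ, Θ⟩ ⟨Ψ', Θ'⟩ h h' n
    filter_upwards [comp_add Θ Θ' n, ae_cons (comp_add Ψ Ψ' (n + 1)), h n, h' n,
      integrable_slice (n := n) f Ψ, integrable_slice (n := n) f Ψ'] with k h1 h2 h3 h4 h5 h6
    have h7 : ∫ q : Space d, conj (f q) * comp (Ψ + Ψ') (n + 1) (Fin.cons q k) =
        (∫ q : Space d, conj (f q) * comp Ψ (n + 1) (Fin.cons q k)) +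
        ∫ q : Space d, conj (f q) * comp Ψ' (n + 1) (Fin.cons q k) := by
      rw [← integral_add h5 h6]
      exact integral_congr_ae (by filter_upwards [h2] with q hq; rw [hq, mul_add])
    simp only [Prod.mk_add_mk] at h3 h4 ⊢
    rw [h1, h7, h3, h4, mul_add]
  smul_mem' := by
    rintro c ⟨Ψ, Θ⟩ h n
    filter_upwards [comp_smul c Θ n, ae_cons (comp_smul c Ψ (n + 1)), h n] with k h1 h2 h3
    have h7 : ∫ q : Space d, conj (f q) * comp (c • Ψ) (n + 1) (Fin.cons q k) =
        c * ∫ q : Space d, conj (f q) * comp Ψ (n + 1) (Fin.cons q k) := by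
      rw [← integral_const_mul]
      exact integral_congr_ae (by filter_upwards [h2] with q hq; rw [hq]; ring)
    simp only [Prod.smul_mk] at h3 ⊢
    rw [h1, h7, h3]; ring

/-- The annihilation operator `a(f)`, `f ∈ L²(ℝᵈ)`, on its maximal domain. -/
def annihilation {d : ℕ} (f : Lp ℂ 2 (volume : Measure (Space d))) : Fock d →ₗ.[ℂ] Fock d :=
  (annihilationGraph f).toLinearPMap

theorem annihilation_graph {d : ℕ} (f : Lp ℂ 2 (volume : Measure (Space d))) :
    (annihilation f).graph = annihilationGraph f := by
  apply Submodule.toLinearPMap_graph_eq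
  rintro ⟨Ψ, Θ⟩ h h0
  obtain rfl : Ψ = 0 := h0
  refine fock_ext fun n => ((h n).trans ?_).trans ((annihilationGraph f).zero_mem n).symm
  rfl

/-- The graph of the creation operator `a†(g)`: `(a†(g) Ψ)⁽⁰⁾ = 0` and
`(a†(g) Ψ)⁽ⁿ⁾(k₁,…,kₙ) = n^{-1/2} ∑ⱼ g(kⱼ) Ψ⁽ⁿ⁻¹⁾(k₁,…,kⱼ₋₁,kⱼ₊₁,…,kₙ)` for `n ≥ 1`
(written below with `n + 1` in place of `n`). -/
def creationGraph {d : ℕ} (g : Lp ℂ 2 (volume : Measure (Space d))) :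
    Submodule ℂ (Fock d × Fock d) where
  carrier := {p | comp p.2 0 =ᵐ[volume] (fun _ => 0) ∧
    ∀ n, comp p.2 (n + 1) =ᵐ[volume] fun k => ((Real.sqrt (n + 1) : ℂ))⁻¹ *
      ∑ j : Fin (n + 1), g (k j) * comp p.1 n (fun i => k (j.succAbove i))}
  zero_mem' := by
    refine ⟨comp_zero 0, fun n => ?_⟩
    have h2 : ∀ᵐ k : Fin (n + 1) → Space d, ∀ j : Fin (n + 1),
        comp (0 : Fock d) n (fun i => k (j.succAbove i)) = 0 :=
      ae_all_iff.2 fun j => (quasiMeasurePreserving_remove d n j).ae (comp_zero n)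
    filter_upwards [comp_zero (d := d) (n + 1), h2] with k h1 h2
    simp only [Prod.fst_zero, Prod.snd_zero]
    simp [h1, h2]
  add_mem' := by
    rintro ⟨Ψ, Θ⟩ ⟨Ψ', Θ'⟩ ⟨h0, h⟩ ⟨h0', h'⟩
    refine ⟨?_, fun n => ?_⟩
    · filter_upwards [comp_add Θ Θ' 0, h0, h0'] with k h1 h2 h3
      simp only [Prod.mk_add_mk] at h2 h3 ⊢
      rw [h1, h2, h3, add_zero]
    · have h2 : ∀ᵐ k : Fin (n + 1) → Space d, ∀ j : Fin (n + 1),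
          comp (Ψ + Ψ') n (fun i => k (j.succAbove i)) =
            comp Ψ n (fun i => k (j.succAbove i)) + comp Ψ' n (fun i => k (j.succAbove i)) :=
        ae_all_iff.2 fun j => (quasiMeasurePreserving_remove d n j).ae (comp_add Ψ Ψ' n)
      filter_upwards [comp_add Θ Θ' (n + 1), h n, h' n, h2] with k h1 h3 h4 h5
      simp only [Prod.mk_add_mk] at h3 h4 ⊢
      rw [h1, h3, h4, ← mul_add, ← Finset.sum_add_distrib]
      simp only [h5, mul_add]
  smul_mem' := by
    rintro c ⟨Ψ, Θ⟩ ⟨h0, h⟩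
    refine ⟨?_, fun n => ?_⟩
    · filter_upwards [comp_smul c Θ 0, h0] with k h1 h2
      simp only [Prod.smul_mk] at h2 ⊢
      rw [h1, h2, mul_zero]
    · have h2 : ∀ᵐ k : Fin (n + 1) → Space d, ∀ j : Fin (n + 1),
          comp (c • Ψ) n (fun i => k (j.succAbove i)) =
            c * comp Ψ n (fun i => k (j.succAbove i)) :=
        ae_all_iff.2 fun j => (quasiMeasurePreserving_remove d n j).ae (comp_smul c Ψ n)
      filter_upwards [comp_smul c Θ (n + 1), h n, h2] with k h1 h3 h5
      simp only [Prod.smul_mk] at h3 ⊢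
      rw [h1, h3]
      simp only [h5, Finset.mul_sum]
      exact Finset.sum_congr rfl fun j _ => by ring

/-- The creation operator `a†(g)`, `g ∈ L²(ℝᵈ)`, on its maximal domain. -/
def creation {d : ℕ} (g : Lp ℂ 2 (volume : Measure (Space d))) : Fock d →ₗ.[ℂ] Fock d :=
  (creationGraph g).toLinearPMap

theorem creation_graph {d : ℕ} (g : Lp ℂ 2 (volume : Measure (Space d))) :
    (creation g).graph = creationGraph g := by
  apply Submodule.toLinearPMap_graph_eq
  rintro ⟨Ψ, Θ⟩ h h0
  obtain rfl : Ψ = 0 := h0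
  refine fock_ext fun n => ?_
  cases n with
  | zero => exact h.1.trans (creationGraph g).zero_mem.1.symm
  | succ n => exact (h.2 n).trans ((creationGraph g).zero_mem.2 n).symm

/-- The Segal field operator `φ_S(f) = (a(f) + a†(f)) / √2`. -/
def segalPhi {d : ℕ} (f : Lp ℂ 2 (volume : Measure (Space d))) : Fock d →ₗ.[ℂ] Fock d :=
  ((1 / Real.sqrt 2 : ℝ) : ℂ) • (annihilation f + creation f)

/-- The conjugate Segal operator `π_S(g) = i (-a(g) + a†(g)) / √2`. -/
def segalPi {d : ℕ} (g : Lp ℂ 2 (volume : Measure (Space d))) : Fock d →ₗ.[ℂ] Fock d :=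
  (Complex.I * ((1 / Real.sqrt 2 : ℝ) : ℂ)) • (-annihilation g + creation g)

/-- The graph of the operator that multiplies the `n`-particle component by the real function
`m n`. -/
def multGraph {d : ℕ} (m : (n : ℕ) → (Fin n → Space d) → ℝ) : Submodule ℂ (Fock d × Fock d) where
  carrier := {p | ∀ n, comp p.2 n =ᵐ[volume] fun k => (m n k : ℂ) * comp p.1 n k}
  zero_mem' := by
    intro n
    filter_upwards [comp_zero (d := d) n] with k h1
    simp only [Prod.fst_zero, Prod.snd_zero]
    rw [h1, mul_zero]
  add_mem' := by
    rintro ⟨Ψ, Θ⟩ ⟨Ψ', Θ'⟩ h h' n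
    filter_upwards [comp_add Θ Θ' n, comp_add Ψ Ψ' n, h n, h' n] with k h1 h2 h3 h4
    simp only [Prod.mk_add_mk] at h3 h4 ⊢
    rw [h1, h2, h3, h4, mul_add]
  smul_mem' := by
    rintro c ⟨Ψ, Θ⟩ h n
    filter_upwards [comp_smul c Θ n, comp_smul c Ψ n, h n] with k h1 h2 h3
    simp only [Prod.smul_mk] at h3 ⊢
    rw [h1, h2, h3]; ring

/-- The multiplication operator with the functions `m n`, on its maximal domain. -/
def mult {d : ℕ} (m : (n : ℕ) → (Fin n → Space d) → ℝ) : Fock d →ₗ.[ℂ] Fock d :=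
  (multGraph m).toLinearPMap

theorem mult_graph {d : ℕ} (m : (n : ℕ) → (Fin n → Space d) → ℝ) :
    (mult m).graph = multGraph m := by
  apply Submodule.toLinearPMap_graph_eq
  rintro ⟨Ψ, Θ⟩ h h0
  obtain rfl : Ψ = 0 := h0
  exact fock_ext fun n => (h n).trans ((multGraph m).zero_mem n).symm

/-- The second quantization `dΓ(T)`: multiplication of `Ψ⁽ⁿ⁾` by `T(k₁) + ⋯ + T(kₙ)`. -/
def dGamma {d : ℕ} (T : Space d → ℝ) : Fock d →ₗ.[ℂ] Fock d :=
  mult fun _ k => ∑ j, T (k j)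

/-- The power `dΓ(T)^s` (`T ≥ 0`, `s > 0`) in the sense of the functional calculus: multiplication
of `Ψ⁽ⁿ⁾` by `(T(k₁) + ⋯ + T(kₙ))^s`. -/
def dGammaPow {d : ℕ} (T : Space d → ℝ) (s : ℝ) : Fock d →ₗ.[ℂ] Fock d :=
  mult fun _ k => (∑ j, T (k j)) ^ s

/-! ### The unitary group `exp(itA)` -/

/-- `V` is the unitary group `t ↦ exp(itA)`: a strongly continuous one-parameter group of unitary
operators whose generator is exactly `A`, domain included. By Stone's theorem there is such a `V`
if and only if `A` is self-adjoint, and it is then unique. -/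
structure IsUnitaryGroupOf {F : Type*} [NormedAddCommGroup F] [InnerProductSpace ℂ F]
    (A : F →ₗ.[ℂ] F) (V : ℝ → (F ≃ₗᵢ[ℂ] F)) : Prop where
  map_add : ∀ s t ψ, V (s + t) ψ = V s (V t ψ)
  continuous : ∀ ψ, Continuous fun t => V t ψ
  generator : ∀ ψ η, (ψ, η) ∈ A.graph ↔ HasDerivAt (fun t => V t ψ) (Complex.I • η) 0

/-- The unitary group of `A` exists (equivalently, on a Hilbert space, `A` is self-adjoint). -/
def HasUnitaryGroup {F : Type*} [NormedAddCommGroup F] [InnerProductSpace ℂ F]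
    (A : F →ₗ.[ℂ] F) : Prop :=
  ∃ V, IsUnitaryGroupOf A V

open Classical in
/-- `expI A t` is the unitary operator `exp(itA)` (with the identity as default value when `A` has
no unitary group). -/
def expI {F : Type*} [NormedAddCommGroup F] [InnerProductSpace ℂ F]
    (A : F →ₗ.[ℂ] F) (t : ℝ) : F ≃ₗᵢ[ℂ] F :=
  if h : HasUnitaryGroup A then h.choose t else LinearIsometryEquiv.refl ℂ F

/-! ### The model -/

/-- The Fourier transform `ρ̂(k) = (2π)^{-d/2} ∫ ρ(x) exp(-i k·x) dx`. -/
def fourierHat {d : ℕ} (ρ : Space d → ℝ) (k : Space d) : ℂ :=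
  (((Real.sqrt (2 * Real.pi)) ^ d : ℝ) : ℂ)⁻¹ *
    ∫ x : Space d, (ρ x : ℂ) * Complex.exp (-(Complex.I * (⟪k, x⟫_ℝ : ℂ)))

/-- The function `k ↦ ρ̂(k) / √ω(k)^l` with `ω(k) = |k|`. -/
def weighted {d : ℕ} (ρ : Space d → ℝ) (l : ℕ) (k : Space d) : ℂ :=
  fourierHat ρ k / (((Real.sqrt ‖k‖) ^ l : ℝ) : ℂ)

/-- First condition on the source: `ρ ∈ L¹` and `ρ̂/√ω, ρ̂/ω ∈ L²`. -/
structure CondA1 {d : ℕ} (ρ : Space d → ℝ) : Prop where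
  integrable : Integrable ρ
  memLp_one : MemLp (weighted ρ 1) 2 volume
  memLp_two : MemLp (weighted ρ 2) 2 volume

/-- Second condition on the source: `ρ̂/ω^{3/2} ∈ L²`, `ρ̂ ∈ L¹` and `ρ̂/ω² ∈ L¹`. -/
structure CondA2 {d : ℕ} (ρ : Space d → ℝ) : Prop where
  memLp_three : MemLp (weighted ρ 3) 2 volume
  integrable_hat : Integrable (fourierHat ρ)
  integrable_div : Integrable (fun k => fourierHat ρ k / ((‖k‖ ^ 2 : ℝ) : ℂ))

/-- The van Hove Hamiltonian `H = dΓ(ω) - φ_S(ρ̂/√ω)`, with the intersection of the domains of the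
two summands as its domain. -/
def hamiltonian {d : ℕ} (ρ : Space d → ℝ) (h1 : CondA1 ρ) : Fock d →ₗ.[ℂ] Fock d :=
  dGamma (fun k => ‖k‖) + -segalPhi (h1.memLp_one.toLp (weighted ρ 1))

/-- The closure of `π_S(ρ̂/ω^{3/2})`. -/
def dressingGenerator {d : ℕ} (ρ : Space d → ℝ) (h2 : CondA2 ρ) : Fock d →ₗ.[ℂ] Fock d :=
  (segalPi (h2.memLp_three.toLp (weighted ρ 3))).closure

/-- The unitary operator `U`, the exponential of `-i` times the closure of `π_S(ρ̂/ω^{3/2})`. -/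
def dressing {d : ℕ} (ρ : Space d → ℝ) (h2 : CondA2 ρ) : Fock d ≃ₗᵢ[ℂ] Fock d :=
  expI (dressingGenerator ρ h2) (-1)

/-- `Θ = a(k) Ψ`, where `a(k)` is the operator kernel of the annihilation operator:
`(a(k) Ψ)⁽ⁿ⁾(k₁,…,kₙ) = √(n+1) Ψ⁽ⁿ⁺¹⁾(k,k₁,…,kₙ)`. -/
def IsKernelValue {d : ℕ} (k : Space d) (Ψ Θ : Fock d) : Prop :=
  ∀ n, comp Θ n =ᵐ[volume] fun ks =>
    (Real.sqrt (n + 1) : ℂ) * comp Ψ (n + 1) (Fin.cons k ks)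

open Classical in
/-- The vector `a(k) Ψ` of the Fock space (with default value `0` when the components of `a(k) Ψ`
do not define a vector of the Fock space). For a given `Ψ` it is, as a function of `k`, determined
up to a set of measure zero. -/
def annihilationKernel {d : ℕ} (k : Space d) (Ψ : Fock d) : Fock d :=
  if h : ∃ Θ, IsKernelValue k Ψ Θ then h.choose else 0

/-- `F_{Φ,Ψ}(t,k) = (Φ, e^{itH} a(k) e^{-itH} Ψ)`. -/
def heisenbergForm {d : ℕ} (ρ : Space d → ℝ) (h1 : CondA1 ρ) (Φ Ψ : Fock d) (t : ℝ)
    (k : Space d) : ℂ :=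
  ⟪Φ, expI (hamiltonian ρ h1) t
    (annihilationKernel k (expI (hamiltonian ρ h1) (-t) Ψ))⟫_ℂ

/-- The integrand
`(2ω(k))^{-1/2} (F_{Φ,Ψ}(t,k) e^{ik·x} + F_{Ψ,Φ}(t,k)^* e^{-ik·x})` of the field form. -/
def fieldIntegrand {d : ℕ} (ρ : Space d → ℝ) (h1 : CondA1 ρ) (Φ Ψ : Fock d) (t : ℝ)
    (x k : Space d) : ℂ :=
  ((1 / Real.sqrt (2 * ‖k‖) : ℝ) : ℂ) *
    (heisenbergForm ρ h1 Φ Ψ t k * Complex.exp (Complex.I * (⟪k, x⟫_ℝ : ℂ)) +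
      conj (heisenbergForm ρ h1 Ψ Φ t k) * Complex.exp (-(Complex.I * (⟪k, x⟫_ℝ : ℂ))))

/-- The sesquilinear form `φ_{Φ,Ψ}(t,x)`, the integral of the integrand above over all `k`,
divided by `(2π)^{d/2}`. -/
def fieldForm {d : ℕ} (ρ : Space d → ℝ) (h1 : CondA1 ρ) (Φ Ψ : Fock d) (t : ℝ)
    (x : Space d) : ℂ :=
  (((Real.sqrt (2 * Real.pi)) ^ d : ℝ) : ℂ)⁻¹ * ∫ k : Space d, fieldIntegrand ρ h1 Φ Ψ t x k

/-- `φ_{Φ,Ψ}` is well defined: at every time the vectors `a(k) e^{-itH} Ψ` and `a(k) e^{-itH} Φ`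
exist for almost every `k`, and the integral that defines `φ_{Φ,Ψ}(t,x)` converges absolutely for
all `t` and `x`. -/
def FieldWellDefined {d : ℕ} (ρ : Space d → ℝ) (h1 : CondA1 ρ) (Φ Ψ : Fock d) : Prop :=
  ∀ t : ℝ,
    (∀ᵐ k : Space d, ∃ Θ, IsKernelValue k (expI (hamiltonian ρ h1) (-t) Ψ) Θ) ∧
    (∀ᵐ k : Space d, ∃ Θ, IsKernelValue k (expI (hamiltonian ρ h1) (-t) Φ) Θ) ∧
    ∀ x : Space d, Integrable (fieldIntegrand ρ h1 Φ Ψ t x)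

/-- The wave equation with source, `(∂ₜ² - Δ) φ (t,x) = ρ(x)`, at the point `(t,x)`. -/
def WaveEquationAt {d : ℕ} (ρ : Space d → ℝ) (φ : ℝ → Space d → ℂ) (t : ℝ) (x : Space d) : Prop :=
  iteratedDeriv 2 (fun s => φ s x) t - Laplacian.laplacian (φ t) x = (ρ x : ℂ)

/-- `φ` is a solution of `(∂ₜ² - Δ) φ = ρ` with classical derivatives: it is twice continuously
differentiable on `ℝ × ℝᵈ` and satisfies the equation at all times, for almost every `x` (recall
that `ρ ∈ L¹` is only determined almost everywhere) and at every `x` where `ρ` is continuous. -/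
structure IsWaveSolution {d : ℕ} (ρ : Space d → ℝ) (φ : ℝ → Space d → ℂ) : Prop where
  contDiff : ContDiff ℝ 2 (fun p : ℝ × Space d => φ p.1 p.2)
  ae : ∀ᵐ x : Space d, ∀ t : ℝ, WaveEquationAt ρ φ t x
  of_continuousAt : ∀ x : Space d, ContinuousAt ρ x → ∀ t : ℝ, WaveEquationAt ρ φ t x

end VanHove

end

open VanHove

/-! Put `v = ρ̂ / √(2ω³)`. The dressing operator `U` is a Weyl operator that shifts annihilation
operators by this function: `U* a(k) U = a(k) + v(k)`. Completing the square gives `H = U H₀ U* - κ`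
with `κ = ∫ ω|v|²`, hence `exp(itH) = exp(-itκ) U exp(itH₀) U*`. Everything cancels in the
Heisenberg form and leaves `F_{UΦ,UΨ}(t,k) = exp(-it|k|) (Φ, a(k)Ψ) + v(k) (Φ,Ψ)`. So the field is a
superposition of free waves plus, since `(Φ,Ψ) = 1`, a static field with amplitude `ρ̂/(2ω²)` and
its conjugate. The wave operator kills the free waves. On the static part `-Δ` multiplies by `ω²`,
and what remains is the inverse Fourier transform of `ρ̂`, equal to `ρ` almost everywhere and at
points of continuity.

The operator theory rests on the exponential vectors `e(g)`. They are total (`total_expVec`) and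
eigenvectors of every `a(f)`; the free evolution and the Weyl operators map them to multiples of one
another. A total family in the domain of a generator that its group preserves up to scalars is a
core (`generator_mem_closure`), and a pair that is weakly in the graph against it is in the graph
(`mem_genGraph_of_weak`). These two facts prove that `π_S` is essentially self-adjoint
(`segalPi_closure_graph`) and that `H` is exactly the generator of the dressed free group
(`vanHove_graph`). For the latter `H` must be closed on the intersection of the domains: since `ρ̂/ω
∈ L²`, the interaction is bounded relative to `H₀` with bound less than one.

The vector `a(k)Ψ` makes sense only for almost every `k`. The shift is explicit on exponential
vectors and is carried to the domain of `H₀` by fast limits in the graph norm (`dressed_kernel`).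
The domain of `H₀^(d/2+2)` supplies enough decay in `k` for two derivatives under the integral
(`integrable_inner_annihilationKernel`); smoothness then comes from reading the field as a Fourier
transform over the light cone. -/

noncomputable section

namespace VanHove

/-! ### One-parameter unitary groups: weak derivatives, generators, uniqueness, cores -/

section UnitaryGroups

variable {F : Type*} [NormedAddCommGroup F] [InnerProductSpace ℂ F]

/-- A family of vectors is total when only `0` is orthogonal to all of its members. -/
def Total {X : Type*} (e : X → F) : Prop := ∀ ψ, (∀ x, ⟪e x, ψ⟫_ℂ = 0) → ψ = 0

theorem Total.ext {X : Type*} {e : X → F} (he : Total e) {ψ φ : F}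
    (h : ∀ x, ⟪e x, ψ⟫_ℂ = ⟪e x, φ⟫_ℂ) : ψ = φ :=
  sub_eq_zero.1 (he _ fun x => by rw [inner_sub_right, h x, sub_self])

theorem Total.map {X : Type*} {e : X → F} (he : Total e) (U : F ≃ₗᵢ[ℂ] F) :
    Total fun x => U (e x) := by
  intro ψ h
  have : U.symm ψ = 0 := he _ fun x => by
    rw [← U.inner_map_map, U.apply_symm_apply]; exact h x
  simpa using congrArg U this

theorem Total.dense_span [CompleteSpace F] {X : Type*} {e : X → F} (he : Total e) :
    Dense (Submodule.span ℂ (Set.range e) : Set F) := by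
  rw [Submodule.dense_iff_topologicalClosure_eq_top, Submodule.topologicalClosure_eq_top_iff,
    Submodule.eq_bot_iff]
  intro ψ hψ
  exact he ψ fun x => (Submodule.mem_orthogonal _ _).1 hψ _ (Submodule.subset_span ⟨x, rfl⟩)

/-- A curve that is weakly differentiable against a total family with a norm continuous weak
derivative is differentiable. -/
theorem Total.hasDerivAt [CompleteSpace F] {X : Type*} {e : X → F} (he : Total e)
    {u w : ℝ → F} (hw : Continuous w)
    (h : ∀ x t, HasDerivAt (fun s => ⟪e x, u s⟫_ℂ) ⟪e x, w t⟫_ℂ t) (t : ℝ) :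
    HasDerivAt u (w t) t := by
  -- The fundamental theorem of calculus holds for each matrix element. Totality lifts it to an
  -- identity of vectors, which can be differentiated in norm because `w` is norm continuous.
  have key : ∀ s, u s = u 0 + ∫ r in (0 : ℝ)..s, w r := by
    intro s
    refine he.ext fun x => ?_
    have h1 : ∫ r in (0 : ℝ)..s, ⟪e x, w r⟫_ℂ = ⟪e x, u s⟫_ℂ - ⟪e x, u 0⟫_ℂ :=
      intervalIntegral.integral_eq_sub_of_hasDerivAt (fun r _ => h x r)
        ((continuous_const.inner hw).intervalIntegrable _ _)
    have h2 : ∫ r in (0 : ℝ)..s, ⟪e x, w r⟫_ℂ = ⟪e x, ∫ r in (0 : ℝ)..s, w r⟫_ℂ :=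
      (innerSL ℂ (e x)).intervalIntegral_comp_comm (hw.intervalIntegrable _ _)
    rw [inner_add_right, ← h2, h1]; ring
  have h3 : HasDerivAt (fun s => u 0 + ∫ r in (0 : ℝ)..s, w r) (w t) t :=
    (intervalIntegral.integral_hasDerivAt_right (hw.intervalIntegrable _ _)
      (hw.stronglyMeasurableAtFilter _ _) hw.continuousAt).const_add _
  exact h3.congr_of_eventuallyEq (Eventually.of_forall key)

/-- A one-parameter group of isometries is strongly continuous if it is so on a total family. -/
theorem Total.continuous_group [CompleteSpace F] {X : Type*} {e : X → F} (he : Total e)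
    {V : ℝ → (F ≃ₗᵢ[ℂ] F)} (h : ∀ x, Continuous fun t => V t (e x)) (ψ : F) :
    Continuous fun t => V t ψ := by
  have hspan : ∀ φ ∈ Submodule.span ℂ (Set.range e), Continuous fun t => V t φ := by
    intro φ hφ
    induction hφ using Submodule.span_induction with
    | mem y hy => obtain ⟨x, rfl⟩ := hy; exact h x
    | zero => simpa using continuous_const
    | add y z _ _ hy hz => simp only [map_add]; exact hy.add hz
    | smul c y _ hy => simp only [map_smul]; exact hy.const_smul c
  rw [Metric.continuous_iff']
  intro t ε hε
  obtain ⟨φ, hφ, hd⟩ := Metric.dense_iff.1 he.dense_span ψ (ε / 3) (by positivity)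
  rw [Metric.mem_ball, dist_eq_norm] at hφ
  filter_upwards [Metric.continuous_iff'.1 (hspan φ hd) t (ε / 3) (by positivity)] with s hs
  rw [dist_eq_norm] at hs ⊢
  have h1 : V s ψ - V t ψ = (V s φ - V t φ) - V s (φ - ψ) + V t (φ - ψ) := by
    simp only [map_sub]; abel
  calc ‖V s ψ - V t ψ‖ ≤ ‖V s φ - V t φ‖ + ‖V s (φ - ψ)‖ + ‖V t (φ - ψ)‖ := by
        rw [h1]; exact (norm_add_le _ _).trans (by gcongr; exact norm_sub_le _ _)
    _ < ε := by rw [LinearIsometryEquiv.norm_map, LinearIsometryEquiv.norm_map]; linarith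

variable {A : F →ₗ.[ℂ] F} {V W : ℝ → (F ≃ₗᵢ[ℂ] F)}

theorem group_zero (hV : ∀ s t ψ, V (s + t) ψ = V s (V t ψ)) (ψ : F) : V 0 ψ = ψ := by
  have := hV 0 0 ψ
  rw [add_zero] at this
  exact ((V 0).injective this).symm

theorem group_neg (hV : ∀ s t ψ, V (s + t) ψ = V s (V t ψ)) (t : ℝ) (ψ : F) :
    V t (V (-t) ψ) = ψ := by
  rw [← hV, add_neg_cancel, group_zero hV]

theorem group_inner_left (hV : ∀ s t ψ, V (s + t) ψ = V s (V t ψ)) (t : ℝ) (ψ φ : F) :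
    ⟪V t ψ, φ⟫_ℂ = ⟪ψ, V (-t) φ⟫_ℂ := by
  rw [← (V t).inner_map_map ψ, group_neg hV]

theorem group_hasDerivAt (hV : ∀ s t ψ, V (s + t) ψ = V s (V t ψ)) {ψ η : F}
    (h : HasDerivAt (fun t => V t ψ) η 0) (t : ℝ) :
    HasDerivAt (fun t => V t ψ) (V t η) t := by
  have h1 : HasDerivAt (fun s => V (s - t) ψ) η t := by
    have := HasDerivAt.scomp (g₁ := fun s => V s ψ) (h := fun s : ℝ => s - t) (h' := 1) t
      (by simpa using h) ((hasDerivAt_id t).sub_const t)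
    simpa [Function.comp_def] using this
  have h2 := (V t).toContinuousLinearEquiv.toContinuousLinearMap.restrictScalars ℝ
    |>.hasFDerivAt.comp_hasDerivAt t h1
  refine h2.congr_of_eventuallyEq (Eventually.of_forall fun s => ?_)
  have := hV t (s - t) ψ
  simpa using this

/-- The infinitesimal generator of a group of isometries is symmetric. -/
theorem generator_symmetric (hV : ∀ s t ψ, V (s + t) ψ = V s (V t ψ)) {ψ η ψ' η' : F}
    (h : HasDerivAt (fun t => V t ψ) (Complex.I • η) 0)
    (h' : HasDerivAt (fun t => V t ψ') (Complex.I • η') 0) : ⟪η, ψ'⟫_ℂ = ⟪ψ, η'⟫_ℂ := by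
  have h1 := h.inner ℂ h'
  have h2 : (fun t => ⟪V t ψ, V t ψ'⟫_ℂ) = fun _ => ⟪ψ, ψ'⟫_ℂ := by
    funext t; exact (V t).inner_map_map _ _
  rw [h2, group_zero hV, group_zero hV] at h1
  have h3 := h1.unique (hasDerivAt_const _ _)
  rw [inner_smul_right, inner_smul_left, Complex.conj_I] at h3
  have h4 : Complex.I * (⟪ψ, η'⟫_ℂ - ⟪η, ψ'⟫_ℂ) = 0 := by linear_combination h3
  rcases mul_eq_zero.1 h4 with h5 | h5
  · exact absurd h5 Complex.I_ne_zero
  · exact (sub_eq_zero.1 h5).symm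

/-- The cross term is the real part of `i⟪η, ψ⟫`, and `⟪η, ψ⟫` is real. This is why `A - i` controls
the whole graph norm of a symmetric `A`, the mechanism behind all the self-adjointness arguments
below. -/
theorem norm_sq_sub_I_smul {ψ η : F} (h : ⟪η, ψ⟫_ℂ = ⟪ψ, η⟫_ℂ) :
    ‖η - Complex.I • ψ‖ ^ 2 = ‖η‖ ^ 2 + ‖ψ‖ ^ 2 := by
  rw [@norm_sub_sq ℂ, inner_smul_right, norm_smul, Complex.norm_I, one_mul]
  have him : (⟪η, ψ⟫_ℂ).im = 0 := by
    have := congrArg Complex.im (inner_conj_symm ψ η)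
    rw [h, Complex.conj_im] at this
    rw [h]; linarith
  have : RCLike.re (Complex.I * ⟪η, ψ⟫_ℂ) = 0 := by
    simp [him]
  rw [this]; ring

theorem norm_le_sub_I_smul {ψ η : F} (h : ⟪η, ψ⟫_ℂ = ⟪ψ, η⟫_ℂ) :
    ‖ψ‖ ≤ ‖η - Complex.I • ψ‖ ∧ ‖η‖ ≤ ‖η - Complex.I • ψ‖ := by
  have := norm_sq_sub_I_smul h
  constructor <;> refine le_of_sq_le_sq ?_ (norm_nonneg _) <;>
    nlinarith [sq_nonneg ‖ψ‖, sq_nonneg ‖η‖]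

/-- A unitary group is determined by its densely defined generator. -/
theorem IsUnitaryGroupOf.unique (hV : IsUnitaryGroupOf A V) (hW : IsUnitaryGroupOf A W)
    {X : Type*} {e : X → F} (he : Total e) (hA : ∀ x, e x ∈ A.domain) (hd : Dense (A.domain : Set F))
    (t : ℝ) (ψ : F) : V t ψ = W t ψ := by
  have graphV : ∀ p ∈ A.graph, ∀ s, (V s p.1, V s p.2) ∈ A.graph := by
    rintro ⟨φ, η⟩ hp s
    refine (hV.generator _ _).2 ?_
    have h1 := (hV.generator _ _).1 hp
    have h2 := ((V s).toContinuousLinearEquiv.toContinuousLinearMap.restrictScalars ℝ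
      |>.hasFDerivAt.comp_hasDerivAt 0 h1)
    simp only [ContinuousLinearMap.coe_restrictScalars', ContinuousLinearEquiv.coe_coe,
      LinearIsometryEquiv.coe_toContinuousLinearEquiv, map_smul] at h2
    refine h2.congr_of_eventuallyEq (Eventually.of_forall fun r => ?_)
    simp only [Function.comp_apply]
    rw [← hV.map_add, ← hV.map_add, add_comm]
  have graphW : ∀ p ∈ A.graph, ∀ s, (W s p.1, W s p.2) ∈ A.graph := by
    rintro ⟨φ, η⟩ hp s
    refine (hW.generator _ _).2 ?_
    have h1 := (hW.generator _ _).1 hp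
    have h2 := ((W s).toContinuousLinearEquiv.toContinuousLinearMap.restrictScalars ℝ
      |>.hasFDerivAt.comp_hasDerivAt 0 h1)
    simp only [ContinuousLinearMap.coe_restrictScalars', ContinuousLinearEquiv.coe_coe,
      LinearIsometryEquiv.coe_toContinuousLinearEquiv, map_smul] at h2
    refine h2.congr_of_eventuallyEq (Eventually.of_forall fun r => ?_)
    simp only [Function.comp_apply]
    rw [← hW.map_add, ← hW.map_add, add_comm]
  -- The function `r ↦ ⟪V r ψ, W r φ⟫` is constant on the domain: both groups preserve the graph of
  -- `A`, so the two terms of the derivative cancel by symmetry of `A`.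
  have key : ∀ p ∈ A.graph, ∀ q ∈ A.graph, ⟪V t p.1, W t q.1⟫_ℂ = ⟪p.1, q.1⟫_ℂ := by
    rintro p hp q hq
    have hd : ∀ s, HasDerivAt (fun r => ⟪V r p.1, W r q.1⟫_ℂ) 0 s := by
      intro s
      have h1 := group_hasDerivAt hV.map_add ((hV.generator _ _).1 hp) s
      have h2 := group_hasDerivAt hW.map_add ((hW.generator _ _).1 hq) s
      have h3 := h1.inner ℂ h2
      have h4 := generator_symmetric hV.map_add ((hV.generator _ _).1 (graphV p hp s))
        ((hV.generator _ _).1 (graphW q hq s))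
      rw [map_smul, map_smul, inner_smul_left, inner_smul_right, Complex.conj_I, h4] at h3
      have h5 : Complex.I * ⟪V s p.1, W s q.2⟫_ℂ + -Complex.I * ⟪V s p.1, W s q.2⟫_ℂ = 0 := by ring
      rwa [h5] at h3
    have := is_const_of_deriv_eq_zero (fun s => (hd s).differentiableAt) (fun s => (hd s).deriv) t 0
    simpa only [group_zero hV.map_add, group_zero hW.map_add] using this
  have hdom : ∀ q ∈ A.graph, W t q.1 = V t q.1 := by
    intro q hq
    refine (he.map (V t)).ext fun x => ?_
    obtain ⟨η, hη⟩ := (LinearPMap.mem_domain_iff).1 (hA x)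
    rw [key _ hη q hq, (V t).inner_map_map]
  have hcl := (V t).continuous.ext_on hd (W t).continuous (fun φ hφ => by
    obtain ⟨η, hη⟩ := LinearPMap.mem_domain_iff.1 hφ
    exact (hdom _ hη).symm)
  exact congrFun hcl ψ

/-- If `A` is contained in the generator of `V` and `A - i` is surjective, `A` is the generator. -/
theorem isUnitaryGroupOf_of_surjective (hV : ∀ s t ψ, V (s + t) ψ = V s (V t ψ))
    (hc : ∀ ψ, Continuous fun t => V t ψ)
    (hA : ∀ ψ η, (ψ, η) ∈ A.graph → HasDerivAt (fun t => V t ψ) (Complex.I • η) 0)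
    (hs : ∀ y, ∃ ψ η, (ψ, η) ∈ A.graph ∧ η - Complex.I • ψ = y) : IsUnitaryGroupOf A V := by
  refine ⟨hV, hc, fun ψ η => ⟨hA ψ η, fun h => ?_⟩⟩
  -- Choose the point of the graph of `A` with the same image under `A - i`. The difference of the
  -- two pairs lies in the generator, which is symmetric, and is killed by the generator minus `i`;
  -- the norm bound makes it zero.
  obtain ⟨ψ', η', hmem, heq⟩ := hs (η - Complex.I • ψ)
  have h1 : HasDerivAt (fun t => V t (ψ - ψ')) (Complex.I • (η - η')) 0 := by
    have := h.sub (hA _ _ hmem)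
    rw [← smul_sub] at this
    simp only [map_sub]
    exact this
  have h2 := (norm_le_sub_I_smul (generator_symmetric hV h1 h1))
  have h3 : (η - η') - Complex.I • (ψ - ψ') = 0 := by
    rw [smul_sub]
    have : η - Complex.I • ψ - (η' - Complex.I • ψ') = 0 := by rw [heq, sub_self]
    rw [← this]; abel
  rw [h3, norm_zero, norm_le_zero_iff, norm_le_zero_iff, sub_eq_zero, sub_eq_zero] at h2
  rw [h2.1, h2.2]; exact hmem

/-- For a group-invariant total family in the domain of the generator `G`, the operator `G - i` has
dense range on its span. -/
theorem dense_range_sub_I [CompleteSpace F] (hV : ∀ s t ψ, V (s + t) ψ = V s (V t ψ))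
    {X : Type*} {e g : X → F} (he : Total e)
    (hg : ∀ x, HasDerivAt (fun t => V t (e x)) (Complex.I • g x) 0)
    (hinv : ∀ x t, ∃ (y : X) (c : ℂ), V t (e x) = c • e y) :
    Total fun x => g x - Complex.I • e x := by
  intro η h
  refine he η fun x => ?_
  have hgen : ∀ t y (c : ℂ), V t (e x) = c • e y → V t (g x) = c • g y := by
    intro t y c hy
    have h1 := group_hasDerivAt hV (hg x) t
    have h2 : HasDerivAt (fun s => V s (c • e y)) (V t (Complex.I • g x)) 0 := by
      rw [← hy]
      have := HasDerivAt.scomp (g₁ := fun s => V s (e x)) (h := fun s : ℝ => s + t) (h' := 1) 0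
        (by simpa using h1) ((hasDerivAt_id (0 : ℝ)).add_const t)
      simpa only [Function.comp_def, hV, one_smul, zero_add, map_smul] using this
    have h3 := (hg y).const_smul c
    simp only [map_smul] at h2
    have h4 := h2.unique h3
    rw [smul_comm c] at h4
    exact smul_right_injective F Complex.I_ne_zero h4
  -- The orbit of `e x` stays in the family up to scalars, so the orthogonality `h` holds along the
  -- whole orbit and becomes the differential equation `y' = -y` for the matrix element.
  have hy : ∀ t, HasDerivAt (fun s => ⟪V s (e x), η⟫_ℂ) (-⟪V t (e x), η⟫_ℂ) t := by
    intro t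
    have h1 := (group_hasDerivAt hV (hg x) t).inner ℂ (hasDerivAt_const t η)
    obtain ⟨y, c, hyc⟩ := hinv x t
    suffices hs : ⟪V t (e x), (0 : F)⟫_ℂ + ⟪V t (Complex.I • g x), η⟫_ℂ = -⟪V t (e x), η⟫_ℂ by
      rwa [hs] at h1
    rw [map_smul, hgen t y c hyc, hyc, inner_zero_right, zero_add]
    have h2 := h y
    rw [inner_sub_left, inner_smul_left, Complex.conj_I] at h2
    simp only [inner_smul_left, Complex.conj_I]
    linear_combination -(starRingEnd ℂ c) * (Complex.I) * h2 +
      (starRingEnd ℂ c) * ⟪e y, η⟫_ℂ * Complex.I_sq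
  have hconst : ∀ t : ℝ, ⟪V t (e x), η⟫_ℂ = Complex.exp (-t) * ⟪e x, η⟫_ℂ := by
    intro t
    have hd : ∀ s : ℝ, HasDerivAt (fun r : ℝ => Complex.exp r * ⟪V r (e x), η⟫_ℂ) 0 s := by
      intro s
      have h1 : HasDerivAt (fun r : ℝ => Complex.exp (r : ℂ)) (Complex.exp (s : ℂ)) s := by
        have := (Complex.ofRealCLM.hasDerivAt (x := s)).cexp
        simpa using this
      have h2 := h1.mul (hy s)
      rw [mul_neg, add_neg_cancel] at h2
      exact h2
    have := is_const_of_deriv_eq_zero (fun s => (hd s).differentiableAt) (fun s => (hd s).deriv) t 0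
    simp only [group_zero hV, Complex.ofReal_zero, Complex.exp_zero, one_mul] at this
    rw [← this, ← mul_assoc, ← Complex.exp_add, neg_add_cancel, Complex.exp_zero, one_mul]
  by_contra hne
  -- The solution `exp(-t) y(0)` grows without bound as `t → -∞`, whereas matrix elements of
  -- isometries are bounded. Hence `y(0) = 0`.
  have hb : ∀ t : ℝ, Real.exp (-t) * ‖⟪e x, η⟫_ℂ‖ ≤ ‖e x‖ * ‖η‖ := by
    intro t
    have h1 := norm_inner_le_norm (𝕜 := ℂ) (V t (e x)) η
    rw [hconst t, (V t).norm_map, norm_mul, Complex.norm_exp, Complex.neg_re, Complex.ofReal_re] at h1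
    exact h1
  have hlim : Tendsto (fun t : ℝ => Real.exp t * ‖⟪e x, η⟫_ℂ‖) atTop atTop :=
    Real.tendsto_exp_atTop.atTop_mul_const (norm_pos_iff.2 hne)
  obtain ⟨t, ht⟩ := (hlim.eventually (eventually_gt_atTop (‖e x‖ * ‖η‖))).exists
  have hb' := hb (-t)
  rw [neg_neg] at hb'
  exact absurd hb' (not_le.2 ht)

/-- For a group-invariant total family in the domain of the generator `G`, the graph of `G` is the
closed span of the graph over the family. -/
theorem generator_mem_closure [CompleteSpace F] (hV : ∀ s t ψ, V (s + t) ψ = V s (V t ψ))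
    {X : Type*} {e g : X → F} (he : Total e)
    (hg : ∀ x, HasDerivAt (fun t => V t (e x)) (Complex.I • g x) 0)
    (hinv : ∀ x t, ∃ (y : X) (c : ℂ), V t (e x) = c • e y) {ψ η : F}
    (h : HasDerivAt (fun t => V t ψ) (Complex.I • η) 0) :
    (ψ, η) ∈ (Submodule.span ℂ (Set.range fun x => (e x, g x))).topologicalClosure := by
  have hspan : ∀ p ∈ Submodule.span ℂ (Set.range fun x => (e x, g x)),
      HasDerivAt (fun t => V t p.1) (Complex.I • p.2) 0 := by
    intro p hp
    induction hp using Submodule.span_induction with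
    | mem y hy => obtain ⟨x, rfl⟩ := hy; exact hg x
    | zero => simpa using hasDerivAt_const (0 : ℝ) (0 : F)
    | add y z _ _ hy hz =>
      simp only [Prod.fst_add, Prod.snd_add, map_add, smul_add]; exact hy.add hz
    | smul c y _ hy =>
      simp only [Prod.smul_fst, Prod.smul_snd, map_smul, smul_comm Complex.I c]
      exact hy.const_smul c
  have hdense := (dense_range_sub_I hV he hg hinv).dense_span
  rw [← SetLike.mem_coe, Submodule.topologicalClosure_coe, Metric.mem_closure_iff]
  intro ε hε
  -- Approximating `η - iψ` within the range of the span suffices: the difference is again in the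
  -- symmetric generator, so closeness after applying `G - i` is closeness in both components.
  obtain ⟨y, hyd, hy⟩ := Metric.dense_iff.1 hdense (η - Complex.I • ψ) ε hε
  let T : F × F →ₗ[ℂ] F := LinearMap.snd ℂ F F - Complex.I • LinearMap.fst ℂ F F
  have hmap : (Submodule.span ℂ (Set.range fun x => (e x, g x))).map T =
      Submodule.span ℂ (Set.range fun x => g x - Complex.I • e x) := by
    rw [Submodule.map_span, ← Set.range_comp]; rfl
  rw [SetLike.mem_coe, ← hmap] at hy
  obtain ⟨p, hp, rfl⟩ := hy
  refine ⟨p, hp, ?_⟩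
  have h1 : HasDerivAt (fun t => V t (ψ - p.1)) (Complex.I • (η - p.2)) 0 := by
    have := h.sub (hspan p hp)
    rw [← smul_sub] at this
    simp only [map_sub]
    exact this
  have h2 := norm_le_sub_I_smul (generator_symmetric hV h1 h1)
  have h3 : ‖(η - p.2) - Complex.I • (ψ - p.1)‖ < ε := by
    rw [Metric.mem_ball, dist_comm, dist_eq_norm] at hyd
    have h4 : η - p.2 - Complex.I • (ψ - p.1) = η - Complex.I • ψ - T p := by
      change _ = η - Complex.I • ψ - (p.2 - Complex.I • p.1)
      rw [smul_sub]
      abel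
    rwa [h4]
  rw [Prod.dist_eq, dist_eq_norm, dist_eq_norm]
  exact max_lt (h2.1.trans_lt h3) (h2.2.trans_lt h3)

/-- Two families with the same Gram matrix, the first one total, are related by an isometry. -/
theorem exists_isometry_of_inner_eq [CompleteSpace F] {X : Type*} {e e' : X → F} (he : Total e)
    (h : ∀ x y, ⟪e' x, e' y⟫_ℂ = ⟪e x, e y⟫_ℂ) : ∃ T : F →ₗᵢ[ℂ] F, ∀ x, T (e x) = e' x := by
  -- The map is defined on formal combinations, where no well-definedness question arises. Equal
  -- Gram matrices give equal norms, so it descends to the dense range and extends.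
  let L := Finsupp.linearCombination ℂ e
  let L' := Finsupp.linearCombination ℂ e'
  have hinner : ∀ c, ⟪L' c, L' c⟫_ℂ = ⟪L c, L c⟫_ℂ := by
    intro c
    simp only [L, L', Finsupp.linearCombination_apply, Finsupp.sum, sum_inner, inner_sum,
      inner_smul_left, inner_smul_right, h]
  have hnorm : ∀ c, ‖L' c‖ = ‖L c‖ := by
    intro c
    rw [@norm_eq_sqrt_re_inner ℂ, @norm_eq_sqrt_re_inner ℂ, hinner c]
  have hd : DenseRange L := by
    have := he.dense_span
    rw [← Finsupp.range_linearCombination] at this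
    exact this
  let T := L'.extendOfNorm L
  have hT : ∀ c, T (L c) = L' c :=
    LinearMap.extendOfNorm_eq hd ⟨1, fun c => by rw [one_mul, hnorm c]⟩
  refine ⟨⟨T.toLinearMap, ?_⟩, fun x => ?_⟩
  · intro ψ
    refine hd.induction_on (p := fun ψ => ‖T ψ‖ = ‖ψ‖) ψ (isClosed_eq (by fun_prop) (by fun_prop))
      (fun c => by rw [hT, hnorm])
  · have := hT (Finsupp.single x 1)
    simpa [L, L'] using this

end UnitaryGroups

/-! ### Fock space sector by sector: annihilation, creation, commutation relation -/

section FockSpace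

open scoped ENNReal

variable {d n : ℕ}

/-- The symmetric functions are the common fixed points of the isometries induced by permutations.
Closedness gives completeness of each sector. -/
theorem isClosed_symL2 (d n : ℕ) : IsClosed (SymL2 d n : Set (L2n d n)) := by
  have h : (SymL2 d n : Set (L2n d n)) =
      ⋂ σ : Equiv.Perm (Fin n), {f | Lp.compMeasurePreserving _ (measurePreserving_perm d σ) f = f} := by
    ext f
    simp only [SetLike.mem_coe, Set.mem_iInter, Set.mem_ofPred_eq]
    refine forall_congr' fun σ => ?_
    constructor
    · intro hf
      exact Lp.ext ((Lp.coeFn_compMeasurePreserving f (measurePreserving_perm d σ)).trans hf)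
    · intro hf
      have := Lp.coeFn_compMeasurePreserving f (measurePreserving_perm d σ)
      rw [hf] at this
      exact this.symm
  rw [h]
  have : Fact ((1 : ℝ≥0∞) ≤ 2) := ⟨by norm_num⟩
  exact isClosed_iInter fun σ =>
    isClosed_eq (Lp.isometry_compMeasurePreserving (measurePreserving_perm d σ)).continuous
      continuous_id

instance completeSpace_symL2 (d n : ℕ) : CompleteSpace (SymL2 d n) :=
  (isClosed_symL2 d n).completeSpace_coe

theorem enorm_sq_Lp {α : Type*} [MeasurableSpace α] {μ : Measure α} (f : Lp ℂ 2 μ) :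
    ‖f‖ₑ ^ 2 = ∫⁻ x, ‖f x‖ₑ ^ 2 ∂μ := by
  rw [Lp.enorm_def, eLpNorm_eq_lintegral_rpow_enorm_toReal (by norm_num) (by norm_num)]
  simp only [ENNReal.toReal_ofNat, ENNReal.rpow_ofNat]
  rw [← ENNReal.rpow_natCast, ← ENNReal.rpow_mul]
  norm_num

theorem memLp_two_of_lintegral {α : Type*} [MeasurableSpace α] {μ : Measure α} {f : α → ℂ}
    (hf : AEStronglyMeasurable f μ) (h : ∫⁻ x, ‖f x‖ₑ ^ 2 ∂μ ≠ ⊤) : MemLp f 2 μ := by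
  refine ⟨hf, ?_⟩
  rw [eLpNorm_eq_lintegral_rpow_enorm_toReal (by norm_num) (by norm_num)]
  simp only [ENNReal.toReal_ofNat, ENNReal.rpow_ofNat]
  exact ENNReal.rpow_lt_top_of_nonneg (by norm_num) h

theorem lintegral_sq_of_memLp {α : Type*} [MeasurableSpace α] {μ : Measure α} {f : α → ℂ}
    (hf : MemLp f 2 μ) : ∫⁻ x, ‖f x‖ₑ ^ 2 ∂μ ≠ ⊤ := by
  have h := enorm_sq_Lp (hf.toLp f)
  have h2 : ∫⁻ x, ‖f x‖ₑ ^ 2 ∂μ = ‖hf.toLp f‖ₑ ^ 2 := by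
    rw [h]; refine lintegral_congr_ae ?_
    filter_upwards [hf.coeFn_toLp] with x hx; rw [hx]
  rw [h2]; finiteness

theorem lintegral_mul_sq_le {α : Type*} [MeasurableSpace α] {μ : Measure α} {F G : α → ℝ≥0∞}
    (hF : AEMeasurable F μ) (hG : AEMeasurable G μ) :
    (∫⁻ x, F x * G x ∂μ) ^ 2 ≤ (∫⁻ x, F x ^ 2 ∂μ) * ∫⁻ x, G x ^ 2 ∂μ := by
  have h := ENNReal.lintegral_mul_le_Lp_mul_Lq μ Real.HolderConjugate.two_two hF hG
  calc (∫⁻ x, F x * G x ∂μ) ^ 2 ≤ _ := pow_le_pow_left' h 2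
    _ = _ := by
      simp only [ENNReal.rpow_ofNat]
      rw [mul_pow]
      congr 1 <;> (rw [← ENNReal.rpow_natCast, ← ENNReal.rpow_mul]; norm_num)

/-- A square integrable symmetric function is a vector of `L²_sym`. -/
theorem exists_symL2 {f : (Fin n → Space d) → ℂ} (hf : MemLp f 2 volume)
    (hs : ∀ σ : Equiv.Perm (Fin n), (fun k => f fun i => k (σ i)) =ᵐ[volume] f) :
    ∃ u : SymL2 d n, ((u : L2n d n) : (Fin n → Space d) → ℂ) =ᵐ[volume] f := by
  refine ⟨⟨hf.toLp f, fun σ => ?_⟩, hf.coeFn_toLp⟩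
  have h0 := hf.coeFn_toLp
  have h1 := (measurePreserving_perm d σ).quasiMeasurePreserving.ae h0
  filter_upwards [h0, h1, hs σ] with k hk hk1 h2
  rw [hk, hk1]; exact h2

theorem symL2_ext {u v : SymL2 d n}
    (h : ((u : L2n d n) : (Fin n → Space d) → ℂ) =ᵐ[volume] (v : L2n d n)) : u = v :=
  Subtype.ext (Lp.ext h)

theorem symL2_symm (u : SymL2 d n) (σ : Equiv.Perm (Fin n)) :
    ∀ᵐ k : Fin n → Space d, (u : L2n d n) (fun i => k (σ i)) = (u : L2n d n) k := u.2 σ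

theorem comp_symm (Ψ : Fock d) (n : ℕ) (σ : Equiv.Perm (Fin n)) :
    ∀ᵐ k : Fin n → Space d, comp Ψ n (fun i => k (σ i)) = comp Ψ n k := (Ψ n).2 σ

theorem enorm_sq_symL2 (u : SymL2 d n) : ‖u‖ₑ ^ 2 = ∫⁻ k, ‖(u : L2n d n) k‖ₑ ^ 2 := by
  rw [← enorm_sq_Lp]; rfl

theorem inner_symL2 (u v : SymL2 d n) :
    ⟪u, v⟫_ℂ = ∫ k, conj ((u : L2n d n) k) * (v : L2n d n) k := by
  rw [Submodule.coe_inner, L2.inner_def]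
  simp only [RCLike.inner_apply, mul_comm]

theorem exists_fock (u : (n : ℕ) → SymL2 d n) (h : ∑' n, ‖u n‖ₑ ^ 2 ≠ ⊤) :
    ∃ Ψ : Fock d, ∀ n, Ψ n = u n := by
  refine ⟨⟨u, ?_⟩, fun n => rfl⟩
  refine memℓp_gen ?_
  have h2 : ∀ n, ‖u n‖ ^ (2 : ℝ≥0∞).toReal = (‖u n‖ₑ ^ 2).toReal := by
    intro n; simp
  simp only [h2]
  exact ENNReal.summable_toReal h

theorem fock_norm_sq (Ψ : Fock d) : ‖Ψ‖ₑ ^ 2 = ∑' n, ‖Ψ n‖ₑ ^ 2 := by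
  have h := lp.norm_rpow_eq_tsum (p := 2) (by norm_num) Ψ
  have hs := (lp.memℓp Ψ).summable (by norm_num)
  simp only [ENNReal.toReal_ofNat, Real.rpow_ofNat] at h hs
  have h1 : ∀ x : ℝ, 0 ≤ x → ENNReal.ofReal x ^ 2 = ENNReal.ofReal (x ^ 2) := fun x hx =>
    (ENNReal.ofReal_pow hx 2).symm
  rw [← ofReal_norm, h1 _ (norm_nonneg _), h,
    ENNReal.ofReal_tsum_of_nonneg (fun n => by positivity) hs]
  refine tsum_congr fun n => ?_
  rw [← h1 _ (norm_nonneg _), ofReal_norm]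

theorem fock_norm_sq' (Ψ : Fock d) : ‖Ψ‖ₑ ^ 2 = ∑' n, ∫⁻ k, ‖comp Ψ n k‖ₑ ^ 2 := by
  rw [fock_norm_sq]
  exact tsum_congr fun n => enorm_sq_symL2 (Ψ n)

/-- Vectors given by component formulas are built with this. Working with extended nonnegative
integrals leaves a single finiteness condition to check. -/
theorem exists_fock_of_comp (f : (n : ℕ) → (Fin n → Space d) → ℂ)
    (hf : ∀ n, AEStronglyMeasurable (f n) volume)
    (hs : ∀ n, ∀ σ : Equiv.Perm (Fin n), (fun k => f n fun i => k (σ i)) =ᵐ[volume] f n)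
    (h : ∑' n, ∫⁻ k, ‖f n k‖ₑ ^ 2 ≠ ⊤) : ∃ Ψ : Fock d, ∀ n, comp Ψ n =ᵐ[volume] f n := by
  have hm : ∀ n, MemLp (f n) 2 volume := fun n =>
    memLp_two_of_lintegral (hf n) (ENNReal.ne_top_of_tsum_ne_top h n)
  choose u hu using fun n => exists_symL2 (hm n) (hs n)
  obtain ⟨Ψ, hΨ⟩ := exists_fock u (by
    convert h using 3 with n
    rw [enorm_sq_symL2]
    exact lintegral_congr_ae (by filter_upwards [hu n] with k hk; rw [hk]))
  refine ⟨Ψ, fun n => ?_⟩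
  rw [comp, hΨ n]; exact hu n

theorem comp_sub (Ψ Φ : Fock d) (n : ℕ) :
    comp (Ψ - Φ) n =ᵐ[volume] fun k => comp Ψ n k - comp Φ n k :=
  Lp.coeFn_sub ((Ψ n : SymL2 d n) : L2n d n) ((Φ n : SymL2 d n) : L2n d n)

theorem lintegral_perm (σ : Equiv.Perm (Fin n)) (F : (Fin n → Space d) → ℝ≥0∞)
    (hF : AEMeasurable F) : ∫⁻ k : Fin n → Space d, F (fun i => k (σ i)) = ∫⁻ k, F k := by
  have hT := measurePreserving_perm d σ
  conv_rhs => rw [← hT.map_eq]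
  rw [lintegral_map' (by rw [hT.map_eq]; exact hF) hT.aemeasurable]

theorem integral_perm (σ : Equiv.Perm (Fin n)) (F : (Fin n → Space d) → ℂ)
    (hF : AEStronglyMeasurable F) :
    ∫ k : Fin n → Space d, F (fun i => k (σ i)) = ∫ k, F k := by
  have hT := measurePreserving_perm d σ
  conv_rhs => rw [← hT.map_eq]
  rw [integral_map hT.aemeasurable (by rw [hT.map_eq]; exact hF)]

theorem lintegral_cons (F : (Fin (n + 1) → Space d) → ℝ≥0∞) (hF : AEMeasurable F) :
    ∫⁻ k, F k = ∫⁻ k : Fin n → Space d, ∫⁻ q : Space d, F (Fin.cons q k) := by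
  have hT := measurePreserving_cons d n
  conv_lhs => rw [← hT.map_eq]
  rw [lintegral_map' (by rw [hT.map_eq]; exact hF) hT.aemeasurable]
  exact lintegral_prod _ (hF.comp_quasiMeasurePreserving hT.quasiMeasurePreserving)

theorem lintegral_cons' (F : (Fin (n + 1) → Space d) → ℝ≥0∞) (hF : AEMeasurable F) :
    ∫⁻ k, F k = ∫⁻ q : Space d, ∫⁻ k : Fin n → Space d, F (Fin.cons q k) := by
  have hT := measurePreserving_cons d n
  conv_lhs => rw [← hT.map_eq]
  rw [lintegral_map' (by rw [hT.map_eq]; exact hF) hT.aemeasurable]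
  exact lintegral_prod_symm _ (hF.comp_quasiMeasurePreserving hT.quasiMeasurePreserving)

theorem integral_cons (F : (Fin (n + 1) → Space d) → ℂ) (hF : Integrable F) :
    ∫ k, F k = ∫ k : Fin n → Space d, ∫ q : Space d, F (Fin.cons q k) := by
  have hT := measurePreserving_cons d n
  conv_lhs => rw [← hT.map_eq]
  rw [integral_map hT.aemeasurable (by rw [hT.map_eq]; exact hF.1)]
  exact integral_prod _ ((hT.integrable_comp hF.1).2 hF)

theorem ae_cons' {P : (Fin (n + 1) → Space d) → Prop} (h : ∀ᵐ k, P k) :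
    ∀ᵐ q : Space d, ∀ᵐ k : Fin n → Space d, P (Fin.cons q k) := by
  have h1 := (measurePreserving_cons d n).quasiMeasurePreserving.ae h
  have h2 := (Measure.measurePreserving_swap (μ := (volume : Measure (Space d)))
    (ν := (volume : Measure (Fin n → Space d)))).quasiMeasurePreserving.ae h1
  exact Measure.ae_ae_of_ae_prod h2

/-- The permutation of `n + 1` indices that fixes `0` and acts as `σ` on the others. -/
theorem exists_perm_succ (σ : Equiv.Perm (Fin n)) :
    ∃ τ : Equiv.Perm (Fin (n + 1)), ∀ (q : Space d) (k : Fin n → Space d),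
      (fun i => (Fin.cons q k : Fin (n + 1) → Space d) (τ i)) = Fin.cons q fun i => k (σ i) := by
  refine ⟨Equiv.Perm.decomposeFin.symm (0, σ), fun q k => ?_⟩
  funext i
  refine Fin.cases ?_ (fun i => ?_) i
  · simp
  · simp

/-- `σ` carries the complement of `j` onto the complement of `σ j`. The induced relabelling `τ` is
what the symmetry of the remaining factor must absorb in the creation formula. -/
theorem exists_perm_succAbove (σ : Equiv.Perm (Fin (n + 1))) (j : Fin (n + 1)) :
    ∃ τ : Equiv.Perm (Fin n), ∀ i, σ (j.succAbove i) = (σ j).succAbove (τ i) := by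
  have h : ∀ i, ∃ i', (σ j).succAbove i' = σ (j.succAbove i) := fun i =>
    Fin.exists_succAbove_eq (fun h => Fin.succAbove_ne j i (σ.injective h))
  choose τ hτ using h
  have hinj : Function.Injective τ := by
    intro a b hab
    have := (hτ a).symm.trans ((congrArg _ hab).trans (hτ b))
    exact Fin.succAbove_right_injective (σ.injective this)
  exact ⟨Equiv.ofBijective τ (Finite.injective_iff_bijective.1 hinj), fun i => (hτ i).symm⟩

theorem memLp_comp_cons (u : L2n d (n + 1)) :
    AEStronglyMeasurable (fun p : (Fin n → Space d) × Space d =>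
      u (Fin.cons p.2 p.1)) (volume.prod volume) :=
  ((Lp.aestronglyMeasurable u).comp_quasiMeasurePreserving
    (measurePreserving_cons d n).quasiMeasurePreserving)

/-- The density of the annihilation operator applied to a function of `n + 1` momenta. -/
def annihFun (f : Lp ℂ 2 (volume : Measure (Space d))) (u : (Fin (n + 1) → Space d) → ℂ)
    (k : Fin n → Space d) : ℂ :=
  (Real.sqrt (n + 1) : ℂ) * ∫ q : Space d, conj (f q) * u (Fin.cons q k)

theorem enorm_sqrt_sq (n : ℕ) : ‖(Real.sqrt (n + 1) : ℂ)‖ₑ ^ 2 = (n + 1 : ℝ≥0∞) := by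
  rw [← enorm_pow, ← Complex.ofReal_pow, Real.sq_sqrt (by positivity)]
  rw [show (((n : ℝ) + 1 : ℝ) : ℂ) = ((n + 1 : ℕ) : ℂ) by push_cast; ring, ← ofReal_norm,
    Complex.norm_natCast, ENNReal.ofReal_natCast]
  push_cast; rfl

/-- By symmetry every momentum may be swapped into position `0`. The factor `n + 1` is the square of
the one in the annihilation operator, so weights on the removed momentum become second quantized
weights. -/
theorem lintegral_weight_sum (u : SymL2 d (n + 1)) {w : Space d → ℝ≥0∞} (hw : Measurable w) :
    ∫⁻ k, (∑ j, w (k j)) * ‖(u : L2n d (n + 1)) k‖ₑ ^ 2 =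
      (n + 1) * ∫⁻ k : Fin (n + 1) → Space d, w (k 0) * ‖(u : L2n d (n + 1)) k‖ₑ ^ 2 := by
  have hm : ∀ j, AEMeasurable (fun k : Fin (n + 1) → Space d =>
      w (k j) * ‖(u : L2n d (n + 1)) k‖ₑ ^ 2) := fun j =>
    (hw.comp (measurable_pi_apply j)).aemeasurable.mul
      ((Lp.aestronglyMeasurable _).enorm.pow_const 2)
  have hterm : ∀ j : Fin (n + 1), ∫⁻ k : Fin (n + 1) → Space d,
      w (k j) * ‖(u : L2n d (n + 1)) k‖ₑ ^ 2 =
      ∫⁻ k : Fin (n + 1) → Space d, w (k 0) * ‖(u : L2n d (n + 1)) k‖ₑ ^ 2 := by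
    intro j
    rw [← lintegral_perm (Equiv.swap 0 j) _ (hm j)]
    refine lintegral_congr_ae ?_
    filter_upwards [symL2_symm u (Equiv.swap 0 j)] with k hk
    rw [hk, Equiv.swap_apply_right]
  simp only [Finset.sum_mul]
  rw [lintegral_finsetSum' _ fun j _ => hm j]
  simp [hterm]

/-- A weighted Cauchy-Schwarz bound for the annihilation operator. -/
theorem lintegral_annihFun_le (f : Lp ℂ 2 (volume : Measure (Space d))) (u : SymL2 d (n + 1))
    {w : Space d → ℝ≥0∞} (hw : Measurable w) (hw0 : ∀ᵐ q, w q ≠ 0) (hwt : ∀ q, w q ≠ ⊤) :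
    ∫⁻ k, ‖annihFun f (u : L2n d (n + 1)) k‖ₑ ^ 2 ≤ (∫⁻ q, ‖f q‖ₑ ^ 2 / w q ^ 2) *
      ∫⁻ k, (∑ j, w (k j) ^ 2) * ‖(u : L2n d (n + 1)) k‖ₑ ^ 2 := by
  have hu : AEMeasurable (fun k : Fin (n + 1) → Space d =>
      w (k 0) ^ 2 * ‖(u : L2n d (n + 1)) k‖ₑ ^ 2) :=
    ((hw.comp (measurable_pi_apply 0)).pow_const 2).aemeasurable.mul
      ((Lp.aestronglyMeasurable _).enorm.pow_const 2)
  have hu' : AEMeasurable (fun p : (Fin n → Space d) × Space d =>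
      w p.2 ^ 2 * ‖(u : L2n d (n + 1)) (Fin.cons p.2 p.1)‖ₑ ^ 2) (volume.prod volume) :=
    ((hw.comp measurable_snd).pow_const 2).aemeasurable.mul
      ((memLp_comp_cons _).enorm.pow_const 2)
  rw [lintegral_weight_sum u (hw.pow_const 2), lintegral_cons _ hu]
  simp only [Fin.cons_zero]
  rw [mul_left_comm, ← lintegral_const_mul'' _ hu'.lintegral_prod_right',
    ← lintegral_const_mul'' _ (hu'.lintegral_prod_right'.const_mul _)]
  refine lintegral_mono_ae ?_
  have hslice := (memLp_comp_cons (u : L2n d (n + 1))).prodMk_left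
  filter_upwards [hslice] with k hk
  rw [annihFun, enorm_mul, mul_pow, enorm_sqrt_sq]
  gcongr
  -- Insert `w / w` and apply Cauchy-Schwarz in the removed momentum.
  calc ‖∫ q : Space d, conj (f q) * (u : L2n d (n + 1)) (Fin.cons q k)‖ₑ ^ 2
      ≤ (∫⁻ q, (‖f q‖ₑ / w q) * (w q * ‖(u : L2n d (n + 1)) (Fin.cons q k)‖ₑ)) ^ 2 := by
        refine pow_le_pow_left' ((enorm_integral_le_lintegral_enorm _).trans
          (lintegral_mono_ae ?_)) 2
        filter_upwards [hw0] with q hq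
        rw [enorm_mul, ← mul_assoc, ENNReal.div_mul_cancel hq (hwt q)]
        simp
    _ ≤ _ := by
        refine (lintegral_mul_sq_le ?_ ?_).trans_eq ?_
        · exact (Lp.aestronglyMeasurable f).enorm.div hw.aemeasurable
        · exact hw.aemeasurable.mul hk.enorm
        · congr 1
          · refine lintegral_congr fun q => ?_
            rw [div_eq_mul_inv, mul_pow, div_eq_mul_inv, ENNReal.inv_pow]
          · refine lintegral_congr fun q => ?_
            rw [mul_pow]

theorem aestronglyMeasurable_annihFun (f : Lp ℂ 2 (volume : Measure (Space d)))
    (u : L2n d (n + 1)) : AEStronglyMeasurable (annihFun f u : (Fin n → Space d) → ℂ) := by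
  have h : AEStronglyMeasurable (fun p : (Fin n → Space d) × Space d =>
      conj (f p.2) * u (Fin.cons p.2 p.1)) (volume.prod volume) :=
    (Complex.continuous_conj.comp_aestronglyMeasurable (Lp.aestronglyMeasurable f)).comp_snd.mul
      (memLp_comp_cons u)
  exact h.integral_prod_right'.const_mul _

theorem annihFun_symm (f : Lp ℂ 2 (volume : Measure (Space d))) (u : SymL2 d (n + 1))
    (σ : Equiv.Perm (Fin n)) :
    (fun k : Fin n → Space d => annihFun f (u : L2n d (n + 1)) fun i => k (σ i)) =ᵐ[volume]
      annihFun f (u : L2n d (n + 1)) := by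
  obtain ⟨τ, hτ⟩ := exists_perm_succ (d := d) σ
  filter_upwards [ae_cons (symL2_symm u τ)] with k hk
  rw [annihFun, annihFun]
  congr 1
  refine integral_congr_ae ?_
  filter_upwards [hk] with q hq
  rw [← hq, hτ]

theorem exists_annih (f : Lp ℂ 2 (volume : Measure (Space d))) (u : SymL2 d (n + 1)) :
    ∃ v : SymL2 d n, ((v : L2n d n) : (Fin n → Space d) → ℂ) =ᵐ[volume]
      annihFun f (u : L2n d (n + 1)) := by
  refine exists_symL2 (memLp_two_of_lintegral (aestronglyMeasurable_annihFun f _) ?_)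
    (annihFun_symm f u)
  -- With weight `1` the sum of the weights is the particle number `n + 1`, constant on the sector,
  -- so annihilation is bounded there.
  refine ne_top_of_le_ne_top ?_ (lintegral_annihFun_le f u (w := fun _ => 1) measurable_const
    (by simp) (by simp))
  simp only [one_pow, div_one, Finset.sum_const, Finset.card_univ, Fintype.card_fin, nsmul_eq_mul,
    mul_one]
  rw [lintegral_const_mul' _ _ (by simp), ← enorm_sq_symL2, ← enorm_sq_Lp]
  finiteness

/-- The annihilation operator from `n + 1` to `n` particles. -/
def annih (f : Lp ℂ 2 (volume : Measure (Space d))) (n : ℕ) (u : SymL2 d (n + 1)) : SymL2 d n :=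
  (exists_annih f u).choose

theorem coe_annih (f : Lp ℂ 2 (volume : Measure (Space d))) (u : SymL2 d (n + 1)) :
    ((annih f n u : L2n d n) : (Fin n → Space d) → ℂ) =ᵐ[volume]
      annihFun f (u : L2n d (n + 1)) := (exists_annih f u).choose_spec

/-- The creation operator applied to a function of `n` momenta. -/
def creatFun (f : Lp ℂ 2 (volume : Measure (Space d))) (u : (Fin n → Space d) → ℂ)
    (k : Fin (n + 1) → Space d) : ℂ :=
  ((Real.sqrt (n + 1) : ℂ))⁻¹ * ∑ j : Fin (n + 1), f (k j) * u (fun i => k (j.succAbove i))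

theorem memLp_creat_term (f : Lp ℂ 2 (volume : Measure (Space d))) (u : L2n d n)
    (j : Fin (n + 1)) :
    MemLp (fun k : Fin (n + 1) → Space d => f (k j) * u (fun i => k (j.succAbove i))) 2 := by
  have h : MemLp (fun p : Space d × (Fin n → Space d) => f p.1 * u p.2) 2
      (volume.prod volume) := by
    have hm : AEStronglyMeasurable (fun p : Space d × (Fin n → Space d) => f p.1 * u p.2)
        (volume.prod volume) :=
      (Lp.aestronglyMeasurable f).comp_fst.mul (Lp.aestronglyMeasurable u).comp_snd
    rw [memLp_two_iff_integrable_sq_norm hm]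
    simp only [norm_mul, mul_pow]
    exact Integrable.mul_prod
      ((memLp_two_iff_integrable_sq_norm (Lp.aestronglyMeasurable f)).1 (Lp.memLp f))
      ((memLp_two_iff_integrable_sq_norm (Lp.aestronglyMeasurable u)).1 (Lp.memLp u))
  exact h.comp_measurePreserving (volume_preserving_piFinSuccAbove (fun _ : Fin (n + 1) => Space d) j)

/-- A permutation of the momenta permutes the summands of the creation formula; the rearrangement
left over inside each summand is absorbed by the symmetry of `u`. -/
theorem exists_creat (f : Lp ℂ 2 (volume : Measure (Space d))) (u : SymL2 d n) :
    ∃ v : SymL2 d (n + 1), ((v : L2n d (n + 1)) : (Fin (n + 1) → Space d) → ℂ) =ᵐ[volume]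
      creatFun f (u : L2n d n) := by
  refine exists_symL2 ?_ fun σ => ?_
  · exact (memLp_finsetSum _ fun j _ => memLp_creat_term f (u : L2n d n) j).const_mul _
  · choose τ hτ using fun j => exists_perm_succAbove σ j
    have h : ∀ᵐ k : Fin (n + 1) → Space d, ∀ j : Fin (n + 1),
        (u : L2n d n) (fun i => (fun i => k ((σ j).succAbove i)) (τ j i)) =
          (u : L2n d n) (fun i => k ((σ j).succAbove i)) := ae_all_iff.2 fun j =>
      (quasiMeasurePreserving_remove d n (σ j)).ae (symL2_symm u (τ j))
    filter_upwards [h] with k hk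
    rw [creatFun, creatFun]
    congr 1
    rw [← Equiv.sum_comp σ (fun j => f (k j) * (u : L2n d n) (fun i => k (j.succAbove i)))]
    refine Finset.sum_congr rfl fun j _ => ?_
    rw [← hk j]
    simp only [hτ]

/-- The creation operator from `n` to `n + 1` particles. -/
def creat (f : Lp ℂ 2 (volume : Measure (Space d))) (n : ℕ) (u : SymL2 d n) : SymL2 d (n + 1) :=
  (exists_creat f u).choose

theorem coe_creat (f : Lp ℂ 2 (volume : Measure (Space d))) (u : SymL2 d n) :
    ((creat f n u : L2n d (n + 1)) : (Fin (n + 1) → Space d) → ℂ) =ᵐ[volume]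
      creatFun f (u : L2n d n) := (exists_creat f u).choose_spec

/-- By symmetry of `v` all `n + 1` summands contribute the same integral, with the created momentum
in first position, and `(n + 1) / √(n + 1) = √(n + 1)`. -/
theorem inner_creat_left (f : Lp ℂ 2 (volume : Measure (Space d))) (u : SymL2 d n)
    (v : SymL2 d (n + 1)) : ⟪creat f n u, v⟫_ℂ = ⟪u, annih f n v⟫_ℂ := by
  have hint : ∀ j : Fin (n + 1), Integrable (fun k : Fin (n + 1) → Space d =>
      conj (f (k j) * (u : L2n d n) (fun i => k (j.succAbove i))) * (v : L2n d (n + 1)) k) :=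
    fun j => (memLp_creat_term f (u : L2n d n) j).star.integrable_mul (Lp.memLp _)
  have hterm : ∀ j : Fin (n + 1), ∫ k : Fin (n + 1) → Space d,
      conj (f (k j) * (u : L2n d n) (fun i => k (j.succAbove i))) * (v : L2n d (n + 1)) k =
      ∫ k : Fin n → Space d, ∫ q : Space d, conj ((u : L2n d n) k) *
        (conj (f q) * (v : L2n d (n + 1)) (Fin.cons q k)) := by
    intro j
    -- The cycle sends `j` to `0` and keeps the order of the other indices, which turns the `j`-th
    -- summand into the one for `0`.
    rw [← integral_perm j.cycleRange _ (hint j).1]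
    have h0 : ∫ k : Fin (n + 1) → Space d, conj (f (k 0) * (u : L2n d n)
        (fun i => k ((0 : Fin (n + 1)).succAbove i))) * (v : L2n d (n + 1)) k = ∫ k : Fin n → Space d,
        ∫ q : Space d, conj ((u : L2n d n) k) *
          (conj (f q) * (v : L2n d (n + 1)) (Fin.cons q k)) := by
      rw [integral_cons _ (hint 0)]
      refine integral_congr_ae (Eventually.of_forall fun k => ?_)
      refine integral_congr_ae (Eventually.of_forall fun q => ?_)
      simp [map_mul]; ring
    rw [← h0]
    refine integral_congr_ae ?_
    filter_upwards [symL2_symm v j.cycleRange] with k hk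
    rw [hk]
    simp
  have h1 : ⟪creat f n u, v⟫_ℂ = ((Real.sqrt (n + 1) : ℂ))⁻¹ * ∑ j : Fin (n + 1),
      ∫ k : Fin (n + 1) → Space d,
      conj (f (k j) * (u : L2n d n) (fun i => k (j.succAbove i))) * (v : L2n d (n + 1)) k := by
    rw [inner_symL2, ← integral_finsetSum _ fun j _ => hint j, ← integral_const_mul]
    refine integral_congr_ae ?_
    filter_upwards [coe_creat f u] with k hk
    rw [hk, creatFun, map_mul, map_sum, map_inv₀, Complex.conj_ofReal, mul_assoc, Finset.sum_mul]
  have h2 : ⟪u, annih f n v⟫_ℂ = (Real.sqrt (n + 1) : ℂ) * ∫ k : Fin n → Space d,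
      ∫ q : Space d, conj ((u : L2n d n) k) *
        (conj (f q) * (v : L2n d (n + 1)) (Fin.cons q k)) := by
    rw [inner_symL2, ← integral_const_mul]
    refine integral_congr_ae ?_
    filter_upwards [coe_annih f v] with k hk
    rw [hk, annihFun, integral_const_mul]
    ring
  rw [h1, h2]
  simp only [hterm, Finset.sum_const, Finset.card_univ, Fintype.card_fin, nsmul_eq_mul]
  have hs : (Real.sqrt (n + 1) : ℂ) * (Real.sqrt (n + 1) : ℂ) = ((n + 1 : ℕ) : ℂ) := by
    rw [← Complex.ofReal_mul, Real.mul_self_sqrt (by positivity)]; push_cast; ring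
  have hne : (Real.sqrt (n + 1) : ℂ) ≠ 0 := by
    rw [Complex.ofReal_ne_zero]; positivity
  rw [← hs, ← mul_assoc, ← mul_assoc, inv_mul_cancel₀ hne, one_mul]

theorem integrable_slice_symL2 (f : Lp ℂ 2 (volume : Measure (Space d))) (u : SymL2 d (n + 1)) :
    ∀ᵐ k : Fin n → Space d,
      Integrable (fun q : Space d => conj (f q) * (u : L2n d (n + 1)) (Fin.cons q k)) := by
  have h1 : MemLp (fun p : (Fin n → Space d) × Space d =>
      (u : L2n d (n + 1)) (Fin.cons p.2 p.1)) 2 (volume.prod volume) :=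
    (Lp.memLp (u : L2n d (n + 1))).comp_measurePreserving (measurePreserving_cons d n)
  have h2 := ((memLp_two_iff_integrable_sq_norm h1.1).1 h1).prod_right_ae
  filter_upwards [h2, h1.1.prodMk_left] with k hk hk3
  exact (Lp.memLp f).star.integrable_mul ((memLp_two_iff_integrable_sq_norm hk3).2 hk)

theorem sqrt_succ_ne_zero (n : ℕ) : (Real.sqrt (n + 1) : ℂ) ≠ 0 := by
  rw [Complex.ofReal_ne_zero]; positivity

theorem inner_L2_eq (f g : Lp ℂ 2 (volume : Measure (Space d))) :
    ⟪f, g⟫_ℂ = ∫ q, conj (f q) * g q := by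
  rw [L2.inner_def]
  simp only [RCLike.inner_apply, mul_comm]

/-- The vacuum sector is separate because there is no lower sector in which annihilation could act
first. -/
theorem annih_creat_zero (f g : Lp ℂ 2 (volume : Measure (Space d))) (u : SymL2 d 0) :
    annih f 0 (creat g 0 u) = ⟪f, g⟫_ℂ • u := by
  refine symL2_ext ?_
  filter_upwards [coe_annih f (creat g 0 u), ae_cons (coe_creat g u),
    Lp.coeFn_smul ⟪f, g⟫_ℂ (u : L2n d 0)] with k h1 h2 h3
  rw [h1, annihFun, Submodule.coe_smul, h3, Pi.smul_apply, smul_eq_mul, inner_L2_eq,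
    ← integral_mul_const, ← integral_const_mul]
  refine integral_congr_ae ?_
  filter_upwards [h2] with q hq
  rw [hq, creatFun]
  simp
  ring

/-- The canonical commutation relation between annihilation and creation operators. -/
theorem annih_creat_succ (f g : Lp ℂ 2 (volume : Measure (Space d))) (u : SymL2 d (n + 1)) :
    annih f (n + 1) (creat g (n + 1) u) = ⟪f, g⟫_ℂ • u + creat g n (annih f n u) := by
  refine symL2_ext ?_
  have hsl : ∀ᵐ k : Fin (n + 1) → Space d, ∀ i : Fin (n + 1), Integrable (fun q : Space d =>
      conj (f q) * (u : L2n d (n + 1)) (Fin.cons q fun l => k (i.succAbove l))) :=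
    ae_all_iff.2 fun i => (quasiMeasurePreserving_remove d n i).ae (integrable_slice_symL2 f u)
  have hann : ∀ᵐ k : Fin (n + 1) → Space d, ∀ i : Fin (n + 1),
      (annih f n u : L2n d n) (fun l => k (i.succAbove l)) =
        annihFun f (u : L2n d (n + 1)) fun l => k (i.succAbove l) :=
    ae_all_iff.2 fun i => (quasiMeasurePreserving_remove d n i).ae (coe_annih f u)
  filter_upwards [coe_annih f (creat g (n + 1) u), ae_cons (coe_creat g u),
    Lp.coeFn_add (⟪f, g⟫_ℂ • (u : L2n d (n + 1))) (creat g n (annih f n u) : L2n d (n + 1)),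
    Lp.coeFn_smul ⟪f, g⟫_ℂ (u : L2n d (n + 1)), coe_creat g (annih f n u), hsl, hann]
    with k h1 h2 h3 h4 h5 h6 h7
  rw [h1, annihFun, Submodule.coe_add, Submodule.coe_smul, h3, Pi.add_apply, h4, h5, creatFun,
    Pi.smul_apply, smul_eq_mul]
  -- The summand in which the new momentum `q` is the created one yields the scalar product. In the
  -- others `q` stays inside `u`, and integrating over it gives creation after annihilation.
  have hpt : ∀ q : Space d, creatFun g (u : L2n d (n + 1)) (Fin.cons q k) =
      ((Real.sqrt ((n + 1 : ℕ) + 1) : ℂ))⁻¹ * (g q * (u : L2n d (n + 1)) k +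
        ∑ i : Fin (n + 1), g (k i) * (u : L2n d (n + 1)) (Fin.cons q fun l => k (i.succAbove l))) := by
    intro q
    rw [creatFun, Fin.sum_univ_succ]
    congr 2
    refine Finset.sum_congr rfl fun i _ => ?_
    congr 2
    funext l
    refine Fin.cases ?_ (fun l => ?_) l <;> simp
  have h8 : ∫ q : Space d, conj (f q) * (creat g (n + 1) u : L2n d (n + 1 + 1)) (Fin.cons q k) =
      ((Real.sqrt ((n + 1 : ℕ) + 1) : ℂ))⁻¹ * (⟪f, g⟫_ℂ * (u : L2n d (n + 1)) k +
        ∑ i : Fin (n + 1), g (k i) * ∫ q : Space d, conj (f q) *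
          (u : L2n d (n + 1)) (Fin.cons q fun l => k (i.succAbove l))) := by
    have h9 : ∫ q : Space d, conj (f q) * (creat g (n + 1) u : L2n d (n + 1 + 1)) (Fin.cons q k) =
        ∫ q : Space d, ((Real.sqrt ((n + 1 : ℕ) + 1) : ℂ))⁻¹ *
          (conj (f q) * g q * (u : L2n d (n + 1)) k + ∑ i : Fin (n + 1), g (k i) * (conj (f q) *
            (u : L2n d (n + 1)) (Fin.cons q fun l => k (i.succAbove l)))) := by
      refine integral_congr_ae ?_
      filter_upwards [h2] with q hq
      rw [hq, hpt, mul_left_comm, mul_add, Finset.mul_sum]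
      congr 2
      · ring
      · exact Finset.sum_congr rfl fun i _ => by ring
    have hfg : Integrable (fun q => conj (f q) * g q) :=
      (Lp.memLp f).star.integrable_mul (Lp.memLp g)
    rw [h9, integral_const_mul, integral_add (hfg.mul_const _)
      (integrable_finsetSum _ fun i _ => (h6 i).const_mul _), integral_mul_const, inner_L2_eq,
      integral_finsetSum _ fun i _ => (h6 i).const_mul _]
    simp only [integral_const_mul]
  rw [h8, ← mul_assoc, mul_inv_cancel₀ (sqrt_succ_ne_zero (n + 1)), one_mul]
  congr 1
  rw [Finset.mul_sum]
  refine Finset.sum_congr rfl fun i _ => ?_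
  rw [h7 i, annihFun]
  field_simp [sqrt_succ_ne_zero n]

theorem norm_sq_eq_of_inner {E : Type*} [NormedAddCommGroup E] [InnerProductSpace ℂ E] {x : E}
    {r : ℝ} (h : ⟪x, x⟫_ℂ = r) : ‖x‖ ^ 2 = r := by
  rw [inner_self_eq_norm_sq_to_K] at h
  exact Complex.ofReal_injective (by simpa using h)

theorem norm_sq_creat_zero (f : Lp ℂ 2 (volume : Measure (Space d))) (u : SymL2 d 0) :
    ‖creat f 0 u‖ ^ 2 = ‖f‖ ^ 2 * ‖u‖ ^ 2 := by
  refine norm_sq_eq_of_inner ?_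
  rw [inner_creat_left, annih_creat_zero]
  refine (inner_smul_right (𝕜 := ℂ) u u _).trans ?_
  rw [inner_self_eq_norm_sq_to_K, inner_self_eq_norm_sq_to_K u]
  push_cast; rfl

/-- This is `⟪u, a a† u⟫` evaluated with the commutation relation. It shows that creation costs no
more than annihilation, up to a bounded term. -/
theorem norm_sq_creat_succ (f : Lp ℂ 2 (volume : Measure (Space d))) (u : SymL2 d (n + 1)) :
    ‖creat f (n + 1) u‖ ^ 2 = ‖f‖ ^ 2 * ‖u‖ ^ 2 + ‖annih f n u‖ ^ 2 := by
  refine norm_sq_eq_of_inner ?_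
  have h : ⟪u, creat f n (annih f n u)⟫_ℂ = ‖annih f n u‖ ^ 2 := by
    have h1 := inner_conj_symm (𝕜 := ℂ) u (creat f n (annih f n u))
    rw [inner_creat_left] at h1
    rw [← h1]
    refine (inner_conj_symm (𝕜 := ℂ) (annih f n u) (annih f n u)).trans ?_
    exact inner_self_eq_norm_sq_to_K (𝕜 := ℂ) (annih f n u)
  rw [inner_creat_left, annih_creat_succ]
  refine (inner_add_right (𝕜 := ℂ) u _ _).trans ?_
  rw [h]
  have h2 := inner_smul_right (𝕜 := ℂ) u u ⟪f, f⟫_ℂ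
  refine (congrArg (fun z : ℂ => z + (‖annih f n u‖ : ℂ) ^ 2) h2).trans ?_
  rw [inner_self_eq_norm_sq_to_K, inner_self_eq_norm_sq_to_K u]
  push_cast; rfl

/-- Turns the almost-everywhere identities of the graph into equalities in each sector, so that the
sectorwise adjointness and norm identities apply. -/
theorem mem_annihilationGraph {f : Lp ℂ 2 (volume : Measure (Space d))} {Ψ Θ : Fock d} :
    (Ψ, Θ) ∈ annihilationGraph f ↔ ∀ n, Θ n = annih f n (Ψ (n + 1)) := by
  refine forall_congr' fun n => ⟨fun h => symL2_ext ?_, fun h => ?_⟩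
  · exact h.trans (coe_annih f (Ψ (n + 1))).symm
  · change comp Θ n =ᵐ[volume] _
    rw [comp, h]; exact coe_annih f (Ψ (n + 1))

theorem mem_creationGraph {f : Lp ℂ 2 (volume : Measure (Space d))} {Ψ Θ : Fock d} :
    (Ψ, Θ) ∈ creationGraph f ↔ Θ 0 = 0 ∧ ∀ n, Θ (n + 1) = creat f n (Ψ n) := by
  refine and_congr ⟨fun h => symL2_ext ?_, fun h => ?_⟩
    (forall_congr' fun n => ⟨fun h => symL2_ext ?_, fun h => ?_⟩)
  · exact h.trans (Lp.coeFn_zero ℂ 2 (volume : Measure (Fin 0 → Space d))).symm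
  · change comp Θ 0 =ᵐ[volume] _
    rw [comp, h]; exact Lp.coeFn_zero ℂ 2 (volume : Measure (Fin 0 → Space d))
  · exact h.trans (coe_creat f (Ψ n)).symm
  · change comp Θ (n + 1) =ᵐ[volume] _
    rw [comp, h]; exact coe_creat f (Ψ n)

/-- Annihilation and creation operators are adjoint to each other. -/
theorem inner_creation_left {f : Lp ℂ 2 (volume : Measure (Space d))} {Ψ Θ Φ Ξ : Fock d}
    (h : (Ψ, Θ) ∈ creationGraph f) (h' : (Φ, Ξ) ∈ annihilationGraph f) :
    ⟪Θ, Φ⟫_ℂ = ⟪Ψ, Ξ⟫_ℂ := by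
  rw [mem_creationGraph] at h
  rw [mem_annihilationGraph] at h'
  rw [lp.inner_eq_tsum, lp.inner_eq_tsum, (lp.summable_inner (𝕜 := ℂ) Θ Φ).tsum_eq_zero_add, h.1,
    inner_zero_left, zero_add]
  refine tsum_congr fun n => ?_
  rw [h.2, h', inner_creat_left]

/-- The creation operator is defined wherever the annihilation operator is. -/
theorem exists_creation (f : Lp ℂ 2 (volume : Measure (Space d))) {Ψ Θ : Fock d}
    (h : (Ψ, Θ) ∈ annihilationGraph f) : ∃ Ξ, (Ψ, Ξ) ∈ creationGraph f ∧
      ‖Ξ‖ ^ 2 = ‖f‖ ^ 2 * ‖Ψ‖ ^ 2 + ‖Θ‖ ^ 2 := by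
  rw [mem_annihilationGraph] at h
  have hs : ∀ Φ : Fock d, HasSum (fun n => ‖Φ n‖ ^ 2) (‖Φ‖ ^ 2) := by
    intro Φ
    have := lp.hasSum_norm (p := 2) (by norm_num) Φ
    simpa using this
  let v : (n : ℕ) → SymL2 d n := fun n => match n with
    | 0 => 0
    | n + 1 => creat f n (Ψ n)
  have hv : ∀ n, ‖v (n + 1)‖ ^ 2 = ‖f‖ ^ 2 * ‖Ψ n‖ ^ 2 +
      (match n with | 0 => 0 | n + 1 => ‖Θ n‖ ^ 2 : ℝ) := by
    intro n
    cases n with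
    | zero => exact (norm_sq_creat_zero f (Ψ 0)).trans (add_zero _).symm
    | succ n => simp only [v, norm_sq_creat_succ, h n]
  -- The created component in sector `n + 1` involves `Θ` in sector `n - 1`, with nothing for `n =
  -- 0`; hence the shift by one.
  have hshift : HasSum (fun n => (match n with | 0 => 0 | n + 1 => ‖Θ n‖ ^ 2 : ℝ)) (‖Θ‖ ^ 2) := by
    rw [← hasSum_nat_add_iff' 1]
    simpa using hs Θ
  have hvs : HasSum (fun n => ‖v n‖ ^ 2) (‖f‖ ^ 2 * ‖Ψ‖ ^ 2 + ‖Θ‖ ^ 2) := by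
    rw [← hasSum_nat_add_iff' 1]
    simp only [hv, Finset.range_one, Finset.sum_singleton]
    have h0 : ‖v 0‖ ^ 2 = 0 := by simp [v]
    rw [h0, sub_zero]
    exact ((hs Ψ).mul_left _).add hshift
  have hmem : Memℓp v 2 := by
    refine memℓp_gen ?_
    simpa using hvs.summable
  refine ⟨⟨v, hmem⟩, mem_creationGraph.2 ⟨rfl, fun n => rfl⟩, ?_⟩
  exact (hs ⟨v, hmem⟩).unique hvs

end FockSpace

/-! ### Tensor powers and exponential vectors: totality and eigenvector property -/

section Exponentials

open scoped ENNReal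

variable {d n : ℕ}

theorem memLp_prod (f : Fin n → Lp ℂ 2 (volume : Measure (Space d))) :
    MemLp (fun k : Fin n → Space d => ∏ j, f j (k j)) 2 := by
  have hm : AEStronglyMeasurable (fun k : Fin n → Space d => ∏ j, f j (k j)) :=
    Finset.aestronglyMeasurable_fun_prod _ fun j _ =>
      (Lp.aestronglyMeasurable (f j)).comp_quasiMeasurePreserving
        (Measure.quasiMeasurePreserving_eval (fun _ => volume) j)
  rw [memLp_two_iff_integrable_sq_norm hm]
  have h := Integrable.fintype_prod (μ := fun _ : Fin n => (volume : Measure (Space d)))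
    (f := fun j q => ‖f j q‖ ^ 2)
    fun j => (memLp_two_iff_integrable_sq_norm (Lp.aestronglyMeasurable _)).1 (Lp.memLp (f j))
  refine h.congr (Eventually.of_forall fun k => ?_)
  simp [norm_prod, Finset.prod_pow]

theorem ae_eval {P : Space d → Prop} (h : ∀ᵐ q, P q) (j : Fin n) :
    ∀ᵐ k : Fin n → Space d, P (k j) := by
  have := (Measure.quasiMeasurePreserving_eval
    (fun _ : Fin n => (volume : Measure (Space d))) j).ae h
  exact this

theorem exists_tpow (n : ℕ) (g : Lp ℂ 2 (volume : Measure (Space d))) :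
    ∃ u : SymL2 d n, ((u : L2n d n) : (Fin n → Space d) → ℂ) =ᵐ[volume] fun k => ∏ j, g (k j) :=
  exists_symL2 (memLp_prod fun _ => g) fun σ => Eventually.of_forall fun k =>
    Equiv.prod_comp σ fun j => g (k j)

/-- The tensor power `g(k₁) ⋯ g(kₙ)`. -/
def tpow (n : ℕ) (g : Lp ℂ 2 (volume : Measure (Space d))) : SymL2 d n := (exists_tpow n g).choose

theorem coe_tpow (n : ℕ) (g : Lp ℂ 2 (volume : Measure (Space d))) :
    ((tpow n g : L2n d n) : (Fin n → Space d) → ℂ) =ᵐ[volume] fun k => ∏ j, g (k j) :=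
  (exists_tpow n g).choose_spec

theorem inner_tpow (f g : Lp ℂ 2 (volume : Measure (Space d))) :
    ⟪tpow n f, tpow n g⟫_ℂ = ⟪f, g⟫_ℂ ^ n := by
  rw [inner_symL2, inner_L2_eq]
  have h := integral_fintype_prod_volume_eq_pow (ι := Fin n) (fun q : Space d => conj (f q) * g q)
  rw [Fintype.card_fin] at h
  rw [← h]
  refine integral_congr_ae ?_
  filter_upwards [coe_tpow n f, coe_tpow n g] with k h1 h2
  rw [h1, h2, map_prod, Finset.prod_mul_distrib]

/-- For almost every choice of the other momenta, the slice of `u` in the removed momentum is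
orthogonal to a dense set of functions. Taking that set countable gives one null set for all of
them. -/
theorem annih_eq_zero {u : SymL2 d (n + 1)} (h : ∀ f, annih f n u = 0) : u = 0 := by
  have : Fact ((1 : ℝ≥0∞) ≤ 2) := ⟨by norm_num⟩
  have : Fact ((2 : ℝ≥0∞) ≠ ⊤) := ⟨by norm_num⟩
  obtain ⟨D, hDc, hDd⟩ := TopologicalSpace.exists_countable_dense
    (Lp ℂ 2 (volume : Measure (Space d)))
  have h1 : ∀ᵐ k : Fin n → Space d, ∀ f ∈ D,
      ∫ q : Space d, conj (f q) * (u : L2n d (n + 1)) (Fin.cons q k) = 0 := by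
    rw [ae_ball_iff hDc]
    intro f _
    have h2 := coe_annih f u
    rw [h f] at h2
    filter_upwards [h2, Lp.coeFn_zero ℂ 2 (volume : Measure (Fin n → Space d))] with k hk hk0
    have h3 : annihFun f (u : L2n d (n + 1)) k = 0 := by
      rw [← hk]; exact hk0
    exact (mul_eq_zero.1 h3).resolve_left (sqrt_succ_ne_zero n)
  have hm : MemLp (fun p : (Fin n → Space d) × Space d =>
      (u : L2n d (n + 1)) (Fin.cons p.2 p.1)) 2 (volume.prod volume) :=
    (Lp.memLp (u : L2n d (n + 1))).comp_measurePreserving (measurePreserving_cons d n)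
  have hsl := ((memLp_two_iff_integrable_sq_norm hm.1).1 hm).prod_right_ae
  have h4 : ∀ᵐ k : Fin n → Space d, ∫⁻ q : Space d, ‖(u : L2n d (n + 1)) (Fin.cons q k)‖ₑ ^ 2 = 0 := by
    filter_upwards [h1, hsl, hm.1.prodMk_left] with k hk hk2 hk3
    have hmem : MemLp (fun q : Space d => (u : L2n d (n + 1)) (Fin.cons q k)) 2 :=
      (memLp_two_iff_integrable_sq_norm hk3).2 hk2
    have hz : hmem.toLp _ = 0 := by
      refine hDd.eq_zero_of_inner_left ℂ fun f hf => ?_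
      rw [← inner_conj_symm, inner_L2_eq, map_eq_zero, ← hk f hf]
      refine integral_congr_ae ?_
      filter_upwards [hmem.coeFn_toLp] with q hq
      rw [hq]
    have hz2 : (fun q : Space d => (u : L2n d (n + 1)) (Fin.cons q k)) =ᵐ[volume] 0 :=
      (Lp.eq_zero_iff_ae_eq_zero.1 hz |>.symm.trans hmem.coeFn_toLp).symm
    rw [lintegral_congr_ae (g := fun _ => 0) (by
      filter_upwards [hz2] with q hq
      rw [hq]; simp), lintegral_zero]
  have h5 : ‖u‖ₑ ^ 2 = 0 := by
    rw [enorm_sq_symL2, lintegral_cons _ ((Lp.aestronglyMeasurable _).enorm.pow_const 2),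
      lintegral_congr_ae h4, lintegral_zero]
  exact enorm_eq_zero.1 ((pow_eq_zero_iff two_ne_zero).1 h5)

/-- Expanding the product over subsets exhibits the inner product as a polynomial in `conj z`. Its
linear coefficient is what polarization needs. -/
theorem inner_tpow_add (g η : Lp ℂ 2 (volume : Measure (Space d))) (z : ℂ) (u : SymL2 d n) :
    ⟪tpow n (g + z • η), u⟫_ℂ = ∑ S : Finset (Fin n), (conj z) ^ S.card *
      ∫ k, conj ((∏ j ∈ S, η (k j)) * ∏ j ∈ Finset.univ \ S, g (k j)) * (u : L2n d n) k := by
  classical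
  have hint : ∀ S : Finset (Fin n), Integrable (fun k : Fin n → Space d =>
      conj ((∏ j ∈ S, η (k j)) * ∏ j ∈ Finset.univ \ S, g (k j)) * (u : L2n d n) k) := by
    intro S
    have h := (memLp_prod (d := d) (n := n) fun j => if j ∈ S then η else g).star.integrable_mul
      (Lp.memLp (u : L2n d n))
    refine h.congr (Eventually.of_forall fun k => ?_)
    simp only [Pi.mul_apply, Pi.star_apply, RCLike.star_def]
    congr 2
    rw [← Finset.prod_sdiff (Finset.subset_univ S), mul_comm]
    congr 1
    · exact Finset.prod_congr rfl fun j hj => by rw [if_pos hj]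
    · exact Finset.prod_congr rfl fun j hj => by rw [if_neg (Finset.mem_sdiff.1 hj).2]
  simp only [← integral_const_mul]
  rw [inner_symL2, ← integral_finsetSum _ fun S _ => (hint S).const_mul _]
  have hpt : ∀ᵐ k : Fin n → Space d, ∀ j, (g + z • η : Lp ℂ 2 _) (k j) = z * η (k j) + g (k j) := by
    refine ae_all_iff.2 fun j => ae_eval (P := fun q => (g + z • η : Lp ℂ 2 _) q =
      z * η q + g q) ?_ j
    filter_upwards [Lp.coeFn_add g (z • η), Lp.coeFn_smul z η] with q h1 h2
    rw [h1, Pi.add_apply, h2, Pi.smul_apply, smul_eq_mul, add_comm]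
  refine integral_congr_ae ?_
  filter_upwards [coe_tpow n (g + z • η), hpt] with k h1 h2
  rw [h1]
  simp only [h2]
  rw [Finset.prod_add, map_sum, Finset.sum_mul, Finset.powerset_univ]
  refine Finset.sum_congr rfl fun S _ => ?_
  rw [Finset.prod_mul_distrib, Finset.prod_const]
  simp only [map_mul, map_pow]
  ring

/-- Polarization: a polynomial that vanishes identically has vanishing linear coefficient, and that
coefficient of `(g + zη)^{⊗(n+1)}` is the creation of `η` on `g^{⊗n}` up to normalization. -/
theorem inner_creat_tpow_eq_zero {u : SymL2 d (n + 1)} (h : ∀ g, ⟪tpow (n + 1) g, u⟫_ℂ = 0)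
    (g η : Lp ℂ 2 (volume : Measure (Space d))) : ⟪creat η n (tpow n g), u⟫_ℂ = 0 := by
  classical
  let I : Finset (Fin (n + 1)) → ℂ := fun S =>
    ∫ k, conj ((∏ j ∈ S, η (k j)) * ∏ j ∈ Finset.univ \ S, g (k j)) * (u : L2n d (n + 1)) k
  have hp : (∑ S : Finset (Fin (n + 1)), Polynomial.C (I S) * Polynomial.X ^ S.card) = 0 := by
    refine Polynomial.funext fun z => ?_
    -- The shift is by `conj z` because the inner product is conjugate linear in its first argument;
    -- the result is then a polynomial in `z` itself.
    rw [Polynomial.eval_finsetSum, Polynomial.eval_zero, ← h (g + conj z • η), inner_tpow_add]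
    refine Finset.sum_congr rfl fun S _ => ?_
    simp only [Polynomial.eval_mul, Polynomial.eval_C, Polynomial.eval_pow, Polynomial.eval_X,
      Complex.conj_conj]
    exact mul_comm _ _
  have hc := congrArg (fun p => Polynomial.coeff p 1) hp
  simp only [Polynomial.finsetSum_coeff, Polynomial.coeff_C_mul, Polynomial.coeff_X_pow,
    Polynomial.coeff_zero, mul_ite, mul_one, mul_zero] at hc
  rw [← Finset.sum_filter] at hc
  have hfil : Finset.univ.filter (fun S : Finset (Fin (n + 1)) => 1 = S.card) =
      Finset.powersetCard 1 Finset.univ := by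
    ext S; simp [Finset.mem_powersetCard, eq_comm]
  rw [hfil, Finset.powersetCard_one, Finset.sum_map] at hc
  have hint : ∀ j : Fin (n + 1), Integrable (fun k : Fin (n + 1) → Space d =>
      conj (η (k j) * (tpow n g : L2n d n) (fun i => k (j.succAbove i))) *
        (u : L2n d (n + 1)) k) :=
    fun j => (memLp_creat_term η (tpow n g : L2n d n) j).star.integrable_mul (Lp.memLp _)
  have h1 : ⟪creat η n (tpow n g), u⟫_ℂ = ((Real.sqrt (n + 1) : ℂ))⁻¹ * ∑ j : Fin (n + 1),
      ∫ k : Fin (n + 1) → Space d,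
      conj (η (k j) * (tpow n g : L2n d n) (fun i => k (j.succAbove i))) *
        (u : L2n d (n + 1)) k := by
    rw [inner_symL2, ← integral_finsetSum _ fun j _ => hint j, ← integral_const_mul]
    refine integral_congr_ae ?_
    filter_upwards [coe_creat η (tpow n g)] with k hk
    rw [hk, creatFun, map_mul, map_sum, map_inv₀, Complex.conj_ofReal, mul_assoc, Finset.sum_mul]
  rw [h1, ← mul_zero ((Real.sqrt (n + 1) : ℂ))⁻¹, ← hc]
  congr 1
  refine Finset.sum_congr rfl fun j _ => ?_
  refine integral_congr_ae ?_
  filter_upwards [(quasiMeasurePreserving_remove d n j).ae (coe_tpow n g)] with k hk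
  rw [hk]
  simp only [Function.Embedding.coeFn_mk, Finset.prod_singleton]
  rw [← Finset.compl_eq_univ_sdiff, ← Fin.image_succAbove_univ,
    Finset.prod_image fun a _ b _ hab => Fin.succAbove_right_injective hab]

/-- Induction on the particle number: if `u` is orthogonal to all powers, polarization and
adjointness make `annih η u` orthogonal to all lower powers for every `η`. So every `annih η u`
vanishes, and `u` with them. -/
theorem total_tpow (d n : ℕ) : Total (tpow n : Lp ℂ 2 (volume : Measure (Space d)) → SymL2 d n) := by
  induction n with
  | zero =>
    intro u hu
    have h := hu 0
    rw [inner_symL2] at h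
    have h1 : ∀ᵐ k : Fin 0 → Space d, (u : L2n d 0) k = 0 := by
      have h2 : ∫ k : Fin 0 → Space d, conj (((tpow 0 0 : SymL2 d 0) : L2n d 0) k) * (u : L2n d 0) k =
          ∫ k : Fin 0 → Space d, (u : L2n d 0) default := by
        refine integral_congr_ae ?_
        filter_upwards [coe_tpow (d := d) 0 0] with k hk
        rw [hk, Subsingleton.elim k default]
        simp
      rw [h2, integral_const] at h
      have h3 : (u : L2n d 0) default = 0 := by
        simpa [Measure.real, volume_pi] using h
      exact Eventually.of_forall fun k => by rw [Subsingleton.elim k default, h3]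
    refine symL2_ext ?_
    filter_upwards [h1, Lp.coeFn_zero ℂ 2 (volume : Measure (Fin 0 → Space d))] with k hk hk0
    rw [hk]; exact hk0.symm
  | succ n ih =>
    intro u hu
    refine annih_eq_zero fun η => ih _ fun g => ?_
    rw [← inner_creat_left]
    exact inner_creat_tpow_eq_zero hu g η

theorem norm_tpow (g : Lp ℂ 2 (volume : Measure (Space d))) : ‖tpow n g‖ ^ 2 = (‖g‖ ^ 2) ^ n := by
  refine norm_sq_eq_of_inner ?_
  rw [inner_tpow, inner_self_eq_norm_sq_to_K]
  push_cast; rfl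

theorem memℓp_exp (g : Lp ℂ 2 (volume : Measure (Space d))) :
    Memℓp (fun n => ((Real.sqrt n.factorial : ℂ))⁻¹ • tpow n g) 2 := by
  refine memℓp_gen ?_
  have h : ∀ n : ℕ, ‖((Real.sqrt n.factorial : ℂ))⁻¹ • tpow n g‖ ^ (2 : ℝ≥0∞).toReal =
      (‖g‖ ^ 2) ^ n / n.factorial := by
    intro n
    rw [norm_smul, ENNReal.toReal_ofNat, Real.rpow_ofNat, mul_pow, norm_tpow, norm_inv,
      Complex.norm_real, Real.norm_eq_abs, inv_pow, sq_abs, Real.sq_sqrt (by positivity),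
      div_eq_inv_mul]
  simp only [h]
  exact Real.summable_pow_div_factorial _

/-- The exponential vector of `g`, with components `g(k₁) ⋯ g(kₙ) / √n!`. -/
def expVec (g : Lp ℂ 2 (volume : Measure (Space d))) : Fock d :=
  ⟨fun n => ((Real.sqrt n.factorial : ℂ))⁻¹ • tpow n g, memℓp_exp g⟩

theorem expVec_apply (g : Lp ℂ 2 (volume : Measure (Space d))) (n : ℕ) :
    expVec g n = ((Real.sqrt n.factorial : ℂ))⁻¹ • tpow n g := rfl

theorem comp_expVec (g : Lp ℂ 2 (volume : Measure (Space d))) (n : ℕ) :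
    comp (expVec g) n =ᵐ[volume] fun k => ((Real.sqrt n.factorial : ℂ))⁻¹ * ∏ j, g (k j) := by
  filter_upwards [coe_tpow n g,
    Lp.coeFn_smul ((Real.sqrt n.factorial : ℂ))⁻¹ (tpow n g : L2n d n)] with k h1 h2
  rw [comp, expVec_apply, Submodule.coe_smul, h2, Pi.smul_apply, h1, smul_eq_mul]

theorem inner_expVec (f g : Lp ℂ 2 (volume : Measure (Space d))) :
    ⟪expVec f, expVec g⟫_ℂ = Complex.exp ⟪f, g⟫_ℂ := by
  have h := lp.hasSum_inner (𝕜 := ℂ) (expVec f) (expVec g)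
  have h2 : (fun n => ⟪(expVec f) n, (expVec g) n⟫_ℂ) = fun n : ℕ => ⟪f, g⟫_ℂ ^ n / n.factorial := by
    funext n
    rw [expVec_apply, expVec_apply]
    have h3 := inner_smul_left (𝕜 := ℂ) (tpow n f)
      (((Real.sqrt n.factorial : ℂ))⁻¹ • tpow n g) ((Real.sqrt n.factorial : ℂ))⁻¹
    have h4 := inner_smul_right (𝕜 := ℂ) (tpow n f) (tpow n g) ((Real.sqrt n.factorial : ℂ))⁻¹
    refine h3.trans ?_
    rw [h4, inner_tpow, map_inv₀, Complex.conj_ofReal, ← mul_assoc, ← mul_inv,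
      ← Complex.ofReal_mul, Real.mul_self_sqrt (by positivity), div_eq_inv_mul]
    push_cast; rfl
  rw [h2] at h
  rw [Complex.exp_eq_exp_ℂ]
  exact h.unique (NormedSpace.expSeries_div_hasSum_exp _)

theorem tpow_smul (z : ℂ) (g : Lp ℂ 2 (volume : Measure (Space d))) :
    tpow n (z • g) = z ^ n • tpow n g := by
  refine symL2_ext ?_
  have hpt : ∀ᵐ k : Fin n → Space d, ∀ j, (z • g : Lp ℂ 2 _) (k j) = z * g (k j) :=
    ae_all_iff.2 fun j => ae_eval (P := fun q => (z • g : Lp ℂ 2 _) q = z * g q)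
      (Lp.coeFn_smul z g) j
  filter_upwards [coe_tpow n (z • g), coe_tpow n g, hpt,
    Lp.coeFn_smul (z ^ n) (tpow n g : L2n d n)] with k h1 h2 h3 h4
  rw [h1, Submodule.coe_smul, h4, Pi.smul_apply, h2]
  simp [h3, Finset.prod_mul_distrib]

/-- Scaling `g` by `z` separates the sectors: `⟪e(zg), ψ⟫` is a power series in `conj z` whose
coefficients are the inner products with tensor powers. It vanishes identically, so each coefficient
does. -/
theorem total_expVec (d : ℕ) :
    Total (expVec : Lp ℂ 2 (volume : Measure (Space d)) → Fock d) := by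
  intro ψ hψ
  refine lp.ext (funext fun n => total_tpow d n _ fun g => ?_)
  let c : ℕ → ℂ := fun n => ((Real.sqrt n.factorial : ℂ))⁻¹ * ⟪tpow n g, ψ n⟫_ℂ
  have hsum : ∀ z : ℂ, HasSum (fun n => conj z ^ n * c n) 0 := by
    intro z
    have h := lp.hasSum_inner (𝕜 := ℂ) (expVec (z • g)) ψ
    rw [hψ] at h
    refine Eq.mp (congrArg (fun f => HasSum f 0) (funext fun m => ?_)) h
    rw [expVec_apply, tpow_smul]
    have h1 := inner_smul_left (𝕜 := ℂ) (z ^ m • tpow m g) (ψ m) ((Real.sqrt m.factorial : ℂ))⁻¹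
    have h2 := inner_smul_left (𝕜 := ℂ) (tpow m g) (ψ m) (z ^ m)
    refine h1.trans ?_
    rw [h2]
    simp only [c, map_inv₀, Complex.conj_ofReal, map_pow]
    ring
  have hps : HasFPowerSeriesOnBall (0 : ℂ → ℂ) (FormalMultilinearSeries.ofScalars ℂ c) 0 1 := by
    refine ⟨?_, by norm_num, fun {y} _ => ?_⟩
    · have hle := FormalMultilinearSeries.le_radius_of_summable
        (FormalMultilinearSeries.ofScalars ℂ c) (r := 1) (by
          have := (hsum 1).summable.norm
          simpa [FormalMultilinearSeries.ofScalars_norm] using this)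
      simpa using hle
    · have := hsum (conj y)
      simp only [FormalMultilinearSeries.ofScalars_apply_eq]
      simpa [mul_comm] using this
  have h0 := (FormalMultilinearSeries.ofScalars_series_eq_zero ℂ).1 hps.hasFPowerSeriesAt.eq_zero
  have h1 := congrFun h0 n
  simp only [c, Pi.zero_apply, mul_eq_zero, inv_eq_zero, Complex.ofReal_eq_zero] at h1
  refine h1.resolve_left ?_
  positivity

/-- Integrating out one factor of the product leaves the others, and `√(n+1) / √(n+1)!` is `1 /
√n!`. -/
theorem expVec_mem_annihilation (f g : Lp ℂ 2 (volume : Measure (Space d))) :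
    (expVec g, ⟪f, g⟫_ℂ • expVec g) ∈ annihilationGraph f := by
  intro n
  filter_upwards [comp_smul ⟪f, g⟫_ℂ (expVec g) n, comp_expVec g n,
    ae_cons (comp_expVec g (n + 1))] with k h1 h2 h3
  rw [h1, h2]
  have h4 : ∫ q : Space d, conj (f q) * comp (expVec g) (n + 1) (Fin.cons q k) =
      ⟪f, g⟫_ℂ * (((Real.sqrt (n + 1).factorial : ℂ))⁻¹ * ∏ j, g (k j)) := by
    rw [inner_L2_eq, ← integral_mul_const]
    refine integral_congr_ae ?_
    filter_upwards [h3] with q hq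
    rw [hq, Fin.prod_univ_succ]
    simp only [Fin.cons_zero, Fin.cons_succ]
    ring
  simp only [h4]
  have h5 : (Real.sqrt (n + 1).factorial : ℂ) =
      (Real.sqrt (n + 1) : ℂ) * (Real.sqrt n.factorial : ℂ) := by
    rw [← Complex.ofReal_mul, ← Real.sqrt_mul (by positivity), Nat.factorial_succ]
    push_cast; rfl
  rw [h5]
  have h6 := sqrt_succ_ne_zero n
  have h7 : (Real.sqrt n.factorial : ℂ) ≠ 0 := by
    rw [Complex.ofReal_ne_zero]; positivity
  field_simp

/-- The norm of a difference is a continuous expression in inner products, because inner products of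
exponential vectors are exponentials. Continuity allows `g` to be restricted to a dense set. -/
theorem continuous_expVec (d : ℕ) :
    Continuous (expVec : Lp ℂ 2 (volume : Measure (Space d)) → Fock d) := by
  rw [continuous_iff_continuousAt]
  intro g
  rw [ContinuousAt, tendsto_iff_norm_sub_tendsto_zero]
  have h : ∀ f : Lp ℂ 2 (volume : Measure (Space d)), ‖expVec f - expVec g‖ =
      Real.sqrt (Complex.exp ⟪f, f⟫_ℂ - Complex.exp ⟪f, g⟫_ℂ - Complex.exp ⟪g, f⟫_ℂ +
        Complex.exp ⟪g, g⟫_ℂ).re := by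
    intro f
    rw [@norm_eq_sqrt_re_inner ℂ, inner_sub_left, inner_sub_right, inner_sub_right, inner_expVec,
      inner_expVec, inner_expVec, inner_expVec]
    congr 2
    rw [RCLike.re_eq_complex_re]
    congr 1
    ring
  simp only [h]
  have hc : Continuous fun f : Lp ℂ 2 (volume : Measure (Space d)) =>
      Real.sqrt (Complex.exp ⟪f, f⟫_ℂ - Complex.exp ⟪f, g⟫_ℂ - Complex.exp ⟪g, f⟫_ℂ +
        Complex.exp ⟪g, g⟫_ℂ).re := by fun_prop
  have := hc.tendsto g
  simpa using this

/-- The exponential vectors of a dense set of functions are total. -/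
theorem total_expVec_of_dense {s : Set (Lp ℂ 2 (volume : Measure (Space d)))} (hs : Dense s) :
    Total fun g : s => expVec (g : Lp ℂ 2 (volume : Measure (Space d))) := by
  intro ψ h
  refine total_expVec d ψ fun g => ?_
  have hc : Continuous fun g : Lp ℂ 2 (volume : Measure (Space d)) => ⟪expVec g, ψ⟫_ℂ :=
    (continuous_expVec d).inner continuous_const
  have := hc.ext_on hs continuous_const (fun g hg => h ⟨g, hg⟩)
  exact congrFun this g

end Exponentials

/-! ### The free Hamiltonian and its unitary group -/

section FreeHamiltonian

open scoped ENNReal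

variable {d n : ℕ}

/-- Multiplication of the components by measurable symmetric functions. -/
theorem exists_mul (m : (n : ℕ) → (Fin n → Space d) → ℂ) (hm : ∀ n, Measurable (m n))
    (hs : ∀ n (σ : Equiv.Perm (Fin n)) k, m n (fun i => k (σ i)) = m n k) (Ψ : Fock d)
    (h : ∑' n, ∫⁻ k, ‖m n k * comp Ψ n k‖ₑ ^ 2 ≠ ⊤) :
    ∃ Φ : Fock d, ∀ n, comp Φ n =ᵐ[volume] fun k => m n k * comp Ψ n k := by
  refine exists_fock_of_comp _ (fun n => (hm n).aestronglyMeasurable.mul (comp_memLp Ψ n).1)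
    (fun n σ => ?_) h
  filter_upwards [comp_symm Ψ n σ] with k hk
  rw [hk, hs]

theorem exists_mul_of_bounded (m : (n : ℕ) → (Fin n → Space d) → ℂ) (hm : ∀ n, Measurable (m n))
    (hs : ∀ n (σ : Equiv.Perm (Fin n)) k, m n (fun i => k (σ i)) = m n k)
    (hb : ∀ n k, ‖m n k‖ ≤ 1) (Ψ : Fock d) :
    ∃ Φ : Fock d, ∀ n, comp Φ n =ᵐ[volume] fun k => m n k * comp Ψ n k := by
  refine exists_mul m hm hs Ψ (ne_top_of_le_ne_top (b := ‖Ψ‖ₑ ^ 2) (by finiteness) ?_)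
  rw [fock_norm_sq']
  refine ENNReal.tsum_le_tsum fun n => lintegral_mono fun k => ?_
  gcongr
  rw [enorm_mul]
  refine mul_le_of_le_one_left (by positivity) ?_
  rw [← ofReal_norm]
  exact ENNReal.ofReal_le_one.2 (hb n k)

/-- The energy `|k₁| + ⋯ + |kₙ|`. -/
def energy (n : ℕ) (k : Fin n → Space d) : ℝ := ∑ j, ‖k j‖

theorem energy_nonneg (k : Fin n → Space d) : 0 ≤ energy n k :=
  Finset.sum_nonneg fun _ _ => norm_nonneg _

theorem continuous_energy (d n : ℕ) : Continuous (energy n : (Fin n → Space d) → ℝ) := by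
  unfold energy; fun_prop

theorem energy_symm (n : ℕ) (σ : Equiv.Perm (Fin n)) (k : Fin n → Space d) :
    energy n (fun i => k (σ i)) = energy n k := Equiv.sum_comp σ fun j => ‖k j‖

/-- The phase factor `exp(it(|k₁| + ⋯ + |kₙ|))`. -/
def phase (t : ℝ) (n : ℕ) (k : Fin n → Space d) : ℂ := Complex.exp (Complex.I * (t * energy n k : ℝ))

theorem norm_phase (t : ℝ) (k : Fin n → Space d) : ‖phase t n k‖ = 1 := by
  rw [phase, mul_comm, Complex.norm_exp_ofReal_mul_I]

theorem continuous_phase (t : ℝ) (d n : ℕ) : Continuous (phase t n : (Fin n → Space d) → ℂ) := by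
  have := continuous_energy d n
  unfold phase; fun_prop

theorem phase_add (s t : ℝ) (k : Fin n → Space d) :
    phase (s + t) n k = phase s n k * phase t n k := by
  rw [phase, phase, phase, ← Complex.exp_add]
  congr 1; push_cast; ring

theorem phase_zero (k : Fin n → Space d) : phase 0 n k = 1 := by simp [phase]

theorem exists_free (t : ℝ) (Ψ : Fock d) :
    ∃ Φ : Fock d, ∀ n, comp Φ n =ᵐ[volume] fun k => phase t n k * comp Ψ n k :=
  exists_mul_of_bounded _ (fun n => (continuous_phase t d n).measurable)
    (fun n σ k => by rw [phase, energy_symm, phase]) (fun n k => (norm_phase t k).le) Ψ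

/-- The free time evolution `exp(itH₀)` as a function. -/
def freeFun (t : ℝ) (Ψ : Fock d) : Fock d := (exists_free t Ψ).choose

theorem comp_freeFun (t : ℝ) (Ψ : Fock d) (n : ℕ) :
    comp (freeFun t Ψ) n =ᵐ[volume] fun k => phase t n k * comp Ψ n k :=
  (exists_free t Ψ).choose_spec n

theorem freeFun_comp (s t : ℝ) (Ψ : Fock d) : freeFun (s + t) Ψ = freeFun s (freeFun t Ψ) := by
  refine fock_ext fun n => ?_
  filter_upwards [comp_freeFun (s + t) Ψ n, comp_freeFun s (freeFun t Ψ) n, comp_freeFun t Ψ n]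
    with k h1 h2 h3
  rw [h1, h2, h3, phase_add, mul_assoc]

theorem freeFun_zero (Ψ : Fock d) : freeFun 0 Ψ = Ψ := by
  refine fock_ext fun n => ?_
  filter_upwards [comp_freeFun 0 Ψ n] with k h1
  rw [h1, phase_zero, one_mul]

/-- The free time evolution `exp(itH₀)`. -/
def free (t : ℝ) : Fock d ≃ₗᵢ[ℂ] Fock d where
  toFun := freeFun t
  invFun := freeFun (-t)
  left_inv Ψ := by rw [← freeFun_comp, neg_add_cancel, freeFun_zero]
  right_inv Ψ := by rw [← freeFun_comp, add_neg_cancel, freeFun_zero]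
  map_add' Ψ Φ := by
    refine fock_ext fun n => ?_
    filter_upwards [comp_freeFun t (Ψ + Φ) n, comp_add (freeFun t Ψ) (freeFun t Φ) n,
      comp_add Ψ Φ n, comp_freeFun t Ψ n, comp_freeFun t Φ n] with k h1 h2 h3 h4 h5
    rw [h1, h2, h3, h4, h5, mul_add]
  map_smul' c Ψ := by
    refine fock_ext fun n => ?_
    filter_upwards [comp_freeFun t (c • Ψ) n, comp_smul c (freeFun t Ψ) n, comp_smul c Ψ n,
      comp_freeFun t Ψ n] with k h1 h2 h3 h4
    rw [h1, RingHom.id_apply, h2, h3, h4]; ring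
  norm_map' Ψ := by
    have h : ‖freeFun t Ψ‖ₑ ^ 2 = ‖Ψ‖ₑ ^ 2 := by
      rw [fock_norm_sq', fock_norm_sq']
      refine tsum_congr fun n => lintegral_congr_ae ?_
      filter_upwards [comp_freeFun t Ψ n] with k hk
      rw [hk, enorm_mul, ← ofReal_norm (phase t n k), norm_phase]
      simp
    have h2 : ‖freeFun t Ψ‖ ^ 2 = ‖Ψ‖ ^ 2 := by simpa using congrArg ENNReal.toReal h
    exact (sq_eq_sq₀ (norm_nonneg _) (norm_nonneg _)).1 h2

theorem comp_free (t : ℝ) (Ψ : Fock d) (n : ℕ) :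
    comp (free t Ψ) n =ᵐ[volume] fun k => phase t n k * comp Ψ n k := comp_freeFun t Ψ n

theorem free_add (s t : ℝ) (Ψ : Fock d) : free (s + t) Ψ = free s (free t Ψ) := freeFun_comp s t Ψ

/-- Testing against vectors of one sector turns matrix elements into single integrals, so dominated
convergence applies without interchanging limits with the sum over sectors. -/
theorem total_single (d : ℕ) :
    Total fun p : Σ n, SymL2 d n => (lp.single 2 p.1 p.2 : Fock d) := by
  intro ψ h
  refine lp.ext (funext fun n => ?_)
  have h1 := h ⟨n, ψ n⟩
  rw [lp.inner_single_left] at h1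
  exact inner_self_eq_zero.1 h1

/-- A group of isometries is strongly continuous if all its diagonal matrix elements are
continuous. -/
theorem Total.continuous_group' {F : Type*} [NormedAddCommGroup F] [InnerProductSpace ℂ F]
    [CompleteSpace F] {X : Type*} {e : X → F} (he : Total e)
    {V : ℝ → (F ≃ₗᵢ[ℂ] F)} (hV : ∀ s t ψ, V (s + t) ψ = V s (V t ψ))
    (h : ∀ x, Continuous fun t => ⟪e x, V t (e x)⟫_ℂ) (ψ : F) :
    Continuous fun t => V t ψ := by
  refine he.continuous_group (fun x => ?_) ψ
  rw [continuous_iff_continuousAt]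
  intro t
  rw [ContinuousAt, tendsto_iff_norm_sub_tendsto_zero]
  -- The group law makes the distance depend only on the diagonal matrix element at time `t - s`.
  have h1 : ∀ s, ‖V s (e x) - V t (e x)‖ =
      Real.sqrt (2 * ‖e x‖ ^ 2 - 2 * RCLike.re ⟪e x, V (t - s) (e x)⟫_ℂ) := by
    intro s
    have h2 : ⟪V s (e x), V t (e x)⟫_ℂ = ⟪e x, V (t - s) (e x)⟫_ℂ := by
      rw [group_inner_left hV, ← hV]; congr 3; ring
    rw [← Real.sqrt_sq (norm_nonneg (V s (e x) - V t (e x))), @norm_sub_sq ℂ, h2,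
      LinearIsometryEquiv.norm_map, LinearIsometryEquiv.norm_map]
    congr 1; ring
  simp only [h1]
  have hc : Continuous fun s =>
      Real.sqrt (2 * ‖e x‖ ^ 2 - 2 * RCLike.re ⟪e x, V (t - s) (e x)⟫_ℂ) := by
    refine Real.continuous_sqrt.comp (continuous_const.sub (continuous_const.mul
      (RCLike.continuous_re.comp ((h x).comp (continuous_const.sub continuous_id)))))
  have := hc.tendsto t
  rw [sub_self, group_zero hV, inner_self_eq_norm_sq_to_K] at this
  have h3 : (RCLike.re ((‖e x‖ : ℂ) ^ 2) : ℝ) = ‖e x‖ ^ 2 := by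
    rw [RCLike.re_eq_complex_re, ← Complex.ofReal_pow, Complex.ofReal_re]
  have h4 : (RCLike.re ((RCLike.ofReal ‖e x‖ : ℂ) ^ 2) : ℝ) = ‖e x‖ ^ 2 := h3
  rw [h4, sub_self, Real.sqrt_zero] at this
  exact this

theorem inner_single_free (p : Σ n, SymL2 d n) (t : ℝ) (Ψ : Fock d) :
    ⟪(lp.single 2 p.1 p.2 : Fock d), free t Ψ⟫_ℂ =
      ∫ k, conj ((p.2 : L2n d p.1) k) * (phase t p.1 k * comp Ψ p.1 k) := by
  rw [lp.inner_single_left, inner_symL2]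
  refine integral_congr_ae ?_
  filter_upwards [comp_free t Ψ p.1] with k hk
  rw [← hk]; rfl

theorem integrable_conj_mul {α : Type*} [MeasurableSpace α] {μ : Measure α} {f g : α → ℂ}
    (hf : MemLp f 2 μ) (hg : MemLp g 2 μ) : Integrable (fun k => conj (f k) * g k) μ :=
  hf.star.integrable_mul hg

theorem continuous_free (Ψ : Fock d) : Continuous fun t => free t Ψ := by
  refine (total_single d).continuous_group' free_add (fun p => ?_) Ψ
  simp only [inner_single_free]
  have hint := integrable_conj_mul (Lp.memLp (p.2 : L2n d p.1))
    (comp_memLp (lp.single 2 p.1 p.2 : Fock d) p.1)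
  refine continuous_of_dominated (bound := fun k => ‖conj ((p.2 : L2n d p.1) k) *
      comp (lp.single 2 p.1 p.2 : Fock d) p.1 k‖) (fun t => ?_)
    (fun t => Eventually.of_forall fun k => ?_) hint.norm (Eventually.of_forall fun k => ?_)
  · have := hint.1.mul (continuous_phase t d p.1).aestronglyMeasurable
    refine this.congr (Eventually.of_forall fun k => ?_)
    simp only [Pi.mul_apply]; ring
  · rw [norm_mul, norm_mul, norm_mul, norm_phase, one_mul]
  · unfold phase; fun_prop

/-- Differentiation under the integral against one-sector vectors gives the weak derivative; the
energy times `Ψ` is `Θ`, which supplies the dominating function. `Total.hasDerivAt` upgrades it to a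
norm derivative. -/
theorem hasDerivAt_free {Ψ Θ : Fock d} (h : (Ψ, Θ) ∈ multGraph fun n (k : Fin n → Space d) => energy n k) :
    HasDerivAt (fun t => free t Ψ) (Complex.I • Θ) 0 := by
  have hc : Continuous fun t => free t (Complex.I • Θ) := continuous_free _
  have := (total_single d).hasDerivAt (u := fun t => free t Ψ) hc (fun p t => ?_) 0
  · rwa [group_zero free_add] at this
  simp only [map_smul, inner_smul_right, inner_single_free]
  rw [← integral_const_mul]
  have hΨ := integrable_conj_mul (Lp.memLp (p.2 : L2n d p.1)) (comp_memLp Ψ p.1)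
  have hΘ := integrable_conj_mul (Lp.memLp (p.2 : L2n d p.1)) (comp_memLp Θ p.1)
  have hmeas : ∀ (Φ : Fock d) (t : ℝ), AEStronglyMeasurable (fun k =>
      conj ((p.2 : L2n d p.1) k) * (phase t p.1 k * comp Φ p.1 k)) := fun Φ t =>
    (Complex.continuous_conj.comp_aestronglyMeasurable (Lp.aestronglyMeasurable _)).mul
      ((continuous_phase t d p.1).aestronglyMeasurable.mul (comp_memLp Φ p.1).1)
  refine (hasDerivAt_integral_of_dominated_loc_of_deriv_le (s := Set.univ)
    (F' := fun t k => Complex.I * (conj ((p.2 : L2n d p.1) k) * (phase t p.1 k * comp Θ p.1 k)))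
    (bound := fun k => ‖conj ((p.2 : L2n d p.1) k) * comp Θ p.1 k‖) univ_mem
    (Eventually.of_forall fun s => hmeas Ψ s) ?_ ((hmeas Θ t).const_mul _)
    (Eventually.of_forall fun k s _ => ?_) hΘ.norm ?_).2
  · refine hΨ.norm.mono' (hmeas Ψ t) (Eventually.of_forall fun k => ?_)
    rw [norm_mul, norm_mul, norm_mul, norm_phase, one_mul]
  · rw [norm_mul, norm_mul, norm_mul, norm_mul, norm_phase, one_mul, Complex.norm_I, one_mul]
  · filter_upwards [h p.1] with k hk s _
    have h1 : HasDerivAt (fun s : ℝ => phase s p.1 k)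
        (Complex.I * energy p.1 k * phase s p.1 k) s := by
      have h2 : HasDerivAt (fun s : ℝ => Complex.I * (s * energy p.1 k : ℝ))
          (Complex.I * energy p.1 k) s := by
        have := ((Complex.ofRealCLM.hasDerivAt (x := s)).mul_const (energy p.1 k : ℂ)).const_mul
          Complex.I
        simpa using this
      have h3 := h2.cexp
      rw [mul_comm] at h3
      exact h3
    have h4 := ((h1.mul_const (comp Ψ p.1 k)).const_mul (conj ((p.2 : L2n d p.1) k)))
    rw [hk]
    refine h4.congr_deriv ?_
    ring

/-- Multiplication by `(E - i)⁻¹` solves the equation. Since `|E - i|` dominates both `1` and `E`,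
this factor and `E (E - i)⁻¹` are bounded by one. The outcome is surjectivity of `H₀ - i`. -/
theorem exists_resolvent (y : Fock d) : ∃ Ψ Θ : Fock d,
    (Ψ, Θ) ∈ multGraph (fun n (k : Fin n → Space d) => energy n k) ∧ Θ - Complex.I • Ψ = y := by
  have hne : ∀ (n : ℕ) (k : Fin n → Space d), (energy n k : ℂ) - Complex.I ≠ 0 := by
    intro n k h
    have := congrArg Complex.im h
    simp at this
  have hm : ∀ n, Measurable (fun k : Fin n → Space d => ((energy n k : ℂ) - Complex.I)⁻¹) := fun n =>
    ((Complex.measurable_ofReal.comp (continuous_energy d n).measurable).sub_const _).inv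
  have hnorm : ∀ (n : ℕ) (k : Fin n → Space d), 1 ≤ ‖(energy n k : ℂ) - Complex.I‖ ∧
      energy n k ≤ ‖(energy n k : ℂ) - Complex.I‖ := by
    intro n k
    constructor
    · have := Complex.abs_im_le_norm ((energy n k : ℂ) - Complex.I)
      simpa using this
    · have := Complex.abs_re_le_norm ((energy n k : ℂ) - Complex.I)
      rw [Complex.sub_re, Complex.ofReal_re, Complex.I_re, sub_zero] at this
      exact (le_abs_self _).trans this
  obtain ⟨Ψ, hΨ⟩ := exists_mul_of_bounded (fun n k => ((energy n k : ℂ) - Complex.I)⁻¹) hm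
    (fun n σ k => by rw [energy_symm]) (fun n k => by
      rw [norm_inv]; exact inv_le_one_of_one_le₀ (hnorm n k).1) y
  obtain ⟨Θ, hΘ⟩ := exists_mul_of_bounded
    (fun n k => (energy n k : ℂ) * ((energy n k : ℂ) - Complex.I)⁻¹)
    (fun n => (Complex.measurable_ofReal.comp (continuous_energy d n).measurable).mul (hm n))
    (fun n σ k => by rw [energy_symm]) (fun n k => by
      rw [norm_mul, norm_inv, Complex.norm_real, Real.norm_of_nonneg (energy_nonneg k),
        ← div_eq_mul_inv]
      exact div_le_one_of_le₀ (hnorm n k).2 (norm_nonneg _)) y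
  refine ⟨Ψ, Θ, fun n => ?_, fock_ext fun n => ?_⟩
  · filter_upwards [hΨ n, hΘ n] with k h1 h2
    rw [h1, h2, mul_assoc]
  · filter_upwards [hΨ n, hΘ n, comp_sub Θ (Complex.I • Ψ) n, comp_smul Complex.I Ψ n]
      with k h1 h2 h3 h4
    rw [h3, h4, h1, h2, ← mul_assoc, ← sub_mul, ← sub_mul, mul_inv_cancel₀ (hne n k), one_mul]

/-- `free` is the unitary group of `H₀ = dΓ(ω)`. -/
theorem isUnitaryGroupOf_free (d : ℕ) :
    IsUnitaryGroupOf (dGamma fun k : Space d => ‖k‖) free := by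
  refine isUnitaryGroupOf_of_surjective free_add continuous_free (fun ψ η h => ?_) fun y => ?_
  · rw [dGamma, mult_graph] at h
    exact hasDerivAt_free h
  · obtain ⟨Ψ, Θ, h, hy⟩ := exists_resolvent y
    refine ⟨Ψ, Θ, ?_, hy⟩
    rw [dGamma, mult_graph]
    exact h

theorem exists_phaseMul (t : ℝ) (g : Lp ℂ 2 (volume : Measure (Space d))) :
    ∃ f : Lp ℂ 2 (volume : Measure (Space d)),
      f =ᵐ[volume] fun q => Complex.exp (Complex.I * (t * ‖q‖ : ℝ)) * g q := by
  have hc : Continuous fun q : Space d => Complex.exp (Complex.I * (t * ‖q‖ : ℝ)) := by fun_prop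
  have h : MemLp (fun q => Complex.exp (Complex.I * (t * ‖q‖ : ℝ)) * g q) 2
      (volume : Measure (Space d)) := by
    refine (Lp.memLp g).of_le (hc.aestronglyMeasurable.mul (Lp.aestronglyMeasurable g))
      (Eventually.of_forall fun q => ?_)
    rw [norm_mul, mul_comm Complex.I, Complex.norm_exp_ofReal_mul_I, one_mul]
  exact ⟨h.toLp _, h.coeFn_toLp⟩

/-- Multiplication of a function of one momentum by `exp(it|k|)`. -/
def phaseMul (t : ℝ) (g : Lp ℂ 2 (volume : Measure (Space d))) :
    Lp ℂ 2 (volume : Measure (Space d)) := (exists_phaseMul t g).choose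

theorem coe_phaseMul (t : ℝ) (g : Lp ℂ 2 (volume : Measure (Space d))) :
    phaseMul t g =ᵐ[volume] fun q => Complex.exp (Complex.I * (t * ‖q‖ : ℝ)) * g q :=
  (exists_phaseMul t g).choose_spec

/-- The phase of a sum of energies is a product of one-particle phases. This is the invariance of
the exponential family that makes it a core. -/
theorem free_expVec (t : ℝ) (g : Lp ℂ 2 (volume : Measure (Space d))) :
    free t (expVec g) = expVec (phaseMul t g) := by
  refine fock_ext fun n => ?_
  have hpt : ∀ᵐ k : Fin n → Space d, ∀ j, phaseMul t g (k j) =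
      Complex.exp (Complex.I * (t * ‖k j‖ : ℝ)) * g (k j) :=
    ae_all_iff.2 fun j => ae_eval (P := fun q => phaseMul t g q =
      Complex.exp (Complex.I * (t * ‖q‖ : ℝ)) * g q) (coe_phaseMul t g) j
  filter_upwards [comp_free t (expVec g) n, comp_expVec g n, comp_expVec (phaseMul t g) n, hpt]
    with k h1 h2 h3 h4
  rw [h1, h2, h3]
  simp only [h4, Finset.prod_mul_distrib, ← Complex.exp_sum]
  rw [phase, energy]
  have : ∑ j, Complex.I * (t * ‖k j‖ : ℝ) = Complex.I * (t * ∑ j, ‖k j‖ : ℝ) := by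
    push_cast; rw [Finset.mul_sum, Finset.mul_sum]
  rw [this]; ring

end FreeHamiltonian

/-! ### The graph of a generator: closedness and weak characterization -/

section GeneratorGraph

variable {F : Type*} [NormedAddCommGroup F] [InnerProductSpace ℂ F]

/-- The graph of the generator of a family of isometries. -/
def genGraph (V : ℝ → (F ≃ₗᵢ[ℂ] F)) : Submodule ℂ (F × F) where
  carrier := {p | HasDerivAt (fun t => V t p.1) (Complex.I • p.2) 0}
  zero_mem' := by simpa using hasDerivAt_const (0 : ℝ) (0 : F)
  add_mem' := by
    intro p q hp hq
    simp only [Set.mem_ofPred_eq, Prod.fst_add, Prod.snd_add, map_add, smul_add]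
    exact HasDerivAt.add hp hq
  smul_mem' := by
    intro c p hp
    simp only [Set.mem_ofPred_eq, Prod.smul_fst, Prod.smul_snd, map_smul, smul_comm Complex.I c]
    exact HasDerivAt.const_smul c hp

theorem mem_genGraph {V : ℝ → (F ≃ₗᵢ[ℂ] F)} {ψ η : F} :
    (ψ, η) ∈ genGraph V ↔ HasDerivAt (fun t => V t ψ) (Complex.I • η) 0 := Iff.rfl

/-- The integrated form of the differential equation, unlike a derivative at `0`, is for each `t` a
closed condition on the pair. -/
theorem genGraph_mem_iff_integral [CompleteSpace F] {V : ℝ → (F ≃ₗᵢ[ℂ] F)}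
    (hV : ∀ s t ψ, V (s + t) ψ = V s (V t ψ)) (hc : ∀ ψ, Continuous fun t => V t ψ) {p : F × F} :
    p ∈ genGraph V ↔ ∀ t, V t p.1 = p.1 + ∫ s in (0 : ℝ)..t, V s (Complex.I • p.2) := by
  constructor
  · intro h t
    have h1 := intervalIntegral.integral_eq_sub_of_hasDerivAt (a := 0) (b := t)
      (fun s _ => group_hasDerivAt hV h s) ((hc _).intervalIntegrable _ _)
    rw [h1, group_zero hV]; abel
  · intro h
    have h3 : HasDerivAt (fun s => p.1 + ∫ r in (0 : ℝ)..s, V r (Complex.I • p.2))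
        (V 0 (Complex.I • p.2)) 0 :=
      (intervalIntegral.integral_hasDerivAt_right ((hc _).intervalIntegrable _ _)
        ((hc _).stronglyMeasurableAtFilter _ _) (hc _).continuousAt).const_add _
    rw [group_zero hV] at h3
    exact h3.congr_of_eventuallyEq (Eventually.of_forall h)

theorem isClosed_genGraph [CompleteSpace F] {V : ℝ → (F ≃ₗᵢ[ℂ] F)}
    (hV : ∀ s t ψ, V (s + t) ψ = V s (V t ψ)) (hc : ∀ ψ, Continuous fun t => V t ψ) :
    IsClosed (genGraph V : Set (F × F)) := by
  have h : (genGraph V : Set (F × F)) =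
      ⋂ t : ℝ, {p | V t p.1 = p.1 + ∫ s in (0 : ℝ)..t, V s (Complex.I • p.2)} := by
    ext p
    rw [SetLike.mem_coe, genGraph_mem_iff_integral hV hc, Set.mem_iInter]
    rfl
  rw [h]
  refine isClosed_iInter fun t => isClosed_eq ((V t).continuous.comp continuous_fst)
    (continuous_fst.add ?_)
  have hint : ∀ η : F, IntervalIntegrable (fun s => V s (Complex.I • η)) volume 0 t := fun η =>
    (hc _).intervalIntegrable _ _
  -- The integral over `[0,t]` of isometries is Lipschitz in `η` with constant `|t|`.
  have hl : LipschitzWith ‖t‖₊ fun η : F => ∫ s in (0 : ℝ)..t, V s (Complex.I • η) := by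
    refine LipschitzWith.of_dist_le_mul fun η η' => ?_
    rw [dist_eq_norm, dist_eq_norm, ← intervalIntegral.integral_sub (hint η) (hint η')]
    have := intervalIntegral.norm_integral_le_of_norm_le_const (a := 0) (b := t) (C := ‖η - η'‖)
      (f := fun s => V s (Complex.I • η) - V s (Complex.I • η')) (fun s _ => by
        rw [← map_sub, ← smul_sub, LinearIsometryEquiv.norm_map, norm_smul, Complex.norm_I, one_mul])
    rw [sub_zero] at this
    rw [mul_comm]
    exact this
  exact hl.continuous.comp continuous_snd

/-- The generator commutes with its group: differentiate `s ↦ V s (V t ψ) = c V s φ` at `0`. -/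
theorem group_generator_eq {V : ℝ → (F ≃ₗᵢ[ℂ] F)} (hV : ∀ s t ψ, V (s + t) ψ = V s (V t ψ))
    {ψ η φ ξ : F} (h : (ψ, η) ∈ genGraph V) (h' : (φ, ξ) ∈ genGraph V) {t : ℝ} {c : ℂ}
    (heq : V t ψ = c • φ) : V t η = c • ξ := by
  have h1 := group_hasDerivAt hV h t
  have h2 : HasDerivAt (fun s => V s (c • φ)) (V t (Complex.I • η)) 0 := by
    rw [← heq]
    have := HasDerivAt.scomp (g₁ := fun s => V s ψ) (h := fun s : ℝ => s + t) (h' := 1) 0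
      (by simpa using h1) ((hasDerivAt_id (0 : ℝ)).add_const t)
    simpa only [Function.comp_def, hV, one_smul, zero_add, map_smul] using this
  have h3 := HasDerivAt.const_smul c h'
  simp only [map_smul] at h2
  have h4 := h2.unique h3
  rw [smul_comm c] at h4
  exact smul_right_injective F Complex.I_ne_zero h4

/-- A pair that is weakly in the graph against an invariant total family in the domain of the
generator belongs to the graph of the generator. -/
theorem mem_genGraph_of_weak [CompleteSpace F] {V : ℝ → (F ≃ₗᵢ[ℂ] F)}
    (hV : ∀ s t ψ, V (s + t) ψ = V s (V t ψ)) (hc : ∀ ψ, Continuous fun t => V t ψ)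
    {X : Type*} {e g : X → F} (he : Total e) (hg : ∀ x, (e x, g x) ∈ genGraph V)
    (hinv : ∀ x t, ∃ (y : X) (c : ℂ), V t (e x) = c • e y) {χ θ : F}
    (h : ∀ x, ⟪g x, χ⟫_ℂ = ⟪e x, θ⟫_ℂ) : (χ, θ) ∈ genGraph V := by
  have h0 : ∀ t, HasDerivAt (fun s => V s χ) (V t (Complex.I • θ)) t := by
    refine he.hasDerivAt (hc _) fun x t => ?_
    have h1 : (fun s => ⟪e x, V s χ⟫_ℂ) = fun s => ⟪V (-s) (e x), χ⟫_ℂ := by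
      funext s
      rw [group_inner_left hV, neg_neg]
    have h2 : HasDerivAt (fun s => V (-s) (e x)) (-V (-t) (Complex.I • g x)) t := by
      have := HasDerivAt.scomp (g₁ := fun s => V s (e x)) (h := fun s : ℝ => -s) (h' := -1) t
        (group_hasDerivAt hV (hg x) (-t)) (hasDerivAt_neg t)
      simpa only [Function.comp_def, neg_smul, one_smul] using this
    have h3 := h2.inner ℂ (hasDerivAt_const t χ)
    rw [h1]
    refine h3.congr_deriv ?_
    -- Moving the group onto the test vector keeps it in the family up to a scalar, so the weak
    -- relation `h` is available at every time and identifies the weak derivative.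
    obtain ⟨y, c, hy⟩ := hinv x (-t)
    have h4 := group_generator_eq hV (hg x) (hg y) hy
    have h5 : ⟪e x, V t (Complex.I • θ)⟫_ℂ = ⟪V (-t) (e x), Complex.I • θ⟫_ℂ := by
      rw [group_inner_left hV, neg_neg]
    rw [h5, inner_zero_right, zero_add, map_smul, h4, hy, inner_neg_left]
    simp only [inner_smul_left, inner_smul_right, Complex.conj_I, h]
    ring
  have := h0 0
  rwa [group_zero hV] at this

end GeneratorGraph

/-! ### Energy of exponential vectors and energy bounds for annihilation -/

section Bounds

open scoped ENNReal

variable {d n : ℕ}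

theorem exists_creatExp (η g : Lp ℂ 2 (volume : Measure (Space d))) :
    ∃ Ξ, (expVec g, Ξ) ∈ creationGraph η :=
  (exists_creation η (expVec_mem_annihilation η g)).imp fun _ h => h.1

/-- The vector `a†(η) e(g)`. -/
def creatExp (η g : Lp ℂ 2 (volume : Measure (Space d))) : Fock d := (exists_creatExp η g).choose

theorem creatExp_mem (η g : Lp ℂ 2 (volume : Measure (Space d))) :
    (expVec g, creatExp η g) ∈ creationGraph η := (exists_creatExp η g).choose_spec

theorem inner_creatExp_left (η g h : Lp ℂ 2 (volume : Measure (Space d))) :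
    ⟪creatExp η g, expVec h⟫_ℂ = ⟪η, h⟫_ℂ * Complex.exp ⟪g, h⟫_ℂ := by
  rw [inner_creation_left (creatExp_mem η g) (expVec_mem_annihilation η h), inner_smul_right,
    inner_expVec]

theorem inner_creatExp_right (η g h : Lp ℂ 2 (volume : Measure (Space d))) :
    ⟪expVec h, creatExp η g⟫_ℂ = ⟪h, η⟫_ℂ * Complex.exp ⟪h, g⟫_ℂ := by
  rw [← inner_conj_symm, inner_creatExp_left, map_mul, inner_conj_symm, ← Complex.exp_conj,
    inner_conj_symm]

/-- Multiplying `∏ g(kⱼ)` by `∑ |kⱼ|` replaces one factor `g` at a time by `|k|g`, which is the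
creation formula for `|k|g`. -/
theorem expVec_mem_energy {g ωg : Lp ℂ 2 (volume : Measure (Space d))}
    (h : ωg =ᵐ[volume] fun q => (‖q‖ : ℂ) * g q) :
    (expVec g, creatExp ωg g) ∈ multGraph fun n (k : Fin n → Space d) => energy n k := by
  obtain ⟨h0, h1⟩ := creatExp_mem ωg g
  intro n
  cases n with
  | zero =>
    filter_upwards [h0] with k hk
    rw [hk]; simp [energy]
  | succ n =>
    have h2 : ∀ᵐ k : Fin (n + 1) → Space d, ∀ j, ωg (k j) = (‖k j‖ : ℂ) * g (k j) :=
      ae_all_iff.2 fun j => ae_eval (P := fun q => ωg q = (‖q‖ : ℂ) * g q) h j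
    have h3 : ∀ᵐ k : Fin (n + 1) → Space d, ∀ j : Fin (n + 1),
        comp (expVec g) n (fun i => k (j.succAbove i)) =
          ((Real.sqrt n.factorial : ℂ))⁻¹ * ∏ i, g (k (j.succAbove i)) :=
      ae_all_iff.2 fun j => (quasiMeasurePreserving_remove d n j).ae (comp_expVec g n)
    filter_upwards [h1 n, h2, h3, comp_expVec g (n + 1)] with k h4 h5 h6 h7
    rw [h4, h7]
    have h8 : ∀ j : Fin (n + 1), ωg (k j) * comp (expVec g) n (fun i => k (j.succAbove i)) =
        (‖k j‖ : ℂ) * (((Real.sqrt n.factorial : ℂ))⁻¹ * ∏ i, g (k i)) := by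
      intro j
      rw [h5, h6, Fin.prod_univ_succAbove (fun i => g (k i)) j]; ring
    simp only [h8]
    have h9 : (Real.sqrt (n + 1).factorial : ℂ) =
        (Real.sqrt (n + 1) : ℂ) * (Real.sqrt n.factorial : ℂ) := by
      rw [← Complex.ofReal_mul, ← Real.sqrt_mul (by positivity), Nat.factorial_succ]
      push_cast; rfl
    rw [← Finset.sum_mul, h9, energy, mul_inv, Complex.ofReal_sum]
    ring

/-- The expectation value of the energy, possibly infinite. -/
def energyForm (Ψ : Fock d) : ℝ≥0∞ :=
  ∑' n, ∫⁻ k, ENNReal.ofReal (energy n k) * ‖comp Ψ n k‖ₑ ^ 2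

/-- Pointwise `E ≤ εE² + 1/(4ε)` by completing the square. The freedom to take `ε` small is what
makes the interaction a small perturbation. -/
theorem energyForm_le {Ψ Θ : Fock d}
    (h : (Ψ, Θ) ∈ multGraph fun n (k : Fin n → Space d) => energy n k) {ε : ℝ} (hε : 0 < ε) :
    energyForm Ψ ≤ ENNReal.ofReal (ε * ‖Θ‖ ^ 2 + (4 * ε)⁻¹ * ‖Ψ‖ ^ 2) := by
  have h1 : ∀ Φ : Fock d, ENNReal.ofReal (‖Φ‖ ^ 2) = ∑' n, ∫⁻ k, ‖comp Φ n k‖ₑ ^ 2 := by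
    intro Φ
    rw [← fock_norm_sq', ENNReal.ofReal_pow (norm_nonneg _), ofReal_norm]
  rw [ENNReal.ofReal_add (by positivity) (by positivity), ENNReal.ofReal_mul (by positivity),
    ENNReal.ofReal_mul (by positivity), h1, h1, ← ENNReal.tsum_mul_left, ← ENNReal.tsum_mul_left,
    ← ENNReal.tsum_add]
  refine ENNReal.tsum_le_tsum fun n => ?_
  rw [← lintegral_const_mul'' _ ((comp_memLp Θ n).1.enorm.pow_const 2),
    ← lintegral_const_mul'' _ ((comp_memLp Ψ n).1.enorm.pow_const 2),
    ← lintegral_add_left' (((comp_memLp Θ n).1.enorm.pow_const 2).const_mul _)]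
  refine lintegral_mono_ae ?_
  filter_upwards [h n] with k hk
  rw [hk, enorm_mul, mul_pow, ← mul_assoc, ← add_mul]
  gcongr
  have h2 : ‖(energy n k : ℂ)‖ₑ ^ 2 = ENNReal.ofReal (energy n k ^ 2) := by
    rw [← ofReal_norm, Complex.norm_real, ← ENNReal.ofReal_pow (norm_nonneg _), Real.norm_eq_abs,
      sq_abs]
  rw [h2, ← ENNReal.ofReal_mul hε.le, ← ENNReal.ofReal_add (by positivity) (by positivity)]
  refine ENNReal.ofReal_le_ofReal ?_
  have h3 : ε * energy n k ^ 2 + (4 * ε)⁻¹ - energy n k =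
      ε * (energy n k - (2 * ε)⁻¹) ^ 2 := by
    field_simp; ring
  have : 0 ≤ ε * (energy n k - (2 * ε)⁻¹) ^ 2 := by positivity
  linarith

theorem ofReal_energy (k : Fin n → Space d) :
    ENNReal.ofReal (energy n k) = ∑ j, ENNReal.ofReal (Real.sqrt ‖k j‖) ^ 2 := by
  rw [energy, ENNReal.ofReal_sum_of_nonneg fun _ _ => norm_nonneg _]
  refine Finset.sum_congr rfl fun j _ => ?_
  rw [← ENNReal.ofReal_pow (Real.sqrt_nonneg _), Real.sq_sqrt (norm_nonneg _)]

theorem ae_ne_zero (hd : 0 < d) : ∀ᵐ q : Space d, q ≠ 0 := by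
  have : Nonempty (Fin d) := ⟨⟨0, hd⟩⟩
  have : Nontrivial (Space d) := inferInstance
  exact Measure.ae_ne volume 0

/-- The annihilation operator is bounded relative to the free energy. -/
theorem exists_annihilation (hd : 0 < d) {f : Lp ℂ 2 (volume : Measure (Space d))}
    (hf : ∫⁻ q, ‖f q‖ₑ ^ 2 / ENNReal.ofReal ‖q‖ ≠ ⊤) {Ψ : Fock d} (hΨ : energyForm Ψ ≠ ⊤) :
    ∃ Ξ, (Ψ, Ξ) ∈ annihilationGraph f ∧
      ‖Ξ‖ₑ ^ 2 ≤ (∫⁻ q, ‖f q‖ₑ ^ 2 / ENNReal.ofReal ‖q‖) * energyForm Ψ := by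
  have hle : ∑' n, ‖annih f n (Ψ (n + 1))‖ₑ ^ 2 ≤
      (∫⁻ q, ‖f q‖ₑ ^ 2 / ENNReal.ofReal ‖q‖) * energyForm Ψ := by
    calc ∑' n, ‖annih f n (Ψ (n + 1))‖ₑ ^ 2
        ≤ ∑' n, (∫⁻ q, ‖f q‖ₑ ^ 2 / ENNReal.ofReal ‖q‖) *
          ∫⁻ k, ENNReal.ofReal (energy (n + 1) k) * ‖comp Ψ (n + 1) k‖ₑ ^ 2 := by
          refine ENNReal.tsum_le_tsum fun n => ?_
          -- The weight `√|q|` is chosen so that the sum of its squares is the energy.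
          have h := lintegral_annihFun_le f (Ψ (n + 1))
            (w := fun q => ENNReal.ofReal (Real.sqrt ‖q‖)) (by fun_prop) (by
              filter_upwards [ae_ne_zero hd] with q hq
              simpa using hq) (by simp)
          simp only [← ofReal_energy] at h
          have h2 : ∀ q : Space d, ENNReal.ofReal (Real.sqrt ‖q‖) ^ 2 = ENNReal.ofReal ‖q‖ := by
            intro q
            rw [← ENNReal.ofReal_pow (Real.sqrt_nonneg _), Real.sq_sqrt (norm_nonneg _)]
          simp only [h2] at h
          refine le_trans (le_of_eq ?_) h
          rw [enorm_sq_symL2]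
          refine lintegral_congr_ae ?_
          filter_upwards [coe_annih f (Ψ (n + 1))] with k hk
          rw [hk]
      _ ≤ _ := by
          rw [ENNReal.tsum_mul_left]
          gcongr
          exact ENNReal.tsum_comp_le_tsum_of_injective (add_left_injective 1)
            fun n => ∫⁻ k, ENNReal.ofReal (energy n k) * ‖comp Ψ n k‖ₑ ^ 2
  obtain ⟨Ξ, hΞ⟩ := exists_fock (fun n => annih f n (Ψ (n + 1)))
    (ne_top_of_le_ne_top (ENNReal.mul_ne_top hf hΨ) hle)
  refine ⟨Ξ, mem_annihilationGraph.2 hΞ, ?_⟩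
  rw [fock_norm_sq]
  simp only [hΞ]
  exact hle

end Bounds

/-! ### Graphs of sums, multiples and closures -/

section Graphs

variable {F : Type*} [NormedAddCommGroup F] [InnerProductSpace ℂ F]

theorem mem_graph_add {A B : F →ₗ.[ℂ] F} {ψ η : F} :
    (ψ, η) ∈ (A + B).graph ↔ ∃ a b, (ψ, a) ∈ A.graph ∧ (ψ, b) ∈ B.graph ∧ η = a + b := by
  simp only [LinearPMap.mem_graph_iff]
  constructor
  · rintro ⟨y, rfl, rfl⟩
    exact ⟨_, _, ⟨⟨y, y.2.1⟩, rfl, rfl⟩, ⟨⟨y, y.2.2⟩, rfl, rfl⟩, LinearPMap.add_apply _ _ _⟩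
  · rintro ⟨_, _, ⟨y, hy, rfl⟩, ⟨z, hz, rfl⟩, rfl⟩
    subst hy
    refine ⟨⟨y, y.2, hz ▸ z.2⟩, rfl, ?_⟩
    rw [LinearPMap.add_apply]
    congr 2
    exact Subtype.ext hz.symm

theorem mem_graph_neg {A : F →ₗ.[ℂ] F} {ψ η : F} :
    (ψ, η) ∈ (-A).graph ↔ (ψ, -η) ∈ A.graph := by
  simp only [LinearPMap.mem_graph_iff]
  constructor
  · rintro ⟨y, rfl, rfl⟩
    exact ⟨y, rfl, by rw [LinearPMap.neg_apply, neg_neg]⟩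
  · rintro ⟨y, rfl, h⟩
    exact ⟨y, rfl, by rw [LinearPMap.neg_apply, h, neg_neg]⟩

theorem mem_graph_smul {A : F →ₗ.[ℂ] F} {c : ℂ} {ψ η : F} :
    (ψ, η) ∈ (c • A).graph ↔ ∃ a, (ψ, a) ∈ A.graph ∧ η = c • a := by
  simp only [LinearPMap.mem_graph_iff]
  constructor
  · rintro ⟨y, rfl, rfl⟩
    exact ⟨_, ⟨y, rfl, rfl⟩, LinearPMap.smul_apply _ _ _⟩
  · rintro ⟨_, ⟨y, rfl, rfl⟩, rfl⟩
    exact ⟨y, rfl, LinearPMap.smul_apply _ _ _⟩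

/-- A linear operator whose graph has the graph of a unitary group's generator as its closure is
essentially self-adjoint. -/
theorem isUnitaryGroupOf_closure [CompleteSpace F] {V : ℝ → (F ≃ₗᵢ[ℂ] F)}
    (hV : ∀ s t ψ, V (s + t) ψ = V s (V t ψ)) (hc : ∀ ψ, Continuous fun t => V t ψ)
    {A : F →ₗ.[ℂ] F} (h : A.graph.topologicalClosure = genGraph V) :
    IsUnitaryGroupOf A.closure V := by
  -- A generator is single valued, so its graph is that of an operator and witnesses that `A` is
  -- closable.
  have hg : (genGraph V).toLinearPMap.graph = genGraph V := by
    refine Submodule.toLinearPMap_graph_eq _ ?_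
    rintro ⟨ψ, η⟩ hp h0
    obtain rfl : ψ = 0 := h0
    have h1 : HasDerivAt (fun t => V t (0 : F)) (Complex.I • η) 0 := hp
    simp only [map_zero] at h1
    have h2 := h1.unique (hasDerivAt_const _ _)
    exact (smul_eq_zero.1 h2).resolve_left Complex.I_ne_zero
  have hcl : A.IsClosable := ⟨_, h.trans hg.symm⟩
  refine ⟨hV, hc, fun ψ η => ?_⟩
  rw [← hcl.graph_closure_eq_closure_graph, h]
  exact mem_genGraph

theorem Total.ext_continuous {X : Type*} {e : X → F} [CompleteSpace F] (he : Total e)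
    {S T : F →ₗᵢ[ℂ] F} (h : ∀ x, S (e x) = T (e x)) (ψ : F) : S ψ = T ψ := by
  have h1 : Set.EqOn S T (Submodule.span ℂ (Set.range e) : Set F) := by
    intro φ hφ
    induction hφ using Submodule.span_induction with
    | mem y hy => obtain ⟨x, rfl⟩ := hy; exact h x
    | zero => simp
    | add y z _ _ hy hz => rw [map_add, map_add, hy, hz]
    | smul c y _ hy => rw [map_smul, map_smul, hy]
  exact congrFun (S.continuous.ext_on he.dense_span T.continuous h1) ψ

end Graphs

/-! ### Weyl operators and essential self-adjointness of `π_S` -/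

section Weyl

variable {d : ℕ}

/-- The factor `exp(-‖v‖²/2 - ⟨v,g⟩)`. -/
def weylFactor (v g : Lp ℂ 2 (volume : Measure (Space d))) : ℂ :=
  Complex.exp (-(1 / 2) * ⟪v, v⟫_ℂ - ⟪v, g⟫_ℂ)

/-- Shifting both arguments adds `⟪f,v⟫ + ⟪v,g⟫ + ‖v‖²` to the exponent of the Gram matrix, and
`weylFactor` is chosen to remove exactly these terms. An isometry then exists because the family is
total. -/
theorem exists_weyl (v : Lp ℂ 2 (volume : Measure (Space d))) :
    ∃ T : Fock d →ₗᵢ[ℂ] Fock d, ∀ g, T (expVec g) = weylFactor v g • expVec (g + v) := by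
  refine exists_isometry_of_inner_eq (total_expVec d) fun f g => ?_
  rw [inner_smul_left, inner_smul_right, inner_expVec, inner_expVec, weylFactor, weylFactor,
    ← Complex.exp_conj, ← Complex.exp_add, ← Complex.exp_add]
  congr 1
  simp only [map_sub, map_mul, map_neg, inner_conj_symm, inner_add_left, inner_add_right, map_div₀,
    map_one, map_ofNat]
  ring

/-- The Weyl operator as an isometry. -/
def weylIso (v : Lp ℂ 2 (volume : Measure (Space d))) : Fock d →ₗᵢ[ℂ] Fock d :=
  (exists_weyl v).choose

theorem weylIso_expVec (v g : Lp ℂ 2 (volume : Measure (Space d))) :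
    weylIso v (expVec g) = weylFactor v g • expVec (g + v) := (exists_weyl v).choose_spec g

/-- For real multiples of one vector, `⟪s v, t v⟫` is real, so the phase in the composition law of
Weyl operators is absent and a true group results. -/
theorem weylIso_smul_comp (v : Lp ℂ 2 (volume : Measure (Space d))) (s t : ℝ) (ψ : Fock d) :
    weylIso ((s : ℂ) • v) (weylIso ((t : ℂ) • v) ψ) = weylIso (((s + t : ℝ) : ℂ) • v) ψ := by
  refine (total_expVec d).ext_continuous (S := (weylIso ((s : ℂ) • v)).comp (weylIso ((t : ℂ) • v)))
    (T := weylIso (((s + t : ℝ) : ℂ) • v)) (fun g => ?_) ψ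
  change weylIso _ (weylIso _ (expVec g)) = _
  rw [weylIso_expVec, weylIso_expVec, map_smul, weylIso_expVec,
    smul_smul, add_assoc, ← add_smul, weylFactor, weylFactor, weylFactor, ← Complex.exp_add]
  congr 2
  · simp only [inner_smul_left, inner_smul_right, inner_add_right, Complex.conj_ofReal]
    push_cast
    ring
  · push_cast
    rw [add_comm (t : ℂ)]

theorem weylIso_zero (ψ : Fock d) : weylIso (0 : Lp ℂ 2 (volume : Measure (Space d))) ψ = ψ := by
  refine (total_expVec d).ext_continuous (S := weylIso 0) (T := LinearIsometry.id) (fun g => ?_) ψ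
  rw [weylIso_expVec]
  simp [weylFactor]

/-- The one-parameter group of Weyl operators `t ↦ W(-t v)`. -/
def weyl (v : Lp ℂ 2 (volume : Measure (Space d))) (t : ℝ) : Fock d ≃ₗᵢ[ℂ] Fock d where
  toFun := weylIso (((-t : ℝ) : ℂ) • v)
  invFun := weylIso ((t : ℂ) • v)
  left_inv ψ := by rw [weylIso_smul_comp]; simp [weylIso_zero]
  right_inv ψ := by rw [weylIso_smul_comp]; simp [weylIso_zero]
  map_add' := map_add _
  map_smul' := map_smul _
  norm_map' := (weylIso _).norm_map

theorem weyl_apply (v : Lp ℂ 2 (volume : Measure (Space d))) (t : ℝ) (ψ : Fock d) :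
    weyl v t ψ = weylIso (((-t : ℝ) : ℂ) • v) ψ := rfl

theorem weyl_add (v : Lp ℂ 2 (volume : Measure (Space d))) (s t : ℝ) (ψ : Fock d) :
    weyl v (s + t) ψ = weyl v s (weyl v t ψ) := by
  rw [weyl_apply, weyl_apply, weyl_apply, weylIso_smul_comp, neg_add]

theorem weyl_expVec (v g : Lp ℂ 2 (volume : Measure (Space d))) (t : ℝ) :
    weyl v t (expVec g) = Complex.exp (-(1 / 2) * t ^ 2 * ⟪v, v⟫_ℂ + t * ⟪v, g⟫_ℂ) •
      expVec (g + ((-t : ℝ) : ℂ) • v) := by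
  rw [weyl_apply, weylIso_expVec, weylFactor]
  congr 2
  simp only [inner_smul_left, inner_smul_right, Complex.conj_ofReal]
  push_cast
  ring

theorem inner_weyl_expVec (v g h : Lp ℂ 2 (volume : Measure (Space d))) (t : ℝ) :
    ⟪expVec h, weyl v t (expVec g)⟫_ℂ = Complex.exp (-(1 / 2) * t ^ 2 * ⟪v, v⟫_ℂ +
      t * (⟪v, g⟫_ℂ - ⟪h, v⟫_ℂ) + ⟪h, g⟫_ℂ) := by
  rw [weyl_expVec, inner_smul_right, inner_expVec, ← Complex.exp_add, inner_add_right,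
    inner_smul_right]
  congr 1
  push_cast
  ring

theorem continuous_weyl (v : Lp ℂ 2 (volume : Measure (Space d))) (ψ : Fock d) :
    Continuous fun t => weyl v t ψ := by
  refine (total_expVec d).continuous_group' (weyl_add v) (fun g => ?_) ψ
  simp only [inner_weyl_expVec]
  fun_prop

/-- The derivative of the Weyl group on exponential vectors. -/
theorem hasDerivAt_weyl (v g : Lp ℂ 2 (volume : Measure (Space d))) :
    HasDerivAt (fun t => weyl v t (expVec g)) (⟪v, g⟫_ℂ • expVec g - creatExp v g) 0 := by
  have h := (total_expVec d).hasDerivAt (u := fun t => weyl v t (expVec g))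
    (continuous_weyl v (⟪v, g⟫_ℂ • expVec g - creatExp v g)) (fun h t => ?_) 0
  · rwa [group_zero (weyl_add v)] at h
  simp only [inner_weyl_expVec]
  -- Matrix elements between exponential vectors are exponentials of a quadratic polynomial in time,
  -- so the weak derivative can be computed at every `t`.
  have h1 : HasDerivAt (fun s : ℝ => (-(1 / 2) * (s : ℂ) ^ 2 * ⟪v, v⟫_ℂ +
      s * (⟪v, g⟫_ℂ - ⟪h, v⟫_ℂ) + ⟪h, g⟫_ℂ)) (-t * ⟪v, v⟫_ℂ + (⟪v, g⟫_ℂ - ⟪h, v⟫_ℂ)) t := by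
    have h2 : HasDerivAt (fun s : ℝ => (s : ℂ)) 1 t := by
      exact (hasDerivAt_id (t : ℂ)).comp_ofReal
    have h3 := ((((h2.pow 2).const_mul (-(1 / 2) : ℂ)).mul_const ⟪v, v⟫_ℂ).add
      (h2.mul_const (⟪v, g⟫_ℂ - ⟪h, v⟫_ℂ))).add_const ⟪h, g⟫_ℂ
    refine h3.congr_deriv ?_
    push_cast
    ring
  refine h1.cexp.congr_deriv ?_
  rw [← neg_neg t, ← group_inner_left (weyl_add v), weyl_expVec, inner_smul_left, inner_sub_right,
    inner_smul_right, inner_expVec, inner_creatExp_right, ← Complex.exp_conj]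
  simp only [map_add, map_mul, map_neg, map_div₀, map_one, map_ofNat, map_pow, Complex.conj_ofReal,
    inner_conj_symm, inner_add_left, inner_smul_left, neg_neg]
  rw [← sub_mul, mul_left_comm, ← Complex.exp_add]
  push_cast
  ring_nf

/-- The Segal operator `π_S(f)` acts on exponential vectors as the generator of the Weyl group. -/
theorem expVec_mem_segalPi (f g : Lp ℂ 2 (volume : Measure (Space d))) :
    (expVec g, (Complex.I * ((1 / Real.sqrt 2 : ℝ) : ℂ)) •
      (-(⟪f, g⟫_ℂ • expVec g) + creatExp f g)) ∈ (segalPi f).graph := by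
  rw [segalPi, mem_graph_smul]
  refine ⟨_, mem_graph_add.2 ⟨_, _, mem_graph_neg.2 ?_, ?_, rfl⟩, rfl⟩
  · rw [neg_neg, annihilation_graph]; exact expVec_mem_annihilation f g
  · rw [creation_graph]; exact creatExp_mem f g

theorem mem_segalPi {f : Lp ℂ 2 (volume : Measure (Space d))} {Ψ Θ : Fock d} :
    (Ψ, Θ) ∈ (segalPi f).graph ↔ ∃ a b, (Ψ, a) ∈ annihilationGraph f ∧ (Ψ, b) ∈ creationGraph f ∧
      Θ = (Complex.I * ((1 / Real.sqrt 2 : ℝ) : ℂ)) • (-a + b) := by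
  rw [segalPi, mem_graph_smul]
  constructor
  · rintro ⟨_, h, rfl⟩
    obtain ⟨a, b, ha, hb, rfl⟩ := mem_graph_add.1 h
    rw [mem_graph_neg, annihilation_graph] at ha
    rw [creation_graph] at hb
    exact ⟨-a, b, ha, hb, by rw [neg_neg]⟩
  · rintro ⟨a, b, ha, hb, rfl⟩
    refine ⟨_, mem_graph_add.2 ⟨-a, b, ?_, ?_, rfl⟩, rfl⟩
    · rw [mem_graph_neg, annihilation_graph, neg_neg]; exact ha
    · rw [creation_graph]; exact hb

theorem inner_annihilation_left {f : Lp ℂ 2 (volume : Measure (Space d))} {Ψ Θ Φ Ξ : Fock d}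
    (h : (Ψ, Θ) ∈ annihilationGraph f) (h' : (Φ, Ξ) ∈ creationGraph f) :
    ⟪Θ, Φ⟫_ℂ = ⟪Ψ, Ξ⟫_ℂ := by
  rw [← inner_conj_symm, ← inner_creation_left h' h, inner_conj_symm]

theorem creatExp_smul (c : ℂ) (f g : Lp ℂ 2 (volume : Measure (Space d))) :
    creatExp (c • f) g = c • creatExp f g := by
  refine (total_expVec d).ext fun h => ?_
  rw [inner_smul_right, inner_creatExp_right, inner_creatExp_right, inner_smul_right]
  ring

/-- Adjointness of `a` and `a†` puts every pair in the graph of `π_S(f)` weakly in the graph of the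
generator, hence in it, and the generator is closed. Conversely the exponential vectors lie in the
domain of `π_S(f)` and form a core. The scaling of `v` absorbs the `1/√2` of the Segal operator. -/
theorem segalPi_closure_graph {f v : Lp ℂ 2 (volume : Measure (Space d))}
    (hv : v = ((1 / Real.sqrt 2 : ℝ) : ℂ) • f) :
    (segalPi f).graph.topologicalClosure = genGraph (weyl v) := by
  have hval : ∀ g, Complex.I • ((Complex.I * ((1 / Real.sqrt 2 : ℝ) : ℂ)) •
      (-(⟪f, g⟫_ℂ • expVec g) + creatExp f g)) = ⟪v, g⟫_ℂ • expVec g - creatExp v g := by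
    intro g
    rw [hv, creatExp_smul, inner_smul_left, Complex.conj_ofReal, smul_smul, ← mul_assoc,
      Complex.I_mul_I]
    simp only [smul_add, smul_neg, smul_smul, neg_mul, one_mul, neg_smul]
    abel
  have hgen : ∀ g, (expVec g, (Complex.I * ((1 / Real.sqrt 2 : ℝ) : ℂ)) •
      (-(⟪f, g⟫_ℂ • expVec g) + creatExp f g)) ∈ genGraph (weyl v) := by
    intro g
    rw [mem_genGraph, hval]
    exact hasDerivAt_weyl v g
  have hinv : ∀ g t, ∃ (y : Lp ℂ 2 (volume : Measure (Space d))) (c : ℂ),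
      weyl v t (expVec g) = c • expVec y := fun g t => ⟨_, _, weyl_expVec v g t⟩
  refine le_antisymm (Submodule.topologicalClosure_minimal _ ?_
    (isClosed_genGraph (weyl_add v) (continuous_weyl v))) ?_
  · rintro ⟨χ, θ⟩ h
    refine mem_genGraph_of_weak (weyl_add v) (continuous_weyl v) (total_expVec d) hgen hinv
      fun g => ?_
    obtain ⟨a, b, ha, hb, rfl⟩ := mem_segalPi.1 h
    have h1 := inner_creation_left (creatExp_mem f g) ha
    have h2 := inner_annihilation_left (expVec_mem_annihilation f g) hb
    rw [inner_smul_left, inner_smul_right, inner_add_left, inner_neg_left, inner_add_right,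
      inner_neg_right, h1, h2, map_mul, Complex.conj_I, Complex.conj_ofReal]
    ring
  · rintro ⟨ψ, η⟩ h
    have h1 := generator_mem_closure (weyl_add v) (total_expVec d) hgen hinv h
    refine Submodule.topologicalClosure_mono (Submodule.span_le.2 ?_) h1
    rintro _ ⟨g, rfl⟩
    exact expVec_mem_segalPi f g

theorem isUnitaryGroupOf_weyl {f v : Lp ℂ 2 (volume : Measure (Space d))}
    (hv : v = ((1 / Real.sqrt 2 : ℝ) : ℂ) • f) : IsUnitaryGroupOf (segalPi f).closure (weyl v) :=
  isUnitaryGroupOf_closure (weyl_add v) (continuous_weyl v) (segalPi_closure_graph hv)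

/-- `expI` picks a group by choice; a total family in the domain makes the domain dense, and then
the uniqueness theorem identifies the choice. -/
theorem IsUnitaryGroupOf.expI_eq {F : Type*} [NormedAddCommGroup F] [InnerProductSpace ℂ F]
    [CompleteSpace F] {A : F →ₗ.[ℂ] F} {V : ℝ → (F ≃ₗᵢ[ℂ] F)} (hV : IsUnitaryGroupOf A V)
    {X : Type*} {e : X → F} (he : Total e) (hA : ∀ x, e x ∈ A.domain) (t : ℝ) : expI A t = V t := by
  have h : HasUnitaryGroup A := ⟨V, hV⟩
  have hd : Dense (A.domain : Set F) := he.dense_span.mono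
    (Submodule.span_le.2 (by rintro _ ⟨x, rfl⟩; exact hA x))
  rw [expI, dif_pos h]
  exact LinearIsometryEquiv.ext fun ψ => h.choose_spec.unique hV he hA hd t ψ

theorem expI_segalPi {f v : Lp ℂ 2 (volume : Measure (Space d))}
    (hv : v = ((1 / Real.sqrt 2 : ℝ) : ℂ) • f) (t : ℝ) :
    expI (segalPi f).closure t = weyl v t := by
  refine (isUnitaryGroupOf_weyl hv).expI_eq (total_expVec d) (fun g => ?_) t
  exact LinearPMap.mem_domain_iff.2
    ⟨_, LinearPMap.le_graph_of_le (LinearPMap.le_closure _) (expVec_mem_segalPi f g)⟩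

end Weyl

/-! ### The van Hove Hamiltonian as the dressed free Hamiltonian -/

section Hamiltonian

open scoped ENNReal

variable {d : ℕ}

/-- The graph of the free Hamiltonian. -/
abbrev freeGraph (d : ℕ) : Submodule ℂ (Fock d × Fock d) :=
  multGraph fun n (k : Fin n → Space d) => energy n k

theorem freeGraph_eq_genGraph (d : ℕ) : freeGraph d = genGraph free := by
  have h := (isUnitaryGroupOf_free d).generator
  rw [dGamma, mult_graph] at h
  ext ⟨ψ, η⟩
  exact h ψ η

theorem isClosed_freeGraph (d : ℕ) : IsClosed (freeGraph d : Set (Fock d × Fock d)) := by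
  rw [freeGraph_eq_genGraph]
  exact isClosed_genGraph free_add continuous_free

theorem freeGraph_symmetric {ψ η φ ξ : Fock d} (h : (ψ, η) ∈ freeGraph d)
    (h' : (φ, ξ) ∈ freeGraph d) : ⟪η, φ⟫_ℂ = ⟪ψ, ξ⟫_ℂ := by
  rw [freeGraph_eq_genGraph] at h h'
  exact generator_symmetric free_add h h'

/-- The van Hove Hamiltonian with coupling function `f`. -/
def vanHove (f : Lp ℂ 2 (volume : Measure (Space d))) : Fock d →ₗ.[ℂ] Fock d :=
  dGamma (fun k => ‖k‖) + -segalPhi f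

theorem mem_vanHove {f : Lp ℂ 2 (volume : Measure (Space d))} {Ψ Η : Fock d} :
    (Ψ, Η) ∈ (vanHove f).graph ↔ ∃ Θ a b, (Ψ, Θ) ∈ freeGraph d ∧ (Ψ, a) ∈ annihilationGraph f ∧
      (Ψ, b) ∈ creationGraph f ∧ Η = Θ - ((1 / Real.sqrt 2 : ℝ) : ℂ) • (a + b) := by
  rw [vanHove, mem_graph_add, dGamma, mult_graph]
  constructor
  · rintro ⟨Θ, c, h1, h2, rfl⟩
    rw [mem_graph_neg, segalPhi, mem_graph_smul] at h2
    obtain ⟨_, h3, h4⟩ := h2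
    obtain ⟨a, b, ha, hb, rfl⟩ := mem_graph_add.1 h3
    rw [annihilation_graph] at ha
    rw [creation_graph] at hb
    exact ⟨Θ, a, b, h1, ha, hb, by rw [← h4]; abel⟩
  · rintro ⟨Θ, a, b, h1, ha, hb, rfl⟩
    refine ⟨Θ, -(((1 / Real.sqrt 2 : ℝ) : ℂ) • (a + b)), h1, ?_, sub_eq_add_neg _ _⟩
    rw [mem_graph_neg, segalPhi, mem_graph_smul, neg_neg]
    refine ⟨_, mem_graph_add.2 ⟨a, b, ?_, ?_, rfl⟩, rfl⟩
    · rw [annihilation_graph]; exact ha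
    · rw [creation_graph]; exact hb

/-- `H₀` is symmetric, and `a(f)`, `a†(f)` change places under the inner product while the coupling
constant is real. -/
theorem vanHove_symmetric {f : Lp ℂ 2 (volume : Measure (Space d))} {ψ η φ ξ : Fock d}
    (h : (ψ, η) ∈ (vanHove f).graph) (h' : (φ, ξ) ∈ (vanHove f).graph) : ⟪η, φ⟫_ℂ = ⟪ψ, ξ⟫_ℂ := by
  obtain ⟨Θ, a, b, h1, ha, hb, rfl⟩ := mem_vanHove.1 h
  obtain ⟨Θ', a', b', h1', ha', hb', rfl⟩ := mem_vanHove.1 h'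
  rw [inner_sub_left, inner_sub_right, inner_smul_left, inner_smul_right, inner_add_left,
    inner_add_right, freeGraph_symmetric h1 h1', inner_creation_left hb ha',
    inner_annihilation_left ha hb', Complex.conj_ofReal]
  ring

/-- The domain of the van Hove Hamiltonian contains the domain of the free one. -/
theorem exists_vanHove (hd : 0 < d) {f : Lp ℂ 2 (volume : Measure (Space d))}
    (hf : ∫⁻ q, ‖f q‖ₑ ^ 2 / ENNReal.ofReal ‖q‖ ≠ ⊤) {Ψ Θ : Fock d} (h : (Ψ, Θ) ∈ freeGraph d) :
    ∃ Η, (Ψ, Η) ∈ (vanHove f).graph := by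
  obtain ⟨a, ha, -⟩ := exists_annihilation hd hf
    (ne_top_of_le_ne_top ENNReal.ofReal_ne_top (energyForm_le h one_pos))
  obtain ⟨b, hb, -⟩ := exists_creation f ha
  exact ⟨_, mem_vanHove.2 ⟨Θ, a, b, h, ha, hb, rfl⟩⟩

theorem graph_unique {F : Type*} [NormedAddCommGroup F] [InnerProductSpace ℂ F] {A : F →ₗ.[ℂ] F}
    {ψ η η' : F} (h : (ψ, η) ∈ A.graph) (h' : (ψ, η') ∈ A.graph) : η = η' :=
  A.mem_graph_snd_inj' h h' rfl

theorem freeGraph_unique {ψ η η' : Fock d} (h : (ψ, η) ∈ freeGraph d)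
    (h' : (ψ, η') ∈ freeGraph d) : η = η' := by
  rw [freeGraph, ← mult_graph] at h h'
  exact graph_unique h h'

/-- The interaction is infinitesimally bounded relative to the free Hamiltonian. -/
theorem exists_relative_bound (hd : 0 < d) {f : Lp ℂ 2 (volume : Measure (Space d))}
    (hf : ∫⁻ q, ‖f q‖ₑ ^ 2 / ENNReal.ofReal ‖q‖ ≠ ⊤) : ∃ C : ℝ, 0 ≤ C ∧ ∀ Ψ Θ Η,
      (Ψ, Θ) ∈ freeGraph d → (Ψ, Η) ∈ (vanHove f).graph →
        ‖Η - Θ‖ ≤ 1 / 2 * ‖Θ‖ + C * ‖Ψ‖ := by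
  set K : ℝ := (∫⁻ q, ‖f q‖ₑ ^ 2 / ENNReal.ofReal ‖q‖).toReal with hK
  have hK0 : 0 ≤ K := ENNReal.toReal_nonneg
  -- This gives `Kε ≤ 1/8`. As `‖(a + a†)Ψ/√2‖² ≤ 2‖aΨ‖² + ‖f‖²‖Ψ‖²`, the coefficient of `‖H₀Ψ‖²` is
  -- then at most `1/4`, the square of the relative bound `1/2`.
  set ε : ℝ := 1 / (8 * (K + 1)) with hε
  have hε0 : 0 < ε := by positivity
  refine ⟨Real.sqrt (2 * K * (4 * ε)⁻¹ + ‖f‖ ^ 2), Real.sqrt_nonneg _, fun Ψ Θ Η hΘ hΗ => ?_⟩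
  obtain ⟨Θ', a, b, h1, ha, hb, rfl⟩ := mem_vanHove.1 hΗ
  obtain rfl := freeGraph_unique h1 hΘ
  obtain ⟨a', ha', hle⟩ := exists_annihilation hd hf
    (ne_top_of_le_ne_top ENNReal.ofReal_ne_top (energyForm_le hΘ one_pos))
  rw [← annihilation_graph] at ha ha'
  obtain rfl := graph_unique ha ha'
  rw [annihilation_graph] at ha
  obtain ⟨b', hb', hbn⟩ := exists_creation f ha
  rw [← creation_graph] at hb hb'
  obtain rfl := graph_unique hb hb'
  have h2 : ‖a‖ ^ 2 ≤ K * (ε * ‖Θ'‖ ^ 2 + (4 * ε)⁻¹ * ‖Ψ‖ ^ 2) := by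
    have h3 := hle.trans (mul_le_mul_right (energyForm_le hΘ hε0) _)
    have h4 := ENNReal.toReal_mono (ENNReal.mul_ne_top hf ENNReal.ofReal_ne_top) h3
    rw [ENNReal.toReal_mul, ENNReal.toReal_ofReal (by positivity), ENNReal.toReal_pow,
      toReal_enorm] at h4
    exact h4
  have h5 : ‖Θ' - ((1 / Real.sqrt 2 : ℝ) : ℂ) • (a + b) - Θ'‖ ^ 2 ≤ 2 * ‖a‖ ^ 2 + ‖f‖ ^ 2 * ‖Ψ‖ ^ 2 := by
    rw [sub_sub_cancel_left, norm_neg, norm_smul, Complex.norm_real, mul_pow, Real.norm_eq_abs,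
      sq_abs, div_pow, Real.sq_sqrt (by norm_num)]
    have h6 : ‖a + b‖ ^ 2 ≤ 2 * (‖a‖ ^ 2 + ‖b‖ ^ 2) := by
      have := norm_add_le a b
      nlinarith [sq_nonneg (‖a‖ - ‖b‖), norm_nonneg (a + b), norm_nonneg a, norm_nonneg b]
    rw [hbn] at h6
    linarith
  have h7 : K * ε ≤ 1 / 8 := by
    rw [hε, mul_one_div, div_le_div_iff₀ (by positivity) (by norm_num)]
    linarith
  refine le_of_sq_le_sq ?_ (by positivity)
  refine h5.trans ?_
  have h8 : Real.sqrt (2 * K * (4 * ε)⁻¹ + ‖f‖ ^ 2) ^ 2 = 2 * K * (4 * ε)⁻¹ + ‖f‖ ^ 2 :=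
    Real.sq_sqrt (by positivity)
  have h9 : 0 ≤ ‖Θ'‖ * (Real.sqrt (2 * K * (4 * ε)⁻¹ + ‖f‖ ^ 2) * ‖Ψ‖) := by positivity
  rw [add_sq, mul_pow (Real.sqrt _), h8]
  have h10 : K * ε * ‖Θ'‖ ^ 2 ≤ 1 / 8 * ‖Θ'‖ ^ 2 := by gcongr
  nlinarith

theorem pair_sub_mem {F : Type*} [AddCommGroup F] [Module ℂ F] {S : Submodule ℂ (F × F)}
    {a b a' b' : F} (h : (a, b) ∈ S) (h' : (a', b') ∈ S) : (a - a', b - b') ∈ S :=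
  S.sub_mem h h'

/-- Since the relative bound is less than one, convergence of `Ψₘ` and `HΨₘ` forces `H₀Ψₘ` to be
Cauchy. Closedness of `H₀` puts the limit in its domain, and the bound again identifies the limit of
`HΨₘ`. -/
theorem isClosed_vanHove (hd : 0 < d) {f : Lp ℂ 2 (volume : Measure (Space d))}
    (hf : ∫⁻ q, ‖f q‖ₑ ^ 2 / ENNReal.ofReal ‖q‖ ≠ ⊤) :
    IsClosed ((vanHove f).graph : Set (Fock d × Fock d)) := by
  obtain ⟨C, hC, hbound⟩ := exists_relative_bound hd hf
  refine IsSeqClosed.isClosed fun x p hx hp => ?_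
  have hxm : ∀ m, ((x m).1, (x m).2) ∈ (vanHove f).graph := hx
  have hx' : ∀ m, ∃ Θ, ((x m).1, Θ) ∈ freeGraph d := fun m => by
    obtain ⟨Θ, a, b, h1, -⟩ := mem_vanHove.1 (hxm m)
    exact ⟨Θ, h1⟩
  choose Θ hΘ using hx'
  have hxd : ∀ m l, ‖Θ m - Θ l‖ ≤ 2 * ‖(x m).2 - (x l).2‖ + 2 * C * ‖(x m).1 - (x l).1‖ := by
    intro m l
    have h1 := hbound _ _ _ (pair_sub_mem (hΘ m) (hΘ l)) (pair_sub_mem (hxm m) (hxm l))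
    have h2 := norm_sub_norm_le (Θ m - Θ l) ((x m).2 - (x l).2)
    rw [norm_sub_rev (Θ m - Θ l)] at h2
    linarith
  have h1 : Tendsto (fun m => (x m).1) atTop (𝓝 p.1) := (continuous_fst.tendsto p).comp hp
  have h2 : Tendsto (fun m => (x m).2) atTop (𝓝 p.2) := (continuous_snd.tendsto p).comp hp
  have hcauchy : CauchySeq Θ := by
    have hb1 := (cauchySeq_iff_tendsto_dist_atTop_0.1 h1.cauchySeq)
    have hb2 := (cauchySeq_iff_tendsto_dist_atTop_0.1 h2.cauchySeq)
    refine cauchySeq_iff_tendsto_dist_atTop_0.2 ?_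
    have hb3 := (hb2.const_mul 2).add (hb1.const_mul (2 * C))
    rw [mul_zero, mul_zero, add_zero] at hb3
    refine squeeze_zero (fun _ => dist_nonneg) (fun n => ?_) hb3
    rw [dist_eq_norm, dist_eq_norm, dist_eq_norm]
    exact hxd n.1 n.2
  obtain ⟨Θ₀, hΘ₀⟩ := cauchySeq_tendsto_of_complete hcauchy
  have hmem : (p.1, Θ₀) ∈ freeGraph d :=
    (isClosed_freeGraph d).mem_of_tendsto (h1.prodMk_nhds hΘ₀) (Eventually.of_forall hΘ)
  obtain ⟨Η, hΗ⟩ := exists_vanHove hd hf hmem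
  have h3 : Tendsto (fun m => (x m).2) atTop (𝓝 Η) := by
    rw [tendsto_iff_norm_sub_tendsto_zero]
    have hb : Tendsto (fun m => 3 / 2 * ‖Θ m - Θ₀‖ + C * ‖(x m).1 - p.1‖) atTop (𝓝 0) := by
      have := ((tendsto_iff_norm_sub_tendsto_zero.1 hΘ₀).const_mul (3 / 2)).add
        ((tendsto_iff_norm_sub_tendsto_zero.1 h1).const_mul C)
      simpa using this
    refine squeeze_zero (fun _ => norm_nonneg _) (fun m => ?_) hb
    have h4 := hbound _ _ _ (pair_sub_mem (hΘ m) hmem) (pair_sub_mem (hxm m) hΗ)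
    have h5 := norm_sub_norm_le ((x m).2 - Η) (Θ m - Θ₀)
    linarith
  have h4 : p = (p.1, Η) := Prod.ext rfl (tendsto_nhds_unique h2 h3)
  rw [h4]
  exact hΗ

/-- The functions `g` with `|k| g ∈ L²`. -/
def energyDomain (d : ℕ) : Set (Lp ℂ 2 (volume : Measure (Space d))) :=
  {g | MemLp (fun q => (‖q‖ : ℂ) * g q) 2}

/-- Multiplication of `g` by `|k|`. -/
def energyMul (g : energyDomain d) : Lp ℂ 2 (volume : Measure (Space d)) := g.2.toLp _

theorem coe_energyMul (g : energyDomain d) :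
    energyMul g =ᵐ[volume] fun q => (‖q‖ : ℂ) * (g : Lp ℂ 2 (volume : Measure (Space d))) q :=
  g.2.coeFn_toLp

/-- If `f` is orthogonal to the domain, test it against `(1 + |q|)⁻¹ f`, which belongs to the
domain: the integral of `(1 + |q|)⁻¹ |f|²` vanishes. -/
theorem dense_energyDomain (d : ℕ) : Dense (energyDomain d) := by
  let S : Submodule ℂ (Lp ℂ 2 (volume : Measure (Space d))) :=
    { carrier := energyDomain d
      zero_mem' := by
        have : MemLp (fun _ : Space d => (0 : ℂ)) 2 := MemLp.zero
        refine this.ae_eq ?_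
        filter_upwards [Lp.coeFn_zero ℂ 2 (volume : Measure (Space d))] with q hq
        rw [hq]; simp
      add_mem' := fun {f g} hf hg => by
        refine (MemLp.add hf hg).ae_eq ?_
        filter_upwards [Lp.coeFn_add f g] with q hq
        rw [hq, Pi.add_apply, Pi.add_apply, mul_add]
      smul_mem' := fun c f hf => by
        refine (MemLp.const_mul hf c).ae_eq ?_
        filter_upwards [Lp.coeFn_smul c f] with q hq
        rw [hq, Pi.smul_apply, smul_eq_mul]; ring }
  change Dense (S : Set (Lp ℂ 2 (volume : Measure (Space d))))
  rw [Submodule.dense_iff_topologicalClosure_eq_top, Submodule.topologicalClosure_eq_top_iff,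
    Submodule.eq_bot_iff]
  intro f hf
  have hden : Measurable fun q : Space d => (((1 + ‖q‖ : ℝ) : ℂ))⁻¹ := by fun_prop
  have hle : ∀ q : Space d, ‖(((1 + ‖q‖ : ℝ) : ℂ))⁻¹‖ ≤ 1 ∧
      ‖(‖q‖ : ℂ) * (((1 + ‖q‖ : ℝ) : ℂ))⁻¹‖ ≤ 1 := by
    intro q
    have h0 := norm_nonneg q
    rw [norm_mul, norm_inv, Complex.norm_real, Complex.norm_real, Real.norm_of_nonneg (by positivity),
      norm_norm]
    exact ⟨inv_le_one_of_one_le₀ (by linarith), by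
      rw [← div_eq_mul_inv]; exact div_le_one_of_le₀ (by linarith) (by positivity)⟩
  have hg : MemLp (fun q => (((1 + ‖q‖ : ℝ) : ℂ))⁻¹ * f q) 2 := by
    refine (Lp.memLp f).of_le (hden.aestronglyMeasurable.mul (Lp.aestronglyMeasurable f))
      (Eventually.of_forall fun q => ?_)
    rw [norm_mul]
    exact mul_le_of_le_one_left (norm_nonneg _) (hle q).1
  have hgm : hg.toLp _ ∈ S := by
    have : MemLp (fun q => (‖q‖ : ℂ) * ((((1 + ‖q‖ : ℝ) : ℂ))⁻¹ * f q)) 2 := by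
      refine (Lp.memLp f).of_le ((by fun_prop : Measurable fun q : Space d =>
        (‖q‖ : ℂ)).aestronglyMeasurable.mul hg.1) (Eventually.of_forall fun q => ?_)
      rw [← mul_assoc, norm_mul]
      exact mul_le_of_le_one_left (norm_nonneg _) (hle q).2
    refine this.ae_eq ?_
    filter_upwards [hg.coeFn_toLp] with q hq
    rw [hq]
  have h1 := (Submodule.mem_orthogonal _ _).1 hf _ hgm
  rw [inner_L2_eq] at h1
  have h2 : ∫ q : Space d, (1 + ‖q‖)⁻¹ * ‖f q‖ ^ 2 = 0 := by
    have h3 : ((∫ q : Space d, (1 + ‖q‖)⁻¹ * ‖f q‖ ^ 2 : ℝ) : ℂ) = 0 := by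
      rw [← h1]
      refine (integral_complex_ofReal (f := fun q : Space d => (1 + ‖q‖)⁻¹ * ‖f q‖ ^ 2)).symm.trans ?_
      refine integral_congr_ae ?_
      filter_upwards [hg.coeFn_toLp] with q hq
      rw [hq, map_mul, map_inv₀, Complex.conj_ofReal, mul_assoc, ← Complex.normSq_eq_conj_mul_self,
        Complex.normSq_eq_norm_sq]
      push_cast; rfl
    exact_mod_cast h3
  have hint : Integrable fun q : Space d => (1 + ‖q‖)⁻¹ * ‖f q‖ ^ 2 := by
    have hf2 := (memLp_two_iff_integrable_sq_norm (Lp.aestronglyMeasurable f)).1 (Lp.memLp f)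
    refine hf2.mono ((by fun_prop : Measurable fun q : Space d =>
      (1 + ‖q‖)⁻¹).aestronglyMeasurable.mul hf2.1) (Eventually.of_forall fun q => ?_)
    have h0 := norm_nonneg q
    rw [norm_mul]
    refine mul_le_of_le_one_left (norm_nonneg _) ?_
    rw [Real.norm_of_nonneg (by positivity)]
    exact inv_le_one_of_one_le₀ (by linarith)
  have h4 := (integral_eq_zero_iff_of_nonneg (fun q => by positivity) hint).1 h2
  refine Lp.ext ?_
  filter_upwards [h4, Lp.coeFn_zero ℂ 2 (volume : Measure (Space d))] with q hq h0
  rw [h0]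
  have h5 : (1 + ‖q‖)⁻¹ ≠ 0 := by positivity
  simpa [h5] using hq

theorem total_energyDomain (d : ℕ) :
    Total fun g : energyDomain d => expVec (g : Lp ℂ 2 (volume : Measure (Space d))) :=
  total_expVec_of_dense (dense_energyDomain d)

theorem phaseMul_mem (t : ℝ) (g : energyDomain d) :
    phaseMul t (g : Lp ℂ 2 (volume : Measure (Space d))) ∈ energyDomain d := by
  have h : MemLp (fun q => (‖q‖ : ℂ) * (g : Lp ℂ 2 (volume : Measure (Space d))) q) 2 := g.2
  refine h.of_le ((by fun_prop : Measurable fun q : Space d => (‖q‖ : ℂ)).aestronglyMeasurable.mul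
    (Lp.aestronglyMeasurable _)) ?_
  filter_upwards [coe_phaseMul t (g : Lp ℂ 2 (volume : Measure (Space d)))] with q hq
  rw [hq, norm_mul, norm_mul, norm_mul, mul_comm Complex.I, Complex.norm_exp_ofReal_mul_I, one_mul]

theorem expVec_mem_freeGraph (g : energyDomain d) :
    (expVec (g : Lp ℂ 2 (volume : Measure (Space d))), creatExp (energyMul g) g) ∈ freeGraph d :=
  expVec_mem_energy (coe_energyMul g)

/-- The span of the exponential vectors is a core of the free Hamiltonian. -/
theorem freeGraph_le_closure {Ψ Θ : Fock d} (h : (Ψ, Θ) ∈ freeGraph d) :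
    (Ψ, Θ) ∈ (Submodule.span ℂ (Set.range fun g : energyDomain d =>
      (expVec (g : Lp ℂ 2 (volume : Measure (Space d))),
        creatExp (energyMul g) g))).topologicalClosure := by
  refine generator_mem_closure free_add (total_energyDomain d) (fun g => ?_) (fun g t => ?_)
    (V := free) ?_
  · have := expVec_mem_freeGraph g
    rw [freeGraph_eq_genGraph] at this
    exact this
  · exact ⟨⟨_, phaseMul_mem t g⟩, 1, by rw [free_expVec, one_smul]⟩
  · rw [freeGraph_eq_genGraph] at h
    exact h

theorem creatExp_add (η ζ g : Lp ℂ 2 (volume : Measure (Space d))) :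
    creatExp (η + ζ) g = creatExp η g + creatExp ζ g := by
  refine (total_expVec d).ext fun h => ?_
  rw [inner_add_right, inner_creatExp_right, inner_creatExp_right, inner_creatExp_right,
    inner_add_right]
  ring

theorem weyl_neg_one_expVec (v g : Lp ℂ 2 (volume : Measure (Space d))) :
    weyl v (-1) (expVec g) = weylFactor v g • expVec (g + v) := by
  rw [weyl_expVec, weylFactor]
  congr 2
  · push_cast; ring
  · simp

/-- The conjugated creation operator is `a†(η) - ⟪v, η⟫`. Moving the Weyl operator onto an
exponential test vector reduces this to explicit exponentials. -/
theorem weyl_neg_one_creatExp (v η g : Lp ℂ 2 (volume : Measure (Space d))) :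
    weyl v (-1) (creatExp η g) =
      weylFactor v g • (creatExp η (g + v) - ⟪v, η⟫_ℂ • expVec (g + v)) := by
  refine (total_expVec d).ext fun h => ?_
  have h1 : ⟪expVec h, weyl v (-1) (creatExp η g)⟫_ℂ = ⟪weyl v 1 (expVec h), creatExp η g⟫_ℂ := by
    rw [group_inner_left (weyl_add v)]
  rw [h1, weyl_expVec, inner_smul_left, inner_smul_right, inner_sub_right, inner_smul_right,
    inner_creatExp_right, inner_creatExp_right, inner_expVec, ← Complex.exp_conj, weylFactor,
    ← sub_mul, mul_left_comm, mul_left_comm (Complex.exp _), ← Complex.exp_add, ← Complex.exp_add]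
  simp only [inner_add_left, inner_add_right, inner_smul_left, map_add, map_mul, map_neg, map_div₀,
    map_one, map_ofNat, map_pow, Complex.conj_ofReal, inner_conj_symm]
  push_cast
  ring_nf

/-- Multiplication by a complex number of modulus one. -/
def phaseIso (θ : ℝ) : Fock d ≃ₗᵢ[ℂ] Fock d where
  toFun ψ := Complex.exp (θ * Complex.I) • ψ
  invFun ψ := Complex.exp (-(θ * Complex.I)) • ψ
  left_inv ψ := by
    change Complex.exp (-(θ * Complex.I)) • (Complex.exp (θ * Complex.I) • ψ) = ψ
    rw [smul_smul, ← Complex.exp_add, neg_add_cancel, Complex.exp_zero, one_smul]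
  right_inv ψ := by
    change Complex.exp (θ * Complex.I) • (Complex.exp (-(θ * Complex.I)) • ψ) = ψ
    rw [smul_smul, ← Complex.exp_add, add_neg_cancel, Complex.exp_zero, one_smul]
  map_add' := smul_add _
  map_smul' c ψ := smul_comm _ _ _
  norm_map' ψ := by
    change ‖Complex.exp (θ * Complex.I) • ψ‖ = ‖ψ‖
    rw [norm_smul, Complex.norm_exp_ofReal_mul_I, one_mul]

/-- The unitary group of the van Hove Hamiltonian: the dressed free evolution, up to a phase. -/
def dressedGroup (v : Lp ℂ 2 (volume : Measure (Space d))) (κ t : ℝ) : Fock d ≃ₗᵢ[ℂ] Fock d :=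
  (((weyl v 1).trans (free t)).trans (weyl v (-1))).trans (phaseIso (-(t * κ)))

theorem dressedGroup_apply (v : Lp ℂ 2 (volume : Measure (Space d))) (κ t : ℝ) (ψ : Fock d) :
    dressedGroup v κ t ψ =
      Complex.exp ((-(t * κ) : ℝ) * Complex.I) • weyl v (-1) (free t (weyl v 1 ψ)) := rfl

theorem weyl_one_neg_one (v : Lp ℂ 2 (volume : Measure (Space d))) (ψ : Fock d) :
    weyl v 1 (weyl v (-1) ψ) = ψ := group_neg (weyl_add v) 1 ψ

theorem dressedGroup_weyl (v : Lp ℂ 2 (volume : Measure (Space d))) (κ t : ℝ) (ψ : Fock d) :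
    dressedGroup v κ t (weyl v (-1) ψ) =
      Complex.exp ((-(t * κ) : ℝ) * Complex.I) • weyl v (-1) (free t ψ) := by
  rw [dressedGroup_apply, weyl_one_neg_one]

theorem dressedGroup_add (v : Lp ℂ 2 (volume : Measure (Space d))) (κ s t : ℝ) (ψ : Fock d) :
    dressedGroup v κ (s + t) ψ = dressedGroup v κ s (dressedGroup v κ t ψ) := by
  rw [dressedGroup_apply v κ t, map_smul, dressedGroup_weyl, dressedGroup_apply, smul_smul,
    ← Complex.exp_add, free_add]
  congr 2
  push_cast; ring

theorem continuous_dressedGroup (v : Lp ℂ 2 (volume : Measure (Space d))) (κ : ℝ) (ψ : Fock d) :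
    Continuous fun t => dressedGroup v κ t ψ := by
  simp only [dressedGroup_apply]
  exact (by fun_prop : Continuous fun t : ℝ => Complex.exp ((-(t * κ) : ℝ) * Complex.I)).smul
    ((weyl v (-1)).continuous.comp (continuous_free _))

theorem mem_genGraph_dressedGroup (v : Lp ℂ 2 (volume : Measure (Space d))) (κ : ℝ) {ψ η : Fock d}
    (h : (ψ, η) ∈ freeGraph d) :
    (weyl v (-1) ψ, weyl v (-1) η - (κ : ℂ) • weyl v (-1) ψ) ∈ genGraph (dressedGroup v κ) := by
  rw [freeGraph_eq_genGraph] at h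
  rw [mem_genGraph]
  simp only [dressedGroup_weyl]
  have h1 : HasDerivAt (fun t : ℝ => Complex.exp ((-(t * κ) : ℝ) * Complex.I))
      (-(κ * Complex.I)) 0 := by
    have h2 : HasDerivAt (fun t : ℝ => ((-(t * κ) : ℝ) : ℂ) * Complex.I) (-(κ * Complex.I)) 0 := by
      have h3 : HasDerivAt (fun s : ℝ => (s : ℂ)) 1 0 := (hasDerivAt_id ((0 : ℝ) : ℂ)).comp_ofReal
      have h4 := ((h3.mul_const (κ : ℂ)).neg).mul_const Complex.I
      rw [one_mul, neg_mul] at h4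
      refine h4.congr_of_eventuallyEq (Eventually.of_forall fun t => ?_)
      simp
    simpa using h2.cexp
  have h5 := (weyl v (-1)).toContinuousLinearEquiv.toContinuousLinearMap.restrictScalars ℝ
    |>.hasFDerivAt.comp_hasDerivAt (0 : ℝ) h
  have h6 := h1.smul h5
  refine h6.congr_deriv ?_
  change Complex.exp ((-((0 : ℝ) * κ) : ℝ) * Complex.I) • weyl v (-1) (Complex.I • η) +
    (-(κ * Complex.I)) • weyl v (-1) (free 0 ψ) = _
  rw [group_zero free_add, zero_mul, neg_zero, Complex.ofReal_zero, zero_mul, Complex.exp_zero,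
    one_smul, map_smul, smul_sub, smul_smul, neg_smul, mul_comm Complex.I, ← sub_eq_add_neg]

/-- The dressed free evolution is the unitary group of the van Hove Hamiltonian. -/
theorem vanHove_graph (hd : 0 < d) {f v w : Lp ℂ 2 (volume : Measure (Space d))} {κ : ℝ}
    (hf : ∫⁻ q, ‖f q‖ₑ ^ 2 / ENNReal.ofReal ‖q‖ ≠ ⊤) (hw : w = ((1 / Real.sqrt 2 : ℝ) : ℂ) • f)
    (hv : w =ᵐ[volume] fun q => (‖q‖ : ℂ) * v q) (hκ : ⟪w, v⟫_ℂ = κ) :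
    (vanHove f).graph = genGraph (dressedGroup v κ) := by
  let e : energyDomain d → Fock d := fun g => weyl v (-1) (expVec g)
  let G : energyDomain d → Fock d := fun g =>
    weyl v (-1) (creatExp (energyMul g) g) - (κ : ℂ) • weyl v (-1) (expVec g)
  have he : Total e := (total_energyDomain d).map _
  have hgen : ∀ g, (e g, G g) ∈ genGraph (dressedGroup v κ) := fun g =>
    mem_genGraph_dressedGroup v κ (expVec_mem_freeGraph g)
  have hinv : ∀ g t, ∃ (y : energyDomain d) (c : ℂ), dressedGroup v κ t (e g) = c • e y :=
    fun g t => ⟨⟨_, phaseMul_mem t g⟩, _, by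
      simp only [e]
      rw [dressedGroup_weyl, free_expVec]⟩
  -- Up to a factor `U e(g) = e(g + v)`, which has finite energy norm because `ωv = w` is in `L²`.
  -- In `H e(g + v)` the term `a†(w)` from the energy cancels against the interaction, and the
  -- scalars `⟪w, g⟫ + κ` remain.
  have hham : ∀ g, (e g, G g) ∈ (vanHove f).graph := by
    intro g
    have h1 : ⟪v, energyMul g⟫_ℂ = ⟪w, g⟫_ℂ := by
      rw [inner_L2_eq, inner_L2_eq]
      refine integral_congr_ae ?_
      filter_upwards [hv, coe_energyMul g] with q h1 h2
      rw [h1, h2, map_mul, Complex.conj_ofReal]; ring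
    have h2 : (expVec ((g : Lp ℂ 2 (volume : Measure (Space d))) + v),
        creatExp (energyMul g + w) (g + v)) ∈ freeGraph d := by
      refine expVec_mem_energy ?_
      filter_upwards [hv, coe_energyMul g, Lp.coeFn_add (energyMul g) w,
        Lp.coeFn_add (g : Lp ℂ 2 (volume : Measure (Space d))) v] with q h3 h4 h5 h6
      rw [h5, h6, Pi.add_apply, Pi.add_apply, h3, h4, mul_add]
    have h3 := mem_vanHove.2 ⟨_, _, _, h2, expVec_mem_annihilation f (g + v),
      creatExp_mem f (g + v), rfl⟩
    have h4 := (vanHove f).graph.smul_mem (weylFactor v g) h3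
    have h5 : (weylFactor v g • expVec ((g : Lp ℂ 2 (volume : Measure (Space d))) + v),
        weylFactor v g • (creatExp (energyMul g + w) (g + v) - ((1 / Real.sqrt 2 : ℝ) : ℂ) •
          (⟪f, g + v⟫_ℂ • expVec ((g : Lp ℂ 2 (volume : Measure (Space d))) + v) +
            creatExp f (g + v)))) = (e g, G g) := by
      refine Prod.ext (weyl_neg_one_expVec v g).symm ?_
      simp only [G]
      rw [weyl_neg_one_creatExp, weyl_neg_one_expVec, creatExp_add, h1, hw, creatExp_smul,
        smul_comm (κ : ℂ), ← smul_sub]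
      congr 1
      have h6 : ⟪((1 / Real.sqrt 2 : ℝ) : ℂ) • f, (g : Lp ℂ 2 (volume : Measure (Space d)))⟫_ℂ + κ =
          ((1 / Real.sqrt 2 : ℝ) : ℂ) * ⟪f, g + v⟫_ℂ := by
        rw [← hκ, hw, ← inner_add_right, inner_smul_left, Complex.conj_ofReal]
      rw [smul_add, smul_smul, ← h6, add_smul]
      abel
    rw [← h5]
    exact h4
  -- Symmetry of `H` makes its graph weakly, hence truly, contained in the generator. The reverse
  -- inclusion holds since the dressed exponential vectors are a core and `H` is closed.
  refine le_antisymm ?_ ?_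
  · rintro ⟨χ, θ⟩ h
    exact mem_genGraph_of_weak (dressedGroup_add v κ) (continuous_dressedGroup v κ) he hgen hinv
      fun g => vanHove_symmetric (hham g) h
  · rintro ⟨ψ, η⟩ h
    have h1 := generator_mem_closure (dressedGroup_add v κ) he hgen hinv h
    refine (isClosed_vanHove hd hf).closure_subset_iff.2 ?_ h1
    exact Submodule.span_le.2 (by rintro _ ⟨g, rfl⟩; exact hham g)

end Hamiltonian

/-! ### The dressing operator and the Hamiltonian of the source `ρ` -/

section Dressing

open scoped ENNReal

variable {d : ℕ}

theorem isUnitaryGroupOf_vanHove (hd : 0 < d) {f v w : Lp ℂ 2 (volume : Measure (Space d))} {κ : ℝ}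
    (hf : ∫⁻ q, ‖f q‖ₑ ^ 2 / ENNReal.ofReal ‖q‖ ≠ ⊤) (hw : w = ((1 / Real.sqrt 2 : ℝ) : ℂ) • f)
    (hv : w =ᵐ[volume] fun q => (‖q‖ : ℂ) * v q) (hκ : ⟪w, v⟫_ℂ = κ) :
    IsUnitaryGroupOf (vanHove f) (dressedGroup v κ) :=
  ⟨dressedGroup_add v κ, continuous_dressedGroup v κ, fun ψ η => by
    rw [vanHove_graph hd hf hw hv hκ, mem_genGraph]⟩

theorem expI_vanHove (hd : 0 < d) {f v w : Lp ℂ 2 (volume : Measure (Space d))} {κ : ℝ}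
    (hf : ∫⁻ q, ‖f q‖ₑ ^ 2 / ENNReal.ofReal ‖q‖ ≠ ⊤) (hw : w = ((1 / Real.sqrt 2 : ℝ) : ℂ) • f)
    (hv : w =ᵐ[volume] fun q => (‖q‖ : ℂ) * v q) (hκ : ⟪w, v⟫_ℂ = κ) (t : ℝ) :
    expI (vanHove f) t = dressedGroup v κ t := by
  refine (isUnitaryGroupOf_vanHove hd hf hw hv hκ).expI_eq
    ((total_energyDomain d).map (weyl v (-1))) (fun g => ?_) t
  refine LinearPMap.mem_domain_iff.2
    ⟨weyl v (-1) (creatExp (energyMul g) g) - (κ : ℂ) • weyl v (-1) (expVec g), ?_⟩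
  rw [vanHove_graph hd hf hw hv hκ]
  exact mem_genGraph_dressedGroup v κ (expVec_mem_freeGraph g)

/-- The displacement `ρ̂ / √(2 ω³)` of the annihilation operators by the dressing operator. -/
def displacement {ρ : Space d → ℝ} (h2 : CondA2 ρ) : Lp ℂ 2 (volume : Measure (Space d)) :=
  ((1 / Real.sqrt 2 : ℝ) : ℂ) • h2.memLp_three.toLp (weighted ρ 3)

theorem coe_displacement {ρ : Space d → ℝ} (h2 : CondA2 ρ) :
    displacement h2 =ᵐ[volume] fun k => ((1 / Real.sqrt 2 : ℝ) : ℂ) * weighted ρ 3 k := by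
  filter_upwards [Lp.coeFn_smul ((1 / Real.sqrt 2 : ℝ) : ℂ) (h2.memLp_three.toLp (weighted ρ 3)),
    h2.memLp_three.coeFn_toLp] with k h3 h4
  rw [displacement, h3, Pi.smul_apply, h4, smul_eq_mul]

theorem dressing_eq {ρ : Space d → ℝ} (h2 : CondA2 ρ) :
    dressing ρ h2 = weyl (displacement h2) (-1) := expI_segalPi rfl (-1)

theorem hasUnitaryGroup_dressingGenerator {ρ : Space d → ℝ} (h2 : CondA2 ρ) :
    HasUnitaryGroup (dressingGenerator ρ h2) := ⟨_, isUnitaryGroupOf_weyl rfl⟩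

theorem weighted_one_eq (ρ : Space d → ℝ) {k : Space d} (hk : k ≠ 0) :
    weighted ρ 1 k = (‖k‖ : ℂ) * weighted ρ 3 k := by
  have h0 : ((Real.sqrt ‖k‖ : ℝ) : ℂ) ≠ 0 := by
    exact_mod_cast (Real.sqrt_pos.2 (norm_pos_iff.2 hk)).ne'
  have h1 : ((‖k‖ : ℝ) : ℂ) = ((Real.sqrt ‖k‖ : ℝ) : ℂ) ^ 2 := by
    rw [← Complex.ofReal_pow, Real.sq_sqrt (norm_nonneg k)]
  rw [weighted, weighted, h1]
  push_cast
  field_simp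

theorem exists_hamiltonian_group (hd : 0 < d) {ρ : Space d → ℝ} (h1 : CondA1 ρ) (h2 : CondA2 ρ) :
    HasUnitaryGroup (hamiltonian ρ h1) ∧
      ∃ κ : ℝ, ∀ t, expI (hamiltonian ρ h1) t = dressedGroup (displacement h2) κ t := by
  set f := h1.memLp_one.toLp (weighted ρ 1) with hfdef
  have hham : hamiltonian ρ h1 = vanHove f := rfl
  have hf : ∫⁻ q, ‖f q‖ₑ ^ 2 / ENNReal.ofReal ‖q‖ ≠ ⊤ := by
    -- For the coupling `ρ̂/√ω` the infrared condition of the relative bound is exactly `ρ̂/ω ∈ L²`.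
    have h3 : ∫⁻ q, ‖f q‖ₑ ^ 2 / ENNReal.ofReal ‖q‖ = ∫⁻ q, ‖weighted ρ 2 q‖ₑ ^ 2 := by
      refine lintegral_congr_ae ?_
      filter_upwards [h1.memLp_one.coeFn_toLp, ae_ne_zero hd] with q hq hq0
      have h0 : 0 < ‖q‖ := norm_pos_iff.2 hq0
      rw [hfdef, hq, ← ofReal_norm, ← ofReal_norm, ← ENNReal.ofReal_pow (norm_nonneg _),
        ← ENNReal.ofReal_pow (norm_nonneg _), ← ENNReal.ofReal_div_of_pos h0, weighted, weighted,
        norm_div, norm_div, Complex.norm_real, Complex.norm_real, norm_pow, norm_pow,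
        Real.norm_of_nonneg (Real.sqrt_nonneg _), Real.sq_sqrt h0.le, pow_one, div_pow, div_pow,
        Real.sq_sqrt h0.le]
      congr 1
      field_simp
    rw [h3]
    exact lintegral_sq_of_memLp h1.memLp_two
  set w : Lp ℂ 2 (volume : Measure (Space d)) := ((1 / Real.sqrt 2 : ℝ) : ℂ) • f with hw
  have hv : w =ᵐ[volume] fun q => (‖q‖ : ℂ) * displacement h2 q := by
    filter_upwards [Lp.coeFn_smul ((1 / Real.sqrt 2 : ℝ) : ℂ) f, h1.memLp_one.coeFn_toLp,
      coe_displacement h2, ae_ne_zero hd] with q h3 h4 h5 h6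
    rw [hw, h3, Pi.smul_apply, hfdef, h4, h5, weighted_one_eq ρ h6, smul_eq_mul]
    ring
  have hκ : ⟪w, displacement h2⟫_ℂ = ((∫ q, ‖q‖ * ‖displacement h2 q‖ ^ 2 : ℝ) : ℂ) := by
    rw [inner_L2_eq]
    refine Eq.trans ?_
      (integral_complex_ofReal (f := fun q : Space d => ‖q‖ * ‖displacement h2 q‖ ^ 2))
    refine integral_congr_ae ?_
    filter_upwards [hv] with q hq
    rw [hq, map_mul, Complex.conj_ofReal, mul_assoc, ← Complex.normSq_eq_conj_mul_self,
      Complex.normSq_eq_norm_sq]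
    push_cast; rfl
  rw [hham]
  exact ⟨⟨_, isUnitaryGroupOf_vanHove hd hf hw hv hκ⟩, _, expI_vanHove hd hf hw hv hκ⟩

end Dressing

/-! ### The annihilation kernel `a(k)` for almost every `k` -/

section Kernel

open scoped ENNReal

variable {d : ℕ}

/-- The square of the norm of `a(k) Ψ`, possibly infinite. -/
def kernelSq (Ψ : Fock d) (k : Space d) : ℝ≥0∞ :=
  ∑' n : ℕ, ((n : ℝ≥0∞) + 1) * ∫⁻ ks : Fin n → Space d, ‖comp Ψ (n + 1) (Fin.cons k ks)‖ₑ ^ 2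

theorem measurable_comp (Ψ : Fock d) (n : ℕ) : Measurable (comp Ψ n) :=
  (Lp.stronglyMeasurable ((Ψ n : SymL2 d n) : L2n d n)).measurable

theorem measurable_cons (n : ℕ) : Measurable fun p : Space d × (Fin n → Space d) =>
    (Fin.cons p.1 p.2 : Fin (n + 1) → Space d) := by
  refine measurable_pi_lambda _ fun i => ?_
  refine Fin.cases ?_ (fun j => ?_) i
  · simpa using measurable_fst
  · simp only [Fin.cons_succ]
    exact (measurable_pi_apply j).comp measurable_snd

theorem measurable_comp_cons (Ψ : Fock d) (n : ℕ) (k : Space d) :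
    Measurable fun ks : Fin n → Space d => comp Ψ (n + 1) (Fin.cons k ks) :=
  (measurable_comp Ψ (n + 1)).comp ((measurable_cons n).comp measurable_prodMk_left)

theorem measurable_sliceSq (Ψ : Fock d) (n : ℕ) : Measurable fun k : Space d =>
    ∫⁻ ks : Fin n → Space d, ‖comp Ψ (n + 1) (Fin.cons k ks)‖ₑ ^ 2 :=
  Measurable.lintegral_prod_right'
    (f := fun p : Space d × (Fin n → Space d) => ‖comp Ψ (n + 1) (Fin.cons p.1 p.2)‖ₑ ^ 2)
    (((measurable_comp Ψ (n + 1)).comp (measurable_cons n)).enorm.pow_const 2)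

theorem measurable_kernelSq (Ψ : Fock d) : Measurable (kernelSq Ψ) := by
  exact Measurable.tsum fun n => (measurable_sliceSq Ψ n).const_mul _

theorem IsKernelValue.enorm_sq {k : Space d} {Ψ Θ : Fock d} (h : IsKernelValue k Ψ Θ) :
    ‖Θ‖ₑ ^ 2 = kernelSq Ψ k := by
  rw [fock_norm_sq', kernelSq]
  refine tsum_congr fun n => ?_
  rw [← lintegral_const_mul _ ((measurable_comp_cons Ψ n k).enorm.pow_const 2)]
  refine lintegral_congr_ae ?_
  filter_upwards [h n] with ks hks
  rw [hks, enorm_mul, mul_pow, enorm_sqrt_sq]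

theorem IsKernelValue.unique {k : Space d} {Ψ Θ Θ' : Fock d} (h : IsKernelValue k Ψ Θ)
    (h' : IsKernelValue k Ψ Θ') : Θ = Θ' :=
  fock_ext fun n => (h n).trans (h' n).symm

/-- Components are symmetric only almost everywhere, so the slices at a fixed `k` are symmetric for
almost every `k`. Countably many sectors and permutations leave one null set; after that only
finiteness of the norm is needed. -/
theorem ae_exists_isKernelValue (Ψ : Fock d) :
    ∀ᵐ k : Space d, kernelSq Ψ k ≠ ⊤ → ∃ Θ, IsKernelValue k Ψ Θ := by
  have hsymm : ∀ᵐ k : Space d, ∀ (n : ℕ) (τ : Equiv.Perm (Fin (n + 1))),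
      ∀ᵐ ks : Fin n → Space d, comp Ψ (n + 1) (fun i => (Fin.cons k ks : Fin (n + 1) → Space d) (τ i))
        = comp Ψ (n + 1) (Fin.cons k ks) :=
    ae_all_iff.2 fun n => ae_all_iff.2 fun τ => ae_cons' (comp_symm Ψ (n + 1) τ)
  filter_upwards [hsymm] with k hk hfin
  have hm : ∀ n, Measurable fun ks : Fin n → Space d =>
      (Real.sqrt (n + 1) : ℂ) * comp Ψ (n + 1) (Fin.cons k ks) := fun n =>
    (measurable_comp_cons Ψ n k).const_mul _
  refine exists_fock_of_comp _ (fun n => (hm n).aestronglyMeasurable) (fun n σ => ?_) ?_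
  · obtain ⟨τ, hτ⟩ := exists_perm_succ (d := d) σ
    filter_upwards [hk n τ] with ks hks
    rw [← hks, hτ k ks]
  · refine ne_of_eq_of_ne (tsum_congr fun n => ?_) hfin
    rw [← lintegral_const_mul _ ((measurable_comp_cons Ψ n k).enorm.pow_const 2)]
    refine lintegral_congr fun ks => ?_
    rw [enorm_mul, mul_pow, enorm_sqrt_sq]

/-- The identity `∫ w(k) ‖a(k)Ψ‖² dk = (Ψ, dΓ(w)Ψ)`, with infinite values allowed. It converts
energy bounds on `Ψ` into integrability in `k`. -/
theorem lintegral_weight_kernelSq (Ψ : Fock d) {w : Space d → ℝ≥0∞} (hw : Measurable w) :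
    ∫⁻ k, w k * kernelSq Ψ k = ∑' n, ∫⁻ k, (∑ j, w (k j)) * ‖comp Ψ n k‖ₑ ^ 2 := by
  simp only [kernelSq, ← ENNReal.tsum_mul_left]
  have hm : ∀ n : ℕ, Measurable fun k : Space d => w k * (((n : ℝ≥0∞) + 1) *
      ∫⁻ ks : Fin n → Space d, ‖comp Ψ (n + 1) (Fin.cons k ks)‖ₑ ^ 2) := fun n =>
    hw.mul ((measurable_sliceSq Ψ n).const_mul _)
  rw [lintegral_tsum fun n => (hm n).aemeasurable,
    tsum_eq_zero_add' (f := fun n => ∫⁻ k : Fin n → Space d, (∑ j, w (k j)) * ‖comp Ψ n k‖ₑ ^ 2)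
      ENNReal.summable]
  simp only [Finset.univ_eq_empty, Finset.sum_empty, zero_mul, lintegral_zero, zero_add]
  refine tsum_congr fun n => ?_
  have h1 := lintegral_weight_sum (Ψ (n + 1)) hw
  refine Eq.trans ?_ h1.symm
  have hF : Measurable fun k : Fin (n + 1) → Space d => w (k 0) * ‖comp Ψ (n + 1) k‖ₑ ^ 2 :=
    (hw.comp (measurable_pi_apply 0)).mul ((measurable_comp Ψ (n + 1)).enorm.pow_const 2)
  have h2 := lintegral_cons' _ hF.aemeasurable
  refine Eq.trans ?_ (congrArg _ h2.symm)
  rw [← lintegral_const_mul]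
  · refine lintegral_congr fun k => ?_
    rw [← mul_assoc, mul_comm (w k), mul_assoc]
    congr 1
    rw [← lintegral_const_mul _ ((measurable_comp_cons Ψ n k).enorm.pow_const 2)]
    rfl
  · exact Measurable.lintegral_prod_right'
      (f := fun p : Space d × (Fin n → Space d) => w ((Fin.cons p.1 p.2 : Fin (n + 1) → Space d) 0) *
        ‖comp Ψ (n + 1) (Fin.cons p.1 p.2)‖ₑ ^ 2) (hF.comp (measurable_cons n))

theorem lintegral_norm_kernelSq (Ψ : Fock d) :
    ∫⁻ k, ENNReal.ofReal ‖k‖ * kernelSq Ψ k = energyForm Ψ := by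
  rw [lintegral_weight_kernelSq Ψ (by fun_prop), energyForm]
  refine tsum_congr fun n => lintegral_congr fun k => ?_
  rw [energy, ENNReal.ofReal_sum_of_nonneg fun _ _ => norm_nonneg _]

theorem kernelSq_ae_ne_top (hd : 0 < d) {Ψ : Fock d} (h : energyForm Ψ ≠ ⊤) :
    ∀ᵐ k, kernelSq Ψ k ≠ ⊤ := by
  rw [← lintegral_norm_kernelSq] at h
  have hm : Measurable fun k : Space d => ENNReal.ofReal ‖k‖ * kernelSq Ψ k :=
    (by fun_prop : Measurable fun k : Space d => ENNReal.ofReal ‖k‖).mul (measurable_kernelSq Ψ)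
  have h1 := ae_lt_top hm h
  filter_upwards [h1, ae_ne_zero hd] with k hk hk0 h2
  rw [h2, ENNReal.mul_top (by simpa using hk0)] at hk
  exact lt_irrefl _ hk

/-- `θ k = a(k) Ψ` for almost every `k`. -/
def IsKernel (Ψ : Fock d) (θ : Space d → Fock d) : Prop := ∀ᵐ k, IsKernelValue k Ψ (θ k)

theorem IsKernel.annihilationKernel_eq {Ψ : Fock d} {θ : Space d → Fock d} (h : IsKernel Ψ θ) :
    ∀ᵐ k, annihilationKernel k Ψ = θ k := by
  filter_upwards [h] with k hk
  have h1 : ∃ Θ, IsKernelValue k Ψ Θ := ⟨_, hk⟩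
  rw [annihilationKernel, dif_pos h1]
  exact h1.choose_spec.unique hk

theorem isKernel_annihilationKernel (hd : 0 < d) {Ψ : Fock d} (h : energyForm Ψ ≠ ⊤) :
    IsKernel Ψ fun k => annihilationKernel k Ψ := by
  filter_upwards [kernelSq_ae_ne_top hd h, ae_exists_isKernelValue Ψ] with k h1 h2
  rw [annihilationKernel, dif_pos (h2 h1)]
  exact (h2 h1).choose_spec

theorem IsKernel.add {Ψ Ψ' : Fock d} {θ θ' : Space d → Fock d} (h : IsKernel Ψ θ)
    (h' : IsKernel Ψ' θ') : IsKernel (Ψ + Ψ') fun k => θ k + θ' k := by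
  have h1 : ∀ᵐ k : Space d, ∀ n : ℕ, ∀ᵐ ks : Fin n → Space d,
      comp (Ψ + Ψ') (n + 1) (Fin.cons k ks) =
        comp Ψ (n + 1) (Fin.cons k ks) + comp Ψ' (n + 1) (Fin.cons k ks) :=
    ae_all_iff.2 fun n => ae_cons' (comp_add Ψ Ψ' (n + 1))
  filter_upwards [h, h', h1] with k h2 h3 h4 n
  filter_upwards [h2 n, h3 n, h4 n, comp_add (θ k) (θ' k) n] with ks h5 h6 h7 h8
  rw [h8, h7, h5, h6, mul_add]

theorem IsKernel.smul {Ψ : Fock d} {θ : Space d → Fock d} (c : ℂ) (h : IsKernel Ψ θ) :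
    IsKernel (c • Ψ) fun k => c • θ k := by
  have h1 : ∀ᵐ k : Space d, ∀ n : ℕ, ∀ᵐ ks : Fin n → Space d,
      comp (c • Ψ) (n + 1) (Fin.cons k ks) = c * comp Ψ (n + 1) (Fin.cons k ks) :=
    ae_all_iff.2 fun n => ae_cons' (comp_smul c Ψ (n + 1))
  filter_upwards [h, h1] with k h2 h4 n
  filter_upwards [h2 n, h4 n, comp_smul c (θ k) n] with ks h5 h7 h8
  rw [h8, h7, h5]; ring

theorem IsKernel.sub {Ψ Ψ' : Fock d} {θ θ' : Space d → Fock d} (h : IsKernel Ψ θ)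
    (h' : IsKernel Ψ' θ') : IsKernel (Ψ - Ψ') fun k => θ k - θ' k := by
  have h1 := h.add (h'.smul (-1))
  simp only [neg_smul, one_smul, ← sub_eq_add_neg] at h1
  exact h1

theorem IsKernel.congr {Ψ : Fock d} {θ θ' : Space d → Fock d} (h : IsKernel Ψ θ)
    (h' : ∀ᵐ k, θ k = θ' k) : IsKernel Ψ θ' := by
  filter_upwards [h, h'] with k h1 h2
  rwa [← h2]

theorem isKernel_zero : IsKernel (0 : Fock d) fun _ => 0 := by
  have h1 : ∀ᵐ k : Space d, ∀ n : ℕ, ∀ᵐ ks : Fin n → Space d,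
      comp (0 : Fock d) (n + 1) (Fin.cons k ks) = 0 :=
    ae_all_iff.2 fun n => ae_cons' (comp_zero (n + 1))
  filter_upwards [h1] with k h2 n
  filter_upwards [h2 n, comp_zero (d := d) n] with ks h3 h4
  rw [h3, h4, mul_zero]

theorem isKernel_expVec (g : Lp ℂ 2 (volume : Measure (Space d))) :
    IsKernel (expVec g) fun k => g k • expVec g := by
  have h1 : ∀ᵐ k : Space d, ∀ n : ℕ, ∀ᵐ ks : Fin n → Space d,
      comp (expVec g) (n + 1) (Fin.cons k ks) = ((Real.sqrt (n + 1).factorial : ℂ))⁻¹ *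
        ∏ j, g ((Fin.cons k ks : Fin (n + 1) → Space d) j) :=
    ae_all_iff.2 fun n => ae_cons' (comp_expVec g (n + 1))
  filter_upwards [h1] with k h2 n
  filter_upwards [h2 n, comp_smul (g k) (expVec g) n, comp_expVec g n] with ks h3 h4 h5
  rw [h4, h5, h3, Fin.prod_univ_succ]
  simp only [Fin.cons_zero, Fin.cons_succ]
  have h6 : (Real.sqrt (n + 1).factorial : ℂ) =
      (Real.sqrt (n + 1) : ℂ) * (Real.sqrt n.factorial : ℂ) := by
    rw [Nat.factorial_succ, ← Complex.ofReal_mul, ← Real.sqrt_mul (by positivity)]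
    push_cast; rfl
  have h7 := sqrt_succ_ne_zero n
  rw [h6, mul_inv]
  field_simp

/-- Removing a particle of momentum `k` lowers the energy by `|k|`, so `a(k)` passes through the
free evolution at the cost of one phase. -/
theorem IsKernel.free {Ψ : Fock d} {θ : Space d → Fock d} (h : IsKernel Ψ θ) (t : ℝ) :
    IsKernel (free t Ψ) fun k => Complex.exp (Complex.I * (t * ‖k‖ : ℝ)) • VanHove.free t (θ k) := by
  have h1 : ∀ᵐ k : Space d, ∀ n : ℕ, ∀ᵐ ks : Fin n → Space d,
      comp (VanHove.free t Ψ) (n + 1) (Fin.cons k ks) =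
        phase t (n + 1) (Fin.cons k ks : Fin (n + 1) → Space d) * comp Ψ (n + 1) (Fin.cons k ks) :=
    ae_all_iff.2 fun n => ae_cons' (comp_free t Ψ (n + 1))
  filter_upwards [h, h1] with k h2 h3 n
  filter_upwards [h2 n, h3 n, comp_free t (θ k) n, comp_smul
    (Complex.exp (Complex.I * (t * ‖k‖ : ℝ))) (VanHove.free t (θ k)) n] with ks h4 h5 h6 h7
  rw [h7, h6, h5, h4]
  have h8 : phase t (n + 1) (Fin.cons k ks : Fin (n + 1) → Space d) =
      Complex.exp (Complex.I * (t * ‖k‖ : ℝ)) * phase t n ks := by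
    rw [phase, phase, ← Complex.exp_add, energy, energy, Fin.sum_univ_succ]
    simp only [Fin.cons_zero, Fin.cons_succ]
    congr 1
    push_cast; ring
  rw [h8]; ring

end Kernel

/-! ### The dressing shifts the annihilation kernel -/

section DressedKernel

open scoped ENNReal

variable {d : ℕ}

theorem tendsto_of_tsum_enorm_sq {E : Type*} [SeminormedAddCommGroup E] {a : ℕ → E} {b : E}
    (h : ∑' m, ‖a m - b‖ₑ ^ 2 ≠ ⊤) : Tendsto a atTop (𝓝 b) := by
  have h1 := (ENNReal.tendsto_toReal ENNReal.zero_ne_top).comp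
    (ENNReal.tendsto_atTop_zero_of_tsum_ne_top h)
  have h2 := h1.sqrt
  rw [tendsto_iff_norm_sub_tendsto_zero]
  simpa [Function.comp_def] using h2

/-- Summable energies make `∑ ‖a(k)(χₘ - Ψ)‖²` integrable against `|k|`, hence finite for almost
every `k`; the whole sequence converges, with no subsequence depending on `k`. -/
theorem IsKernel.tendsto (hd : 0 < d) {Ψ : Fock d} {θ : Space d → Fock d} {χ : ℕ → Fock d}
    {η : ℕ → Space d → Fock d} (h : IsKernel Ψ θ) (hχ : ∀ m, IsKernel (χ m) (η m))
    (hs : ∑' m, energyForm (χ m - Ψ) ≠ ⊤) : ∀ᵐ k, Tendsto (fun m => η m k) atTop (𝓝 (θ k)) := by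
  have hm : ∀ m, Measurable fun k : Space d => ENNReal.ofReal ‖k‖ * kernelSq (χ m - Ψ) k := fun m =>
    (by fun_prop : Measurable fun k : Space d => ENNReal.ofReal ‖k‖).mul (measurable_kernelSq _)
  simp only [← lintegral_norm_kernelSq] at hs
  rw [← lintegral_tsum fun m => (hm m).aemeasurable] at hs
  have h1 := ae_lt_top (Measurable.tsum hm) hs
  have h2 : ∀ᵐ k, ∀ m, IsKernelValue k (χ m - Ψ) (η m k - θ k) := ae_all_iff.2 fun m => (hχ m).sub h
  filter_upwards [h1, h2, ae_ne_zero hd] with k h3 h4 h5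
  rw [ENNReal.tsum_mul_left] at h3
  refine tendsto_of_tsum_enorm_sq fun h6 => h3.ne ?_
  simp only [(h4 _).enorm_sq] at h6
  rw [h6, ENNReal.mul_top (by simpa using h5)]

theorem enorm_comp_le (Ψ : Fock d) (n : ℕ) : ∫⁻ k, ‖comp Ψ n k‖ₑ ^ 2 ≤ ‖Ψ‖ₑ ^ 2 := by
  rw [fock_norm_sq']
  exact ENNReal.le_tsum n

theorem ae_tendsto_comp {Ψ : Fock d} {χ : ℕ → Fock d} (hs : ∑' m, ‖χ m - Ψ‖ₑ ^ 2 ≠ ⊤) (n : ℕ) :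
    ∀ᵐ k, Tendsto (fun m => comp (χ m) n k) atTop (𝓝 (comp Ψ n k)) := by
  have hm : ∀ m, Measurable fun k : Fin n → Space d => ‖comp (χ m - Ψ) n k‖ₑ ^ 2 := fun m =>
    (measurable_comp _ n).enorm.pow_const 2
  have h1 : ∫⁻ k, ∑' m, ‖comp (χ m - Ψ) n k‖ₑ ^ 2 ≠ ⊤ := by
    rw [lintegral_tsum fun m => (hm m).aemeasurable]
    exact ne_top_of_le_ne_top hs (ENNReal.tsum_le_tsum fun m => enorm_comp_le _ n)
  have h2 := ae_lt_top (Measurable.tsum hm) h1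
  have h3 : ∀ᵐ k, ∀ m, comp (χ m - Ψ) n k = comp (χ m) n k - comp Ψ n k :=
    ae_all_iff.2 fun m => comp_sub _ _ n
  filter_upwards [h2, h3] with k h4 h5
  refine tendsto_of_tsum_enorm_sq ?_
  simp only [← h5]
  exact h4.ne

/-- The relation between a vector and its kernel is closed under such limits. Summability makes the
components of `χₘ` converge almost everywhere; those of `ηₘ(k)` do so along a subsequence, and the
two limits must agree. No energy bound on `Ψ` is involved, so this applies to dressed vectors. -/
theorem IsKernel.of_tendsto {Ψ : Fock d} {θ : Space d → Fock d} {χ : ℕ → Fock d}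
    {η : ℕ → Space d → Fock d} (hχ : ∀ m, IsKernel (χ m) (η m)) (hs : ∑' m, ‖χ m - Ψ‖ₑ ^ 2 ≠ ⊤)
    (ht : ∀ᵐ k, Tendsto (fun m => η m k) atTop (𝓝 (θ k))) : IsKernel Ψ θ := by
  have h1 : ∀ᵐ k : Space d, ∀ n : ℕ, ∀ᵐ ks : Fin n → Space d,
      Tendsto (fun m => comp (χ m) (n + 1) (Fin.cons k ks)) atTop
        (𝓝 (comp Ψ (n + 1) (Fin.cons k ks))) :=
    ae_all_iff.2 fun n => ae_cons' (ae_tendsto_comp hs (n + 1))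
  have h2 : ∀ᵐ k, ∀ m, IsKernelValue k (χ m) (η m k) := ae_all_iff.2 hχ
  filter_upwards [h1, h2, ht] with k h3 h4 h5 n
  have h6 : Tendsto (fun m => ((η m k n : SymL2 d n) : L2n d n)) atTop
      (𝓝 ((θ k n : SymL2 d n) : L2n d n)) := by
    rw [tendsto_iff_norm_sub_tendsto_zero] at h5 ⊢
    refine squeeze_zero (fun _ => norm_nonneg _) (fun m => ?_) h5
    exact lp.norm_apply_le_norm (by norm_num) (η m k - θ k) n
  obtain ⟨ns, hns, h7⟩ := (tendstoInMeasure_of_tendsto_Lp h6).exists_seq_tendsto_ae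
  have h8 : ∀ᵐ ks : Fin n → Space d, ∀ m, comp (η m k) n ks =
      (Real.sqrt (n + 1) : ℂ) * comp (χ m) (n + 1) (Fin.cons k ks) := ae_all_iff.2 fun m => h4 m n
  filter_upwards [h3 n, h7, h8] with ks h9 h10 h11
  refine tendsto_nhds_unique h10 ?_
  refine ((h9.comp hns.tendsto_atTop).const_mul _).congr fun m => ?_
  exact (h11 (ns m)).symm

/-- A sequence in the core of the free Hamiltonian that converges fast in the graph norm. -/
theorem exists_fast_sequence {S : Submodule ℂ (Fock d × Fock d)} {p : Fock d × Fock d}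
    (h : p ∈ S.topologicalClosure) (hS : S ≤ freeGraph d) (hp : p ∈ freeGraph d) :
    ∃ χ : ℕ → Fock d × Fock d, (∀ m, χ m ∈ S) ∧ ∑' m, ‖(χ m).1 - p.1‖ₑ ^ 2 ≠ ⊤ ∧
      ∑' m, energyForm ((χ m).1 - p.1) ≠ ⊤ := by
  have h1 : ∀ m : ℕ, ∃ q ∈ S, dist p q < (1 / 2) ^ m := fun m =>
    Metric.mem_closure_iff.1 h _ (by positivity)
  choose χ hχ hdist using h1
  have hsum : Summable fun m : ℕ => ((1 / 2 : ℝ) ^ m) ^ 2 := by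
    simp only [← pow_mul, mul_comm _ 2]
    simp only [pow_mul]
    exact summable_geometric_of_lt_one (by positivity) (by norm_num)
  have hb : ∀ m, ‖(χ m).1 - p.1‖ ≤ (1 / 2) ^ m ∧ ‖(χ m).2 - p.2‖ ≤ (1 / 2) ^ m := by
    intro m
    have h2 := (hdist m).le
    rw [dist_comm, dist_eq_norm] at h2
    exact ⟨(norm_fst_le _).trans h2, (norm_snd_le _).trans h2⟩
  refine ⟨χ, hχ, ne_top_of_le_ne_top hsum.tsum_ofReal_ne_top (ENNReal.tsum_le_tsum fun m => ?_),
    ne_top_of_le_ne_top (hsum.mul_left 2).tsum_ofReal_ne_top (ENNReal.tsum_le_tsum fun m => ?_)⟩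
  · rw [← ofReal_norm, ← ENNReal.ofReal_pow (norm_nonneg _)]
    exact ENNReal.ofReal_le_ofReal (pow_le_pow_left₀ (norm_nonneg _) (hb m).1 2)
  · have h3 : ((χ m).1 - p.1, (χ m).2 - p.2) ∈ freeGraph d := pair_sub_mem (hS (hχ m)) hp
    refine (energyForm_le h3 one_pos).trans (ENNReal.ofReal_le_ofReal ?_)
    have h4 := pow_le_pow_left₀ (norm_nonneg _) (hb m).1 2
    have h5 := pow_le_pow_left₀ (norm_nonneg _) (hb m).2 2
    have h6 := sq_nonneg ‖(χ m).1 - p.1‖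
    linarith

theorem energyForm_ne_top {Ψ Θ : Fock d} (h : (Ψ, Θ) ∈ freeGraph d) : energyForm Ψ ≠ ⊤ :=
  ne_top_of_le_ne_top ENNReal.ofReal_ne_top (energyForm_le h one_pos)

/-- On an exponential vector both sides multiply by `g(k) + v(k)`, and the span follows by
linearity. The family `θ` is existential because kernels are additive only up to null sets of `k`.
Weak measurability is included since it survives the limit. -/
theorem dressed_kernel_core (v : Lp ℂ 2 (volume : Measure (Space d))) {p : Fock d × Fock d}
    (h : p ∈ Submodule.span ℂ (Set.range fun g : energyDomain d =>
      (expVec (g : Lp ℂ 2 (volume : Measure (Space d))), creatExp (energyMul g) g))) :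
    ∃ θ : Space d → Fock d, IsKernel p.1 θ ∧
      IsKernel (weyl v (-1) p.1) (fun k => weyl v (-1) (θ k + v k • p.1)) ∧
      ∀ Φ, AEStronglyMeasurable (fun k => ⟪Φ, θ k⟫_ℂ) volume := by
  induction h using Submodule.span_induction with
  | mem x hx =>
    obtain ⟨g, rfl⟩ := hx
    set g' : Lp ℂ 2 (volume : Measure (Space d)) := g.1
    refine ⟨fun k => g' k • expVec g', isKernel_expVec g', ?_, fun Φ => ?_⟩
    · simp only
      rw [weyl_neg_one_expVec]
      refine ((isKernel_expVec (g' + v)).smul (weylFactor v g')).congr ?_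
      filter_upwards [Lp.coeFn_add g' v] with k hk
      rw [← add_smul, map_smul, weyl_neg_one_expVec, hk, Pi.add_apply, smul_comm]
    · simp only [inner_smul_right]
      exact (Lp.aestronglyMeasurable g').mul aestronglyMeasurable_const
  | zero =>
    refine ⟨fun _ => 0, isKernel_zero, ?_, fun Φ => ?_⟩
    · simp only [Prod.fst_zero, map_zero, smul_zero, add_zero]
      exact isKernel_zero
    · simp only [inner_zero_right]
      exact aestronglyMeasurable_const
  | add x y _ _ hx hy =>
    obtain ⟨θ, h1, h2, h3⟩ := hx
    obtain ⟨θ', h1', h2', h3'⟩ := hy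
    refine ⟨fun k => θ k + θ' k, h1.add h1', ?_, fun Φ => ?_⟩
    · rw [Prod.fst_add, map_add]
      refine (h2.add h2').congr (Eventually.of_forall fun k => ?_)
      rw [← map_add, smul_add, add_add_add_comm]
    · simp only [inner_add_right]
      exact (h3 Φ).add (h3' Φ)
  | smul c x _ hx =>
    obtain ⟨θ, h1, h2, h3⟩ := hx
    refine ⟨fun k => c • θ k, h1.smul c, ?_, fun Φ => ?_⟩
    · rw [Prod.smul_fst, map_smul]
      refine (h2.smul c).congr (Eventually.of_forall fun k => ?_)
      rw [← map_smul, smul_add, smul_comm c (v k)]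
    · simp only [inner_smul_right]
      exact aestronglyMeasurable_const.mul (h3 Φ)

/-- The dressing operator shifts the annihilation operators by its displacement. -/
theorem dressed_kernel (hd : 0 < d) (v : Lp ℂ 2 (volume : Measure (Space d))) {Ψ Θ : Fock d}
    (h : (Ψ, Θ) ∈ freeGraph d) :
    IsKernel (weyl v (-1) Ψ) (fun k => weyl v (-1) (annihilationKernel k Ψ + v k • Ψ)) ∧
      ∀ Φ, AEStronglyMeasurable (fun k => ⟪Φ, annihilationKernel k Ψ⟫_ℂ) volume := by
  -- The approximants lie in the span of exponential vectors. Convergence is fast in norm, so their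
  -- dressed images qualify for `IsKernel.of_tendsto`, and fast in energy, so that their kernels
  -- converge for almost every `k`.
  obtain ⟨χ, hχ, hs, hs'⟩ := exists_fast_sequence (freeGraph_le_closure h)
    (Submodule.span_le.2 (by rintro _ ⟨g, rfl⟩; exact expVec_mem_freeGraph g)) h
  choose θ h1 h2 h3 using fun m => dressed_kernel_core v (hχ m)
  have h4 := (isKernel_annihilationKernel hd (energyForm_ne_top h)).tendsto hd h1 hs'
  have h5 : Tendsto (fun m => (χ m).1) atTop (𝓝 Ψ) := tendsto_of_tsum_enorm_sq hs
  refine ⟨IsKernel.of_tendsto h2 ?_ ?_, fun Φ => ?_⟩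
  · refine ne_of_eq_of_ne (tsum_congr fun m => ?_) hs
    rw [← map_sub, LinearIsometryEquiv.enorm_map]
  · filter_upwards [h4] with k hk
    exact ((weyl v (-1)).continuous.tendsto _).comp (hk.add (h5.const_smul (v k)))
  · refine aestronglyMeasurable_of_tendsto_ae atTop (fun m => h3 m Φ) ?_
    filter_upwards [h4] with k hk
    exact tendsto_const_nhds.inner hk

theorem free_mem_freeGraph {Ψ Θ : Fock d} (h : (Ψ, Θ) ∈ freeGraph d) (t : ℝ) :
    (free t Ψ, free t Θ) ∈ freeGraph d := by
  intro n
  filter_upwards [comp_free t Ψ n, comp_free t Θ n, h n] with k h1 h2 h3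
  rw [h2, h3, h1]; ring

/-- The annihilation operators in the dressed states, in the Heisenberg picture. -/
theorem isKernel_dressedGroup (hd : 0 < d) (v : Lp ℂ 2 (volume : Measure (Space d))) (κ t : ℝ)
    {Ψ Θ : Fock d} (h : (Ψ, Θ) ∈ freeGraph d) :
    IsKernel (dressedGroup v κ (-t) (weyl v (-1) Ψ)) fun k => dressedGroup v κ (-t) (weyl v (-1)
      (Complex.exp (-(Complex.I * (t * ‖k‖ : ℝ))) • annihilationKernel k Ψ + v k • Ψ)) := by
  have h1 := free_mem_freeGraph h (-t)
  have h2 := (dressed_kernel hd v h1).1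
  have h3 := ((isKernel_annihilationKernel hd (energyForm_ne_top h)).free (-t)).annihilationKernel_eq
  rw [dressedGroup_weyl]
  -- Expressing the kernel of the evolved vector through that of `Ψ` lets the whole evolution be
  -- factored out on the left, leaving only the one-particle phase and the shift `v(k)`, which stays
  -- constant in time.
  refine (h2.smul _).congr ?_
  filter_upwards [h3] with k hk
  rw [dressedGroup_weyl, hk, map_add (free (-t)), map_smul (free (-t)), map_smul (free (-t))]
  congr 5
  push_cast; ring

/-- The evolution factored out of the kernel is undone by `exp(itH)`, and the dressing cancels
because it is unitary. The second term is the source of the static field. -/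
theorem heisenbergForm_dressing (hd : 0 < d) {ρ : Space d → ℝ} (h1 : CondA1 ρ) (h2 : CondA2 ρ)
    {Φ Ψ Θ : Fock d} (h : (Ψ, Θ) ∈ freeGraph d) (t : ℝ) :
    (∀ᵐ k, ∃ χ, IsKernelValue k (expI (hamiltonian ρ h1) (-t) (dressing ρ h2 Ψ)) χ) ∧
    ∀ᵐ k, heisenbergForm ρ h1 (dressing ρ h2 Φ) (dressing ρ h2 Ψ) t k =
      Complex.exp (-(Complex.I * (t * ‖k‖ : ℝ))) * ⟪Φ, annihilationKernel k Ψ⟫_ℂ +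
        ((1 / Real.sqrt 2 : ℝ) : ℂ) * weighted ρ 3 k * ⟪Φ, Ψ⟫_ℂ := by
  obtain ⟨-, κ, hκ⟩ := exists_hamiltonian_group hd h1 h2
  simp only [heisenbergForm, hκ, dressing_eq]
  have h3 := isKernel_dressedGroup hd (displacement h2) κ t h
  refine ⟨?_, ?_⟩
  · filter_upwards [h3] with k hk
    exact ⟨_, hk⟩
  · filter_upwards [h3.annihilationKernel_eq, coe_displacement h2] with k hk hk'
    rw [hk, group_neg (dressedGroup_add _ κ), LinearIsometryEquiv.inner_map_map, inner_add_right,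
      inner_smul_right, inner_smul_right, hk']

end DressedKernel

/-! ### Momentum integrability from the domain of `H₀^(d/2+2)` -/

section PowerDomain

open scoped ENNReal

variable {d : ℕ}

/-- The integral of `1 + E^{2s}` against `|Ψ|²` is `‖Ψ‖² + ‖E^s Ψ‖²`, so any weight of at most this
growth is integrable. -/
theorem tsum_lintegral_weight_ne_top {s : ℝ} {Ψ Ξ : Fock d}
    (h : (Ψ, Ξ) ∈ multGraph fun n (k : Fin n → Space d) => energy n k ^ s)
    {W : (n : ℕ) → (Fin n → Space d) → ℝ≥0∞} {C : ℝ}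
    (hW : ∀ n k, W n k ≤ ENNReal.ofReal (C * (1 + (energy n k ^ s) ^ 2))) :
    ∑' n, ∫⁻ k, W n k * ‖comp Ψ n k‖ₑ ^ 2 ≠ ⊤ := by
  have h1 : ∑' n, ENNReal.ofReal C *
      ((∫⁻ k, ‖comp Ψ n k‖ₑ ^ 2) + ∫⁻ k, ‖comp Ξ n k‖ₑ ^ 2) ≠ ⊤ := by
    rw [ENNReal.tsum_mul_left, ENNReal.tsum_add, ← fock_norm_sq', ← fock_norm_sq']
    exact ENNReal.mul_ne_top ENNReal.ofReal_ne_top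
      (ENNReal.add_ne_top.2 ⟨by simp, by simp⟩)
  refine ne_top_of_le_ne_top h1 (ENNReal.tsum_le_tsum fun n => ?_)
  rw [← lintegral_add_left ((measurable_comp Ψ n).enorm.pow_const 2),
    ← lintegral_const_mul' _ _ ENNReal.ofReal_ne_top]
  refine lintegral_mono_ae ?_
  filter_upwards [h n] with k hk
  have h2 : ‖comp Ξ n k‖ₑ ^ 2 = ENNReal.ofReal ((energy n k ^ s) ^ 2) * ‖comp Ψ n k‖ₑ ^ 2 := by
    rw [hk, enorm_mul, mul_pow]
    congr 1
    rw [← ofReal_norm, Complex.norm_real, ← ENNReal.ofReal_pow (norm_nonneg _), Real.norm_eq_abs,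
      sq_abs]
  rw [h2, ← one_add_mul, ← mul_assoc]
  gcongr
  refine (hW n k).trans ?_
  by_cases hC : 0 ≤ C
  · rw [ENNReal.ofReal_mul hC, ENNReal.ofReal_add (by positivity) (by positivity),
      ENNReal.ofReal_one]
  · rw [ENNReal.ofReal_of_nonpos]
    · exact zero_le
    · have : 0 ≤ 1 + (energy n k ^ s) ^ 2 := by positivity
      nlinarith

theorem le_one_add_pow {E : ℝ} (hE : 0 ≤ E) {m l : ℕ} (h : m ≤ l) : E ^ m ≤ 1 + E ^ l := by
  rcases le_total E 1 with h1 | h1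
  · have := pow_le_one₀ (n := m) hE h1
    have := pow_nonneg hE l
    linarith
  · have := pow_le_pow_right₀ h1 h
    linarith

theorem energy_rpow_sq (n : ℕ) (k : Fin n → Space d) :
    (energy n k ^ ((d : ℝ) / 2 + 2)) ^ 2 = energy n k ^ (d + 4) := by
  rw [← Real.rpow_natCast (energy n k ^ _), ← Real.rpow_mul (energy_nonneg k),
    ← Real.rpow_natCast (energy n k)]
  congr 1
  push_cast; ring

theorem exists_freeGraph {Ψ Ξ : Fock d}
    (h : (Ψ, Ξ) ∈ multGraph fun n (k : Fin n → Space d) => energy n k ^ ((d : ℝ) / 2 + 2)) :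
    ∃ Θ, (Ψ, Θ) ∈ freeGraph d := by
  refine exists_mul (fun n k => (energy n k : ℂ)) (fun n => ?_) (fun n σ k => ?_) Ψ ?_
  · exact (Complex.continuous_ofReal.comp (continuous_energy d n)).measurable
  · rw [energy_symm]
  · have h1 := tsum_lintegral_weight_ne_top h (C := 1)
      (W := fun n k => ENNReal.ofReal (energy n k ^ 2)) fun n k => by
        rw [one_mul, energy_rpow_sq]
        exact ENNReal.ofReal_le_ofReal (le_one_add_pow (energy_nonneg k) (by omega))
    refine ne_of_eq_of_ne (tsum_congr fun n => lintegral_congr fun k => ?_) h1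
    rw [enorm_mul, mul_pow]
    congr 1
    rw [← ofReal_norm, Complex.norm_real, ← ENNReal.ofReal_pow (norm_nonneg _), Real.norm_eq_abs,
      sq_abs]

/-- Here `d + 4` is twice `d/2 + 2`, and a sum of powers of the `|kⱼ|` is at most the power of the
sum. The linear term controls small momenta, the high power large ones. -/
theorem lintegral_kernelSq_ne_top {Ψ Ξ : Fock d}
    (h : (Ψ, Ξ) ∈ multGraph fun n (k : Fin n → Space d) => energy n k ^ ((d : ℝ) / 2 + 2)) :
    ∫⁻ k, ENNReal.ofReal (‖k‖ + ‖k‖ ^ (d + 4)) * kernelSq Ψ k ≠ ⊤ := by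
  rw [lintegral_weight_kernelSq Ψ (by fun_prop)]
  refine tsum_lintegral_weight_ne_top h (C := 2) fun n k => ?_
  rw [← ENNReal.ofReal_sum_of_nonneg fun _ _ => by positivity, energy_rpow_sq]
  refine ENNReal.ofReal_le_ofReal ?_
  have h1 : ∑ j, ‖k j‖ ^ (d + 4) ≤ energy n k ^ (d + 4) := by
    calc ∑ j, ‖k j‖ ^ (d + 4) = ∑ j, ‖k j‖ * ‖k j‖ ^ (d + 3) := by
          refine Finset.sum_congr rfl fun j _ => ?_
          ring
      _ ≤ ∑ j, ‖k j‖ * energy n k ^ (d + 3) := by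
          gcongr with j
          exact Finset.single_le_sum (f := fun j => ‖k j‖) (fun _ _ => norm_nonneg _)
            (Finset.mem_univ j)
      _ = energy n k ^ (d + 4) := by
          rw [← Finset.sum_mul, energy]; ring
  have h2 := le_one_add_pow (energy_nonneg k) (show 1 ≤ d + 4 by omega)
  have h3 := pow_nonneg (energy_nonneg k) (d + 4)
  rw [pow_one] at h2
  rw [Finset.sum_add_distrib]
  rw [show ∑ j, ‖k j‖ = energy n k from rfl]
  linarith

/-- In polar coordinates the density is `r^(d-3) (1 + r²)² / (1 + r^(d+3))`: bounded near `0`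
because `d ≥ 3`, and of order `r⁻²` at infinity. -/
theorem integrable_radial_weight (hd : 3 ≤ d) : Integrable fun k : Space d =>
    ‖k‖⁻¹ * (1 + ‖k‖ ^ 2) ^ 2 / (‖k‖ + ‖k‖ ^ (d + 4)) := by
  have : Nontrivial (Space d) := by
    have : Nonempty (Fin d) := ⟨⟨0, by omega⟩⟩
    infer_instance
  refine (integrable_fun_norm_addHaar (E := Space d) volume
    (f := fun r : ℝ => r⁻¹ * (1 + r ^ 2) ^ 2 / (r + r ^ (d + 4)))).2 ?_
  rw [finrank_euclideanSpace_fin]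
  -- The constant `8` is the sum of the coefficients `1, 3, 3, 1` of `(1 + r²)³`; each resulting
  -- power of `r` is at most `1 + r^(d+3)`.
  refine Integrable.mono' (g := fun r => 8 * (1 + r ^ 2)⁻¹)
    ((integrable_inv_one_add_sq.const_mul 8).integrableOn) (by fun_prop) ?_
  filter_upwards [ae_restrict_mem measurableSet_Ioi] with r hr
  have hr0 : 0 < r := hr
  obtain ⟨e, rfl⟩ : ∃ e, d = e + 3 := ⟨d - 3, by omega⟩
  have h1 : r ^ (e + 3 - 1) • (r⁻¹ * (1 + r ^ 2) ^ 2 / (r + r ^ (e + 3 + 4))) =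
      r ^ e * (1 + r ^ 2) ^ 2 / (1 + r ^ (e + 6)) := by
    rw [show e + 3 - 1 = e + 2 by omega, smul_eq_mul,
      show r + r ^ (e + 3 + 4) = r * (1 + r ^ (e + 6)) by ring, pow_add]
    field_simp
  rw [h1, Real.norm_of_nonneg (by positivity), ← div_eq_mul_inv, div_le_div_iff₀ (by positivity)
    (by positivity)]
  have h2 : r ^ e ≤ 1 + r ^ (e + 6) := le_one_add_pow hr0.le (by omega)
  have h3 : r ^ (e + 2) ≤ 1 + r ^ (e + 6) := le_one_add_pow hr0.le (by omega)
  have h4 : r ^ (e + 4) ≤ 1 + r ^ (e + 6) := le_one_add_pow hr0.le (by omega)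
  have h5 : r ^ e * (1 + r ^ 2) ^ 2 * (1 + r ^ 2) =
      r ^ e + 3 * r ^ (e + 2) + 3 * r ^ (e + 4) + r ^ (e + 6) := by ring
  rw [h5]
  linarith

/-- Integrability of the matrix elements of the annihilation operators, with the weight that two
derivatives of the field require. -/
theorem integrable_inner_annihilationKernel (hd : 3 ≤ d) {Ψ Ξ : Fock d}
    (h : (Ψ, Ξ) ∈ multGraph fun n (k : Fin n → Space d) => energy n k ^ ((d : ℝ) / 2 + 2))
    (Φ : Fock d) : Integrable fun k =>
      ((1 + ‖k‖ ^ 2 : ℝ) : ℂ) * (((1 / Real.sqrt (2 * ‖k‖) : ℝ) : ℂ) *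
        ⟪Φ, annihilationKernel k Ψ⟫_ℂ) := by
  have hd0 : 0 < d := by omega
  obtain ⟨Θ, hΘ⟩ := exists_freeGraph h
  -- The measurability statement does not involve the displacement, so it is taken to be zero.
  have hm := (dressed_kernel hd0 0 hΘ).2 Φ
  have hker := isKernel_annihilationKernel hd0 (energyForm_ne_top hΘ)
  have h1 : Integrable fun k : Space d =>
      (‖k‖ + ‖k‖ ^ (d + 4)) * ‖⟪Φ, annihilationKernel k Ψ⟫_ℂ‖ ^ 2 := by
    refine ⟨(by fun_prop : Measurable fun k : Space d =>
      ‖k‖ + ‖k‖ ^ (d + 4)).aestronglyMeasurable.mul (hm.norm.pow 2), ?_⟩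
    have h2 : ∫⁻ k, ‖Φ‖ₑ ^ 2 * (ENNReal.ofReal (‖k‖ + ‖k‖ ^ (d + 4)) * kernelSq Ψ k) < ⊤ := by
      rw [lintegral_const_mul' _ _ (by simp)]
      exact ENNReal.mul_lt_top (by simp) (lintegral_kernelSq_ne_top h).lt_top
    refine lt_of_le_of_lt (lintegral_mono_ae ?_) h2
    filter_upwards [hker] with k hk
    rw [← hk.enorm_sq, mul_left_comm, ← mul_pow, enorm_mul, enorm_pow, enorm_norm,
      Real.enorm_of_nonneg (by positivity)]
    gcongr
    rw [← ofReal_norm, ← ofReal_norm, ← ofReal_norm, ← ENNReal.ofReal_mul (norm_nonneg _)]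
    exact ENNReal.ofReal_le_ofReal (norm_inner_le_norm _ _)
  refine ((integrable_radial_weight hd).add h1).mono' ?_ ?_
  · refine Measurable.aestronglyMeasurable (by fun_prop) |>.mul (AEStronglyMeasurable.mul
      (Measurable.aestronglyMeasurable (by fun_prop)) hm)
  · filter_upwards [ae_ne_zero hd0] with k hk
    have hk0 : 0 < ‖k‖ := norm_pos_iff.2 hk
    set r := ‖k‖
    set x := ‖⟪Φ, annihilationKernel k Ψ⟫_ℂ‖ with hx
    have hx0 : 0 ≤ x := norm_nonneg _
    rw [norm_mul, norm_mul, Complex.norm_real, Complex.norm_real, Real.norm_of_nonneg (by positivity),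
      Real.norm_of_nonneg (by positivity), ← hx, Pi.add_apply]
    set w := r + r ^ (d + 4) with hw
    have hw0 : 0 < w := by positivity
    have h3 : ((1 + r ^ 2) * (1 / Real.sqrt (2 * r))) ^ 2 = 1 / 2 * (r⁻¹ * (1 + r ^ 2) ^ 2) := by
      rw [mul_pow, div_pow, Real.sq_sqrt (by positivity)]
      field_simp
    set y := (1 + r ^ 2) * (1 / Real.sqrt (2 * r)) with hy
    have h4 : r⁻¹ * (1 + r ^ 2) ^ 2 = 2 * y ^ 2 := by rw [h3]; ring
    rw [h4, ← mul_assoc, ← hy]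
    -- The product `yx` is split as `y/√w` times `√w x`. The first square is the radial weight, the
    -- second is integrable by the domain condition.
    have h5 : 2 * y ^ 2 / w + w * x ^ 2 - y * x = ((w * x - y / 2) ^ 2 + 7 / 4 * y ^ 2) / w := by
      field_simp; ring
    have h6 : 0 ≤ ((w * x - y / 2) ^ 2 + 7 / 4 * y ^ 2) / w := by positivity
    linarith

end PowerDomain

/-! ### Oscillatory integrals with bilinear phase -/

section Oscillatory

variable {V W : Type*} [NormedAddCommGroup V] [NormedSpace ℝ V] [MeasurableSpace V]
  [NormedAddCommGroup W] [NormedSpace ℝ W]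

/-- The oscillatory integral `∫ exp(i L(v,w)) f(v) dμ(v)`. -/
def oscillatory (L : V →L[ℝ] W →L[ℝ] ℝ) (μ : Measure V) (f : V → ℂ) (w : W) : ℂ :=
  ∫ v, Complex.exp (Complex.I * (L v w : ℝ)) * f v ∂μ

/-- The Fourier character contributes `exp(-2πi ·)`, so the pairing is rescaled by `-1/(2π)`;
differentiability theorems for Fourier integrals then apply. -/
theorem oscillatory_eq (L : V →L[ℝ] W →L[ℝ] ℝ) (μ : Measure V) (f : V → ℂ) :
    oscillatory L μ f = VectorFourier.fourierIntegral Real.fourierChar μ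
      ((-(2 * Real.pi)⁻¹ : ℝ) • L).toLinearMap₁₂ f := by
  ext w
  refine integral_congr_ae (Eventually.of_forall fun v => ?_)
  simp only [Circle.smul_def, Real.fourierChar_apply, smul_eq_mul]
  congr 2
  have h : 2 * Real.pi * -(((-(2 * Real.pi)⁻¹ : ℝ) • L).toLinearMap₁₂ v w) = L v w := by
    change 2 * Real.pi * -(-(2 * Real.pi)⁻¹ * L v w) = L v w
    field_simp
  rw [h, mul_comm]

theorem integrable_pow_mul {E : Type*} [NormedAddCommGroup E] [MeasurableSpace E] [BorelSpace E]
    {μ : Measure E} {f : E → ℂ} (hf : Integrable f μ)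
    (hf2 : Integrable (fun v => ‖v‖ ^ 2 * ‖f v‖) μ) (n : ℕ) (hn : (n : ℕ∞) ≤ 2) :
    Integrable (fun v => ‖v‖ ^ n * ‖f v‖) μ := by
  have hn' : n ≤ 2 := by exact_mod_cast hn
  refine (hf.norm.add hf2).mono' ?_ (Eventually.of_forall fun v => ?_)
  · exact (continuous_norm.pow n).aestronglyMeasurable.mul hf.1.norm
  · rw [Real.norm_of_nonneg (by positivity), Pi.add_apply, ← one_add_mul]
    exact mul_le_mul_of_nonneg_right (le_one_add_pow (norm_nonneg v) hn') (norm_nonneg _)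

theorem contDiff_oscillatory [BorelSpace V] [SecondCountableTopology V]
    (L : V →L[ℝ] W →L[ℝ] ℝ) {μ : Measure V} {f : V → ℂ}
    (hf : Integrable f μ) (hf2 : Integrable (fun v => ‖v‖ ^ 2 * ‖f v‖) μ) :
    ContDiff ℝ 2 (oscillatory L μ f) := by
  rw [oscillatory_eq]
  exact VectorFourier.contDiff_fourierIntegral (N := 2) _ (integrable_pow_mul hf hf2)

theorem iteratedFDeriv_oscillatory [BorelSpace V] [SecondCountableTopology V]
    (L : V →L[ℝ] W →L[ℝ] ℝ) {μ : Measure V} {f : V → ℂ}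
    (hf : Integrable f μ) (hf2 : Integrable (fun v => ‖v‖ ^ 2 * ‖f v‖) μ) (w m : W) :
    iteratedFDeriv ℝ 2 (oscillatory L μ f) w ![m, m] =
      -∫ v, ((L v m : ℝ) : ℂ) ^ 2 * (Complex.exp (Complex.I * (L v w : ℝ)) * f v) ∂μ := by
  rw [oscillatory_eq, VectorFourier.iteratedFDeriv_fourierIntegral (N := 2) _
    (integrable_pow_mul hf hf2) hf.1 le_rfl,
    VectorFourier.fourierIntegral_continuousMultilinearMap_apply Real.continuous_fourierChar
      (VectorFourier.integrable_fourierPowSMulRight _ hf2 hf.1), ← oscillatory_eq, oscillatory,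
    ← integral_neg]
  refine integral_congr_ae (Eventually.of_forall fun v => ?_)
  simp only [VectorFourier.fourierPowSMulRight_apply, Fin.prod_univ_two, Matrix.cons_val_zero,
    Matrix.cons_val_one]
  change _ * ((-(2 * (Real.pi : ℂ) * Complex.I)) ^ 2 • ((-(2 * Real.pi)⁻¹ * L v m) *
    (-(2 * Real.pi)⁻¹ * L v m)) • f v) = _
  rw [Complex.real_smul, smul_eq_mul]
  have hpi : (Real.pi : ℂ) ≠ 0 := by exact_mod_cast Real.pi_ne_zero
  push_cast
  rw [neg_sq, mul_pow, Complex.I_sq]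
  field_simp

end Oscillatory

/-! ### Superpositions of plane waves and their second derivatives -/

section PlaneWave

variable {d : ℕ}

/-- The embedding of the momentum space into the light cone. -/
def coneMap (k : Space d) : ℝ × Space d := (‖k‖, k)

theorem measurableEmbedding_coneMap : MeasurableEmbedding (coneMap (d := d)) :=
  Measurable.measurableEmbedding (measurable_norm.prodMk measurable_id)
    fun _ _ h => (Prod.ext_iff.1 h).2

theorem norm_coneMap (k : Space d) : ‖coneMap k‖ = ‖k‖ := by
  rw [coneMap, Prod.norm_mk, norm_norm, max_self]

/-- A superposition of the plane waves with phases `ε k·x + τ |k| t`. -/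
def planeWave (g : Space d → ℂ) (ε τ t : ℝ) (x : Space d) : ℂ :=
  ∫ k, Complex.exp (Complex.I * (ε * ⟪k, x⟫_ℝ + τ * (‖k‖ * t) : ℝ)) * g k

/-- Integrability with the weight that controls two derivatives. -/
def TwiceIntegrable (g : Space d → ℂ) : Prop :=
  Integrable fun k => ((1 + ‖k‖ ^ 2 : ℝ) : ℂ) * g k

theorem TwiceIntegrable.integrable_bounded_mul {g : Space d → ℂ} (hg : TwiceIntegrable g)
    {b : Space d → ℂ} (hb : Measurable b) (h : ∀ k, ‖b k‖ ≤ 1 + ‖k‖ ^ 2) :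
    Integrable fun k => b k * g k := by
  have h1 : ∀ k : Space d, ((1 + ‖k‖ ^ 2 : ℝ) : ℂ) ≠ 0 := fun k => by
    have : (0 : ℝ) < 1 + ‖k‖ ^ 2 := by positivity
    exact_mod_cast this.ne'
  have h2 : (fun k => b k * g k) = fun k => (b k / ((1 + ‖k‖ ^ 2 : ℝ) : ℂ)) *
      (((1 + ‖k‖ ^ 2 : ℝ) : ℂ) * g k) := by
    funext k
    rw [← mul_assoc, div_mul_cancel₀ _ (h1 k)]
  rw [h2]
  refine Integrable.bdd_mul (c := 1) hg ?_ (Eventually.of_forall fun k => ?_)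
  · exact (hb.div (by fun_prop)).aestronglyMeasurable
  · have h3 : (0 : ℝ) < 1 + ‖k‖ ^ 2 := by positivity
    rw [norm_div, Complex.norm_real, Real.norm_of_nonneg h3.le]
    exact div_le_one_of_le₀ (h k) h3.le

theorem TwiceIntegrable.integrable {g : Space d → ℂ} (hg : TwiceIntegrable g) : Integrable g := by
  simpa using hg.integrable_bounded_mul (b := fun _ => 1) measurable_const fun k => by
    rw [norm_one]; have := sq_nonneg ‖k‖; linarith

theorem TwiceIntegrable.integrable_sq {g : Space d → ℂ} (hg : TwiceIntegrable g) :
    Integrable fun k => ((‖k‖ ^ 2 : ℝ) : ℂ) * g k :=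
  hg.integrable_bounded_mul (by fun_prop) fun k => by
    rw [Complex.norm_real, Real.norm_of_nonneg (by positivity)]; linarith

theorem TwiceIntegrable.phase_mul {g : Space d → ℂ} (hg : TwiceIntegrable g) {p : Space d → ℝ}
    (hp : Measurable p) : TwiceIntegrable fun k => Complex.exp (Complex.I * p k) * g k := by
  refine (Integrable.bdd_mul (c := 1) hg (f := fun k => Complex.exp (Complex.I * p k)) ?_
    (Eventually.of_forall fun k => ?_)).congr (Eventually.of_forall fun k => ?_)
  · exact Measurable.aestronglyMeasurable (by fun_prop)
  · rw [mul_comm, Complex.norm_exp_ofReal_mul_I]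
  · simp only; ring

theorem TwiceIntegrable.cone {g : Space d → ℂ} (hg : TwiceIntegrable g) :
    Integrable (fun v : ℝ × Space d => g v.2) (volume.map coneMap) ∧
    Integrable (fun v : ℝ × Space d => ‖v‖ ^ 2 * ‖g v.2‖) (volume.map coneMap) := by
  rw [measurableEmbedding_coneMap.integrable_map_iff, measurableEmbedding_coneMap.integrable_map_iff]
  refine ⟨hg.integrable, ?_⟩
  refine hg.integrable_sq.norm.congr (Eventually.of_forall fun k => ?_)
  simp only [Function.comp_apply]
  rw [norm_coneMap, norm_mul, Complex.norm_real, Real.norm_of_nonneg (by positivity)]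
  rfl

/-- The inner product of `ℝᵈ` as a continuous bilinear map. -/
def realInner (d : ℕ) : Space d →L[ℝ] Space d →L[ℝ] ℝ := innerSL ℝ

/-- The pairing `ε k·x + τ r t` of `(r,k)` and `(t,x)`. -/
def conePairing (ε τ : ℝ) : (ℝ × Space d) →L[ℝ] (ℝ × Space d) →L[ℝ] ℝ :=
  ε • (realInner d).bilinearComp (ContinuousLinearMap.snd ℝ ℝ (Space d))
    (ContinuousLinearMap.snd ℝ ℝ (Space d)) +
  τ • (ContinuousLinearMap.mul ℝ ℝ).bilinearComp (ContinuousLinearMap.fst ℝ ℝ (Space d))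
    (ContinuousLinearMap.fst ℝ ℝ (Space d))

/-- The phase `|k|t` is not linear in `k`. Pushing the measure forward to the cone of points `(|k|,
k)` makes the phase bilinear, so joint smoothness in `(t, x)` becomes a fact about Fourier
integrals. -/
theorem planeWave_eq (g : Space d → ℂ) (ε τ : ℝ) : (fun p : ℝ × Space d => planeWave g ε τ p.1 p.2) =
    oscillatory (conePairing ε τ) (volume.map coneMap) fun v => g v.2 := by
  funext p
  rw [oscillatory, measurableEmbedding_coneMap.integral_map]
  rfl

theorem contDiff_planeWave {g : Space d → ℂ} (hg : TwiceIntegrable g) (ε τ : ℝ) :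
    ContDiff ℝ 2 fun p : ℝ × Space d => planeWave g ε τ p.1 p.2 := by
  rw [planeWave_eq]
  exact contDiff_oscillatory _ hg.cone.1 hg.cone.2

theorem iteratedDeriv_planeWave {g : Space d → ℂ} (hg : TwiceIntegrable g) (ε τ t : ℝ)
    (x : Space d) : iteratedDeriv 2 (fun s => planeWave g ε τ s x) t =
      -(τ : ℂ) ^ 2 * planeWave (fun k => ((‖k‖ ^ 2 : ℝ) : ℂ) * g k) ε τ t x := by
  -- Only time is a variable here; the spatial phase has modulus one and is absorbed into the
  -- amplitude.
  set L : (ℝ × Space d) →L[ℝ] ℝ →L[ℝ] ℝ := τ • (ContinuousLinearMap.mul ℝ ℝ).bilinearComp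
    (ContinuousLinearMap.fst ℝ ℝ (Space d)) (ContinuousLinearMap.id ℝ ℝ) with hL
  have hLa : ∀ v s, L v s = τ * (v.1 * s) := fun v s => rfl
  set f : Space d → ℂ := fun k => Complex.exp (Complex.I * (ε * ⟪k, x⟫_ℝ : ℝ)) * g k with hf
  have hft : TwiceIntegrable f := hg.phase_mul (by fun_prop)
  have h1 : (fun s => planeWave g ε τ s x) = oscillatory L (volume.map coneMap) fun v => f v.2 := by
    funext s
    rw [oscillatory, measurableEmbedding_coneMap.integral_map, planeWave]
    refine integral_congr_ae (Eventually.of_forall fun k => ?_)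
    simp only [hLa, hf, coneMap]
    rw [← mul_assoc (Complex.exp _) (Complex.exp _), ← Complex.exp_add]
    congr 2
    push_cast; ring
  rw [iteratedDeriv_eq_iteratedFDeriv, h1]
  have h2 : (fun _ : Fin 2 => (1 : ℝ)) = ![1, 1] := by
    funext i; fin_cases i <;> rfl
  rw [h2, iteratedFDeriv_oscillatory _ hft.cone.1 hft.cone.2,
    measurableEmbedding_coneMap.integral_map, planeWave, ← integral_neg, ← integral_const_mul]
  refine integral_congr_ae (Eventually.of_forall fun k => ?_)
  simp only [hLa, hf, coneMap]
  rw [← mul_assoc (Complex.exp _) (Complex.exp _), ← Complex.exp_add]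
  have h3 : Complex.I * ((τ * (‖k‖ * t) : ℝ) : ℂ) + Complex.I * ((ε * ⟪k, x⟫_ℝ : ℝ) : ℂ) =
      Complex.I * ((ε * ⟪k, x⟫_ℝ + τ * (‖k‖ * t) : ℝ) : ℂ) := by push_cast; ring
  rw [h3]
  push_cast; ring

theorem laplacian_planeWave {g : Space d → ℂ} (hg : TwiceIntegrable g) (ε τ t : ℝ)
    (x : Space d) : Laplacian.laplacian (planeWave g ε τ t) x =
      -(ε : ℂ) ^ 2 * planeWave (fun k => ((‖k‖ ^ 2 : ℝ) : ℂ) * g k) ε τ t x := by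
  -- The mirror situation: the temporal phase is absorbed and only the position varies.
  set L : (ℝ × Space d) →L[ℝ] Space d →L[ℝ] ℝ := ε • (realInner d).bilinearComp
    (ContinuousLinearMap.snd ℝ ℝ (Space d)) (ContinuousLinearMap.id ℝ (Space d)) with hL
  have hLa : ∀ v y, L v y = ε * ⟪v.2, y⟫_ℝ := fun v y => rfl
  set f : Space d → ℂ := fun k => Complex.exp (Complex.I * (τ * (‖k‖ * t) : ℝ)) * g k with hf
  have hft : TwiceIntegrable f := hg.phase_mul (by fun_prop)
  have h1 : planeWave g ε τ t = oscillatory L (volume.map coneMap) fun v => f v.2 := by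
    funext y
    rw [oscillatory, measurableEmbedding_coneMap.integral_map, planeWave]
    refine integral_congr_ae (Eventually.of_forall fun k => ?_)
    simp only [hLa, hf, coneMap]
    rw [← mul_assoc (Complex.exp _) (Complex.exp _), ← Complex.exp_add]
    congr 2
    push_cast; ring
  rw [InnerProductSpace.laplacian_eq_iteratedFDeriv_orthonormalBasis _
    (EuclideanSpace.basisFun (Fin d) ℝ), h1]
  simp only [iteratedFDeriv_oscillatory _ hft.cone.1 hft.cone.2,
    measurableEmbedding_coneMap.integral_map]
  rw [Finset.sum_neg_distrib, ← integral_finsetSum, planeWave, ← integral_neg, ← integral_const_mul]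
  · refine integral_congr_ae (Eventually.of_forall fun k => ?_)
    simp only [hLa, hf, coneMap]
    rw [← mul_assoc (Complex.exp _) (Complex.exp _), ← Complex.exp_add, ← Finset.sum_mul]
    have h3 : Complex.I * ((ε * ⟪k, x⟫_ℝ : ℝ) : ℂ) + Complex.I * ((τ * (‖k‖ * t) : ℝ) : ℂ) =
        Complex.I * ((ε * ⟪k, x⟫_ℝ + τ * (‖k‖ * t) : ℝ) : ℂ) := by push_cast; ring
    have h4 : ∑ i, ((ε * ⟪k, EuclideanSpace.basisFun (Fin d) ℝ i⟫_ℝ : ℝ) : ℂ) ^ 2 =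
        (ε : ℂ) ^ 2 * ((‖k‖ ^ 2 : ℝ) : ℂ) := by
      rw [EuclideanSpace.norm_sq_eq]
      push_cast
      rw [Finset.mul_sum]
      refine Finset.sum_congr rfl fun i _ => ?_
      rw [EuclideanSpace.basisFun_apply, EuclideanSpace.inner_single_right]
      simp [mul_pow, ← Complex.ofReal_pow]
    rw [h3, h4]
    ring
  · intro i _
    simp only [hLa, hf, coneMap]
    refine (((hft.phase_mul (p := fun k => ε * ⟪k, x⟫_ℝ) (by fun_prop)).integrable_bounded_mul
      (b := fun k => ((⟪k, EuclideanSpace.basisFun (Fin d) ℝ i⟫_ℝ ^ 2 : ℝ) : ℂ)) (by fun_prop)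
      fun k => ?_).const_mul ((ε : ℂ) ^ 2)).congr (Eventually.of_forall fun k => ?_)
    · have h5 := abs_real_inner_le_norm k (EuclideanSpace.basisFun (Fin d) ℝ i)
      rw [(EuclideanSpace.basisFun (Fin d) ℝ).norm_eq_one, mul_one] at h5
      rw [Complex.norm_real, norm_pow, Real.norm_eq_abs]
      have h6 := pow_le_pow_left₀ (abs_nonneg _) h5 2
      linarith
    · simp only [hf]
      push_cast; ring

end PlaneWave

/-! ### Fourier inversion almost everywhere -/

section Inversion

open scoped FourierTransform

variable {V : Type*} [NormedAddCommGroup V] [InnerProductSpace ℝ V] [MeasurableSpace V]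
  [BorelSpace V] [FiniteDimensional ℝ V]

theorem integral_fourier_mul {f g : V → ℂ} (hf : Integrable f) (hg : Integrable g) :
    ∫ x, 𝓕 f x * g x = ∫ x, f x * 𝓕 g x := by
  have h := VectorFourier.integral_fourierIntegral_smul_eq_flip (μ := (volume : Measure V))
    (ν := (volume : Measure V)) (L := innerₗ V) Real.continuous_fourierChar continuous_inner hf hg
  rw [flip_innerₗ] at h
  exact h

theorem integral_fourierInv_mul {f g : V → ℂ} (hf : Integrable f) (hg : Integrable g) :
    ∫ x, 𝓕⁻ f x * g x = ∫ x, f x * 𝓕⁻ g x := by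
  rw [Real.fourierInv_eq_fourier_comp_neg g, ← integral_fourier_mul hf hg.comp_neg,
    ← integral_neg_eq_self (fun x => 𝓕 f x * g (-x))]
  simp only [neg_neg, Real.fourierInv_eq_fourier_neg]

theorem continuous_fourierInv {f : V → ℂ} (hf : Integrable f) : Continuous (𝓕⁻ f) := by
  rw [Real.fourierInv_eq_fourier_comp_neg]
  exact VectorFourier.fourierIntegral_continuous Real.continuous_fourierChar
    (innerSL ℝ).continuous₂ hf.comp_neg

/-- Fourier inversion, almost everywhere. -/
theorem ae_fourierInv_fourier_eq {f : V → ℂ} (hf : Integrable f) (hf' : Integrable (𝓕 f)) :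
    ∀ᵐ x, 𝓕⁻ (𝓕 f) x = f x := by
  -- It is enough to test against smooth functions of compact support. Both transforms move onto the
  -- test function, where inversion holds for Schwartz functions.
  refine ae_eq_of_integral_contDiff_smul_eq (continuous_fourierInv hf').locallyIntegrable
    hf.locallyIntegrable fun g hg hgs => ?_
  have hg1 : ContDiff ℝ ∞ fun x => (g x : ℂ) := Complex.ofRealCLM.contDiff.comp hg
  have hg2 : HasCompactSupport fun x => (g x : ℂ) := hgs.comp_left (g := Complex.ofReal) rfl
  set φ := hg2.toSchwartzMap hg1 with hφ
  have h1 : (φ : V → ℂ) = fun x => (g x : ℂ) := rfl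
  have h2 : Integrable (𝓕⁻ (φ : V → ℂ)) := by
    rw [← SchwartzMap.fourierInv_coe]
    exact (𝓕⁻ φ).integrable
  have h3 : 𝓕 (𝓕⁻ (φ : V → ℂ)) = φ := by
    refine φ.continuous.fourier_fourierInv_eq φ.integrable ?_
    rw [← SchwartzMap.fourier_coe]
    exact (𝓕 φ).integrable
  calc ∫ x, g x • 𝓕⁻ (𝓕 f) x = ∫ x, 𝓕⁻ (𝓕 f) x * φ x := by
        refine integral_congr_ae (Eventually.of_forall fun x => ?_)
        simp only [h1, Complex.real_smul]; ring
    _ = ∫ x, 𝓕 f x * 𝓕⁻ (φ : V → ℂ) x := integral_fourierInv_mul hf' φ.integrable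
    _ = ∫ x, f x * φ x := by rw [integral_fourier_mul hf h2, h3]
    _ = ∫ x, g x • f x := by
        refine integral_congr_ae (Eventually.of_forall fun x => ?_)
        simp only [h1, Complex.real_smul]; ring

end Inversion

/-! ### The Fourier normalization of `ρ̂` -/

section Source

open scoped FourierTransform

variable {d : ℕ}

theorem fourierHat_eq (ρ : Space d → ℝ) (k : Space d) : fourierHat ρ k =
    (((Real.sqrt (2 * Real.pi)) ^ d : ℝ) : ℂ)⁻¹ * 𝓕 (fun x => (ρ x : ℂ)) ((2 * Real.pi)⁻¹ • k) := by
  rw [fourierHat, Real.fourier_eq']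
  congr 1
  refine integral_congr_ae (Eventually.of_forall fun x => ?_)
  simp only [smul_eq_mul]
  rw [mul_comm, inner_smul_right, real_inner_comm]
  congr 2
  have h : -2 * Real.pi * ((2 * Real.pi)⁻¹ * ⟪x, k⟫_ℝ) = -⟪x, k⟫_ℝ := by
    field_simp
  rw [h]
  push_cast; ring

theorem conj_fourierHat (ρ : Space d → ℝ) (k : Space d) :
    conj (fourierHat ρ k) = fourierHat ρ (-k) := by
  rw [fourierHat, fourierHat, map_mul, map_inv₀, Complex.conj_ofReal, ← integral_conj]
  congr 1
  refine integral_congr_ae (Eventually.of_forall fun x => ?_)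
  simp only [map_mul, Complex.conj_ofReal, ← Complex.exp_conj, map_neg, Complex.conj_I,
    inner_neg_left]
  push_cast; ring_nf

/-- Substituting `k = 2πξ`: the Jacobian `(2π)^d` is cancelled by the two prefactors `(2π)^{-d/2}`.
-/
theorem integral_exp_fourierHat (ρ : Space d → ℝ) (x : Space d) :
    (((Real.sqrt (2 * Real.pi)) ^ d : ℝ) : ℂ)⁻¹ *
      ∫ k, Complex.exp (Complex.I * (⟪k, x⟫_ℝ : ℂ)) * fourierHat ρ k =
        𝓕⁻ (𝓕 fun x => (ρ x : ℂ)) x := by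
  have h1 := Measure.integral_comp_smul (volume : Measure (Space d))
    (fun ξ => Complex.exp (((2 * Real.pi * ⟪ξ, x⟫_ℝ : ℝ) : ℂ) * Complex.I) •
      𝓕 (fun x => (ρ x : ℂ)) ξ) (2 * Real.pi)⁻¹
  rw [finrank_euclideanSpace_fin] at h1
  rw [Real.fourierInv_eq']
  have h0 : (0 : ℝ) < 2 * Real.pi := by positivity
  have h2 : ∫ k, Complex.exp (Complex.I * (⟪k, x⟫_ℝ : ℂ)) * fourierHat ρ k =
      (((Real.sqrt (2 * Real.pi)) ^ d : ℝ) : ℂ)⁻¹ * ∫ k : Space d,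
        Complex.exp (((2 * Real.pi * ⟪(2 * Real.pi)⁻¹ • k, x⟫_ℝ : ℝ) : ℂ) * Complex.I) •
          𝓕 (fun x => (ρ x : ℂ)) ((2 * Real.pi)⁻¹ • k) := by
    rw [← integral_const_mul]
    refine integral_congr_ae (Eventually.of_forall fun k => ?_)
    simp only [smul_eq_mul]
    rw [fourierHat_eq, inner_smul_left, mul_left_comm]
    congr 3
    have h : 2 * Real.pi * ((starRingEnd ℝ) (2 * Real.pi)⁻¹ * ⟪k, x⟫_ℝ) = ⟪k, x⟫_ℝ := by
      rw [conj_trivial]; field_simp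
    rw [h, mul_comm]
  rw [h2, h1, inv_pow, inv_inv, abs_of_pos (by positivity), Complex.real_smul, ← mul_assoc,
    ← mul_assoc]
  have h3 : (((Real.sqrt (2 * Real.pi)) ^ d : ℝ) : ℂ)⁻¹ *
      (((Real.sqrt (2 * Real.pi)) ^ d : ℝ) : ℂ)⁻¹ * (((2 * Real.pi) ^ d : ℝ) : ℂ) = 1 := by
    have h4 : (2 * Real.pi) ^ d = (Real.sqrt (2 * Real.pi)) ^ d * (Real.sqrt (2 * Real.pi)) ^ d := by
      rw [← mul_pow, Real.mul_self_sqrt h0.le]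
    have h5 : (((Real.sqrt (2 * Real.pi)) ^ d : ℝ) : ℂ) ≠ 0 := by
      have : (0 : ℝ) < (Real.sqrt (2 * Real.pi)) ^ d := by positivity
      exact_mod_cast this.ne'
    rw [h4, Complex.ofReal_mul]
    field_simp
  rw [h3, one_mul]

theorem integrable_fourier {ρ : Space d → ℝ} (h : Integrable (fourierHat ρ)) :
    Integrable (𝓕 fun x => (ρ x : ℂ)) := by
  have h0 : (0 : ℝ) < 2 * Real.pi := by positivity
  have h1 := (h.const_mul (((Real.sqrt (2 * Real.pi)) ^ d : ℝ) : ℂ)).comp_smul h0.ne'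
  refine h1.congr (Eventually.of_forall fun k => ?_)
  have h5 : (((Real.sqrt (2 * Real.pi)) ^ d : ℝ) : ℂ) ≠ 0 := by
    have : (0 : ℝ) < (Real.sqrt (2 * Real.pi)) ^ d := by positivity
    exact_mod_cast this.ne'
  simp only
  rw [fourierHat_eq, smul_smul, inv_mul_cancel₀ h0.ne', one_smul, ← mul_assoc,
    mul_inv_cancel₀ h5, one_mul]

end Source

/-! ### The wave equation for free waves plus the static field -/

section Wave

open scoped FourierTransform

variable {d : ℕ}

/-- The wave operator `∂ₜ² - Δ`. -/
def waveOp (φ : ℝ → Space d → ℂ) (t : ℝ) (x : Space d) : ℂ :=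
  iteratedDeriv 2 (fun s => φ s x) t - Laplacian.laplacian (φ t) x

theorem contDiffAt_slices {φ : ℝ → Space d → ℂ}
    (h : ContDiff ℝ 2 fun p : ℝ × Space d => φ p.1 p.2) (t : ℝ) (x : Space d) :
    ContDiffAt ℝ 2 (fun s => φ s x) t ∧ ContDiffAt ℝ 2 (φ t) x :=
  ⟨(h.comp (contDiff_id.prodMk contDiff_const)).contDiffAt,
    (h.comp (contDiff_const.prodMk contDiff_id)).contDiffAt⟩

theorem waveOp_add {φ ψ : ℝ → Space d → ℂ} (h : ContDiff ℝ 2 fun p : ℝ × Space d => φ p.1 p.2)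
    (h' : ContDiff ℝ 2 fun p : ℝ × Space d => ψ p.1 p.2) (t : ℝ) (x : Space d) :
    waveOp (fun s y => φ s y + ψ s y) t x = waveOp φ t x + waveOp ψ t x := by
  have h1 := contDiffAt_slices h t x
  have h2 := contDiffAt_slices h' t x
  have h3 := iteratedDeriv_add h1.1 h2.1
  have h4 := h1.2.laplacian_add h2.2
  change iteratedDeriv 2 ((fun s => φ s x) + fun s => ψ s x) t -
    Laplacian.laplacian (φ t + ψ t) x = _
  rw [h3, h4, waveOp, waveOp]
  ring

theorem waveOp_const_mul {φ : ℝ → Space d → ℂ} (c : ℂ)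
    (h : ContDiff ℝ 2 fun p : ℝ × Space d => φ p.1 p.2) (t : ℝ) (x : Space d) :
    waveOp (fun s y => c * φ s y) t x = c * waveOp φ t x := by
  have h1 := contDiffAt_slices h t x
  have h4 := InnerProductSpace.laplacian_smul c h1.2
  rw [waveOp, iteratedDeriv_const_mul c h1.1]
  change _ - Laplacian.laplacian (c • φ t) x = _
  rw [h4, waveOp, smul_eq_mul]
  ring

/-- The prefactor vanishes on the light cone `ε² = τ²`, as for free waves, and is `1` for the static
waves with `ε = ±1`, `τ = 0`. -/
theorem waveOp_planeWave {g : Space d → ℂ} (hg : TwiceIntegrable g) (ε τ t : ℝ) (x : Space d) :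
    waveOp (planeWave g ε τ) t x = ((ε : ℂ) ^ 2 - (τ : ℂ) ^ 2) *
      planeWave (fun k => ((‖k‖ ^ 2 : ℝ) : ℂ) * g k) ε τ t x := by
  rw [waveOp, iteratedDeriv_planeWave hg, laplacian_planeWave hg]
  ring

theorem TwiceIntegrable.conj {g : Space d → ℂ} (hg : TwiceIntegrable g) :
    TwiceIntegrable fun k => conj (g k) := by
  refine Integrable.congr (Complex.conjCLE.toContinuousLinearMap.integrable_comp hg)
    (Eventually.of_forall fun k => ?_)
  simp

theorem integrable_exp_mul {g : Space d → ℂ} (hg : TwiceIntegrable g) (ε τ t : ℝ) (x : Space d) :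
    Integrable fun k => Complex.exp (Complex.I * (ε * ⟪k, x⟫_ℝ + τ * (‖k‖ * t) : ℝ)) * g k :=
  (hg.phase_mul (by fun_prop)).integrable

/-- The amplitude `ρ̂ / (2 ω²)` of the static part of the field. -/
def staticAmplitude (ρ : Space d → ℝ) (k : Space d) : ℂ :=
  1 / 2 * (fourierHat ρ k / ((‖k‖ ^ 2 : ℝ) : ℂ))

theorem sq_mul_staticAmplitude (ρ : Space d → ℝ) {k : Space d} (hk : k ≠ 0) :
    ((‖k‖ ^ 2 : ℝ) : ℂ) * staticAmplitude ρ k = 1 / 2 * fourierHat ρ k := by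
  have h : ((‖k‖ ^ 2 : ℝ) : ℂ) ≠ 0 := by
    exact_mod_cast (pow_pos (norm_pos_iff.2 hk) 2).ne'
  rw [staticAmplitude]
  field_simp

/-- Away from `k = 0` the weight `1 + |k|²` produces `ρ̂/ω²` and `ρ̂`, whose integrability is
assumed. -/
theorem twiceIntegrable_staticAmplitude (hd : 0 < d) {ρ : Space d → ℝ} (h2 : CondA2 ρ) :
    TwiceIntegrable (staticAmplitude ρ) := by
  refine ((h2.integrable_div.const_mul (1 / 2)).add (h2.integrable_hat.const_mul (1 / 2))).congr ?_
  filter_upwards [ae_ne_zero hd] with k hk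
  rw [Pi.add_apply, ← sq_mul_staticAmplitude ρ hk, staticAmplitude]
  push_cast; ring

theorem weighted_three_eq (ρ : Space d → ℝ) {k : Space d} (hk : k ≠ 0) :
    ((1 / Real.sqrt (2 * ‖k‖) : ℝ) : ℂ) * (((1 / Real.sqrt 2 : ℝ) : ℂ) * weighted ρ 3 k) =
      staticAmplitude ρ k := by
  have h0 : 0 < ‖k‖ := norm_pos_iff.2 hk
  have h1 : (1 / Real.sqrt (2 * ‖k‖)) * (1 / Real.sqrt 2) * (1 / Real.sqrt ‖k‖ ^ 3) =
      1 / 2 * (1 / ‖k‖ ^ 2) := by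
    rw [Real.sqrt_mul (by norm_num)]
    have h2 := Real.mul_self_sqrt (show (0 : ℝ) ≤ 2 by norm_num)
    have h3 := Real.mul_self_sqrt h0.le
    have h4 : 0 < Real.sqrt ‖k‖ := Real.sqrt_pos.2 h0
    rw [div_mul_div_comm, div_mul_div_comm, div_mul_div_comm]
    congr 1
    · norm_num
    · calc _ = (Real.sqrt 2 * Real.sqrt 2) * (Real.sqrt ‖k‖ * Real.sqrt ‖k‖) ^ 2 := by ring
        _ = _ := by rw [h2, h3]
  have h5 := congrArg (fun r : ℝ => (r : ℂ)) h1
  simp only [Complex.ofReal_mul, Complex.ofReal_div, Complex.ofReal_one, Complex.ofReal_pow,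
    Complex.ofReal_ofNat] at h5
  rw [weighted, staticAmplitude, div_eq_mul_one_div (fourierHat ρ k),
    div_eq_mul_one_div (fourierHat ρ k)]
  simp only [Complex.ofReal_div, Complex.ofReal_one, Complex.ofReal_pow]
  linear_combination (fourierHat ρ k) * h5

/-- Because `ρ` is real, `k ↦ -k` turns the conjugate half into the first one, and the two halves
add up to the inversion integral. -/
theorem static_source (hd : 0 < d) (ρ : Space d → ℝ) (t : ℝ) (x : Space d) :
    planeWave (fun k => ((‖k‖ ^ 2 : ℝ) : ℂ) * staticAmplitude ρ k) 1 0 t x +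
      planeWave (fun k => ((‖k‖ ^ 2 : ℝ) : ℂ) * conj (staticAmplitude ρ k)) (-1) 0 t x =
        ∫ k, Complex.exp (Complex.I * (⟪k, x⟫_ℝ : ℂ)) * fourierHat ρ k := by
  have h3 : planeWave (fun k => ((‖k‖ ^ 2 : ℝ) : ℂ) * staticAmplitude ρ k) 1 0 t x =
      ∫ k, 1 / 2 * (Complex.exp (Complex.I * (⟪k, x⟫_ℝ : ℂ)) * fourierHat ρ k) := by
    refine integral_congr_ae ?_
    filter_upwards [ae_ne_zero hd] with k hk
    rw [sq_mul_staticAmplitude ρ hk, one_mul, zero_mul, add_zero]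
    ring
  have h4 : planeWave (fun k => ((‖k‖ ^ 2 : ℝ) : ℂ) * conj (staticAmplitude ρ k)) (-1) 0 t x =
      ∫ k, 1 / 2 * (Complex.exp (Complex.I * (⟪k, x⟫_ℝ : ℂ)) * fourierHat ρ k) := by
    rw [← integral_neg_eq_self (fun k => 1 / 2 * (Complex.exp (Complex.I * (⟪k, x⟫_ℝ : ℂ)) *
      fourierHat ρ k))]
    refine integral_congr_ae ?_
    filter_upwards [ae_ne_zero hd] with k hk
    have h5 := congrArg conj (sq_mul_staticAmplitude ρ hk)
    rw [map_mul, Complex.conj_ofReal, map_mul, conj_fourierHat] at h5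
    rw [h5, inner_neg_left, zero_mul, add_zero, map_div₀, map_one, map_ofNat]
    push_cast
    ring_nf
  rw [h3, h4, integral_const_mul]
  ring

theorem waveEquationAt_iff (ρ : Space d → ℝ) (φ : ℝ → Space d → ℂ) (t : ℝ) (x : Space d) :
    WaveEquationAt ρ φ t x ↔ waveOp φ t x = (ρ x : ℂ) := Iff.rfl

/-- The sum of free waves and the static field solves the wave equation with source `ρ`. -/
theorem isWaveSolution_of_planeWaves (hd : 0 < d) {ρ : Space d → ℝ} (h1 : CondA1 ρ) (h2 : CondA2 ρ)
    {φ : ℝ → Space d → ℂ} {g g' : Space d → ℂ} (hg : TwiceIntegrable g) (hg' : TwiceIntegrable g')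
    (hφ : ∀ t x, φ t x = (((Real.sqrt (2 * Real.pi)) ^ d : ℝ) : ℂ)⁻¹ *
      ((planeWave g 1 (-1) t x + planeWave g' (-1) 1 t x) +
        (planeWave (staticAmplitude ρ) 1 0 t x +
          planeWave (fun k => conj (staticAmplitude ρ k)) (-1) 0 t x))) :
    IsWaveSolution ρ φ := by
  obtain rfl : φ = fun t x => (((Real.sqrt (2 * Real.pi)) ^ d : ℝ) : ℂ)⁻¹ *
      ((planeWave g 1 (-1) t x + planeWave g' (-1) 1 t x) +
        (planeWave (staticAmplitude ρ) 1 0 t x +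
          planeWave (fun k => conj (staticAmplitude ρ k)) (-1) 0 t x)) := by
    funext t x; exact hφ t x
  have hs := twiceIntegrable_staticAmplitude hd h2
  have c1 := contDiff_planeWave hg 1 (-1)
  have c2 := contDiff_planeWave hg' (-1) 1
  have c3 := contDiff_planeWave hs 1 0
  have c4 := contDiff_planeWave hs.conj (-1) 0
  have hbox : ∀ t x, waveOp (fun t x => (((Real.sqrt (2 * Real.pi)) ^ d : ℝ) : ℂ)⁻¹ *
      ((planeWave g 1 (-1) t x + planeWave g' (-1) 1 t x) +
        (planeWave (staticAmplitude ρ) 1 0 t x +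
          planeWave (fun k => conj (staticAmplitude ρ k)) (-1) 0 t x))) t x =
      𝓕⁻ (𝓕 fun x => (ρ x : ℂ)) x := by
    intro t x
    rw [waveOp_const_mul _ ((c1.add c2).add (c3.add c4)), waveOp_add (c1.add c2) (c3.add c4),
      waveOp_add c1 c2, waveOp_add c3 c4, waveOp_planeWave hg, waveOp_planeWave hg',
      waveOp_planeWave hs, waveOp_planeWave hs.conj, ← integral_exp_fourierHat,
      ← static_source hd ρ t x]
    push_cast
    ring
  have hρ : Integrable fun x => (ρ x : ℂ) := h1.integrable.ofReal
  have hρ' := integrable_fourier h2.integrable_hat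
  refine ⟨contDiff_const.mul ((c1.add c2).add (c3.add c4)), ?_, fun x hx t => ?_⟩
  -- The wave operator gives the same continuous function at all times, so one null set of positions
  -- serves every `t`.
  · filter_upwards [ae_fourierInv_fourier_eq hρ hρ'] with x hx t
    rw [waveEquationAt_iff, hbox, hx]
  · rw [waveEquationAt_iff, hbox]
    exact hρ.fourierInv_fourier_eq hρ' (Complex.continuous_ofReal.continuousAt.comp hx)

end Wave

/-! ### The field in dressed states -/

section Field

variable {d : ℕ}

/-- The amplitude `⟨Φ, a(k) Ψ⟩ / √(2 ω)` of the radiated part of the field. -/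
def waveAmplitude (Φ Ψ : Fock d) (k : Space d) : ℂ :=
  ((1 / Real.sqrt (2 * ‖k‖) : ℝ) : ℂ) * ⟪Φ, annihilationKernel k Ψ⟫_ℂ

/-- The normalization `(Φ,Ψ) = 1`, which also gives `(Ψ,Φ) = 1`, is what makes the static amplitude
exactly `ρ̂/(2ω²)` in both halves. -/
theorem fieldIntegrand_dressing (hd : 0 < d) {ρ : Space d → ℝ} (h1 : CondA1 ρ) (h2 : CondA2 ρ)
    {Φ Ψ Θ Θ' : Fock d} (hΦ : (Φ, Θ') ∈ freeGraph d) (hΨ : (Ψ, Θ) ∈ freeGraph d)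
    (h : ⟪Φ, Ψ⟫_ℂ = 1) (t : ℝ) (x : Space d) :
    ∀ᵐ k, fieldIntegrand ρ h1 (dressing ρ h2 Φ) (dressing ρ h2 Ψ) t x k =
      (Complex.exp (Complex.I * ((1 : ℝ) * ⟪k, x⟫_ℝ + (-1 : ℝ) * (‖k‖ * t) : ℝ)) *
          waveAmplitude Φ Ψ k +
        Complex.exp (Complex.I * ((-1 : ℝ) * ⟪k, x⟫_ℝ + (1 : ℝ) * (‖k‖ * t) : ℝ)) *
          conj (waveAmplitude Ψ Φ k)) +
      (Complex.exp (Complex.I * ((1 : ℝ) * ⟪k, x⟫_ℝ + (0 : ℝ) * (‖k‖ * t) : ℝ)) *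
          staticAmplitude ρ k +
        Complex.exp (Complex.I * ((-1 : ℝ) * ⟪k, x⟫_ℝ + (0 : ℝ) * (‖k‖ * t) : ℝ)) *
          conj (staticAmplitude ρ k)) := by
  have h' : ⟪Ψ, Φ⟫_ℂ = 1 := by rw [← inner_conj_symm, h, map_one]
  filter_upwards [(heisenbergForm_dressing hd h1 h2 (Φ := Φ) hΨ t).2,
    (heisenbergForm_dressing hd h1 h2 (Φ := Ψ) hΦ t).2, ae_ne_zero hd] with k h3 h4 hk
  rw [fieldIntegrand, h3, h4, h, h', ← weighted_three_eq ρ hk, waveAmplitude, waveAmplitude]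
  simp only [map_add, map_mul, Complex.conj_ofReal, ← Complex.exp_conj, map_neg, Complex.conj_I,
    map_one]
  have e1 : Complex.exp (Complex.I * ((1 : ℝ) * ⟪k, x⟫_ℝ + (-1 : ℝ) * (‖k‖ * t) : ℝ)) =
      Complex.exp (-(Complex.I * (t * ‖k‖ : ℝ))) * Complex.exp (Complex.I * (⟪k, x⟫_ℝ : ℂ)) := by
    rw [← Complex.exp_add]; congr 1; push_cast; ring
  have e2 : Complex.exp (Complex.I * ((-1 : ℝ) * ⟪k, x⟫_ℝ + (1 : ℝ) * (‖k‖ * t) : ℝ)) =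
      Complex.exp (-(-Complex.I * (t * ‖k‖ : ℝ))) *
        Complex.exp (-(Complex.I * (⟪k, x⟫_ℝ : ℂ))) := by
    rw [← Complex.exp_add]; congr 1; push_cast; ring
  have e3 : Complex.exp (Complex.I * ((1 : ℝ) * ⟪k, x⟫_ℝ + (0 : ℝ) * (‖k‖ * t) : ℝ)) =
      Complex.exp (Complex.I * (⟪k, x⟫_ℝ : ℂ)) := by
    congr 1; push_cast; ring
  have e4 : Complex.exp (Complex.I * ((-1 : ℝ) * ⟪k, x⟫_ℝ + (0 : ℝ) * (‖k‖ * t) : ℝ)) =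
      Complex.exp (-(Complex.I * (⟪k, x⟫_ℝ : ℂ))) := by
    congr 1; push_cast; ring
  rw [e1, e2, e3, e4]
  ring

/-- The four summands of the integrand are separately integrable, which gives absolute convergence
and splits the field into the plane waves already treated. -/
theorem dressed_field (hd : 3 ≤ d) {ρ : Space d → ℝ} (h1 : CondA1 ρ) (h2 : CondA2 ρ) {Φ Ψ : Fock d}
    (hΦ : Φ ∈ (dGammaPow (fun k : Space d => ‖k‖) ((d : ℝ) / 2 + 2)).domain)
    (hΨ : Ψ ∈ (dGammaPow (fun k : Space d => ‖k‖) ((d : ℝ) / 2 + 2)).domain)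
    (h : ⟪Φ, Ψ⟫_ℂ = 1) :
    FieldWellDefined ρ h1 (dressing ρ h2 Φ) (dressing ρ h2 Ψ) ∧
      IsWaveSolution ρ (fieldForm ρ h1 (dressing ρ h2 Φ) (dressing ρ h2 Ψ)) := by
  have hd0 : 0 < d := by omega
  obtain ⟨Ξ', hΞ'⟩ := LinearPMap.mem_domain_iff.1 hΦ
  obtain ⟨Ξ, hΞ⟩ := LinearPMap.mem_domain_iff.1 hΨ
  rw [dGammaPow, mult_graph] at hΞ hΞ'
  obtain ⟨Θ', hΘ'⟩ := exists_freeGraph hΞ'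
  obtain ⟨Θ, hΘ⟩ := exists_freeGraph hΞ
  have i1 : TwiceIntegrable (waveAmplitude Φ Ψ) := integrable_inner_annihilationKernel hd hΞ Φ
  have i2 : TwiceIntegrable fun k => conj (waveAmplitude Ψ Φ k) :=
    TwiceIntegrable.conj (integrable_inner_annihilationKernel hd hΞ' Ψ)
  have i3 := twiceIntegrable_staticAmplitude hd0 h2
  have j1 := integrable_exp_mul i1 1 (-1)
  have j2 := integrable_exp_mul i2 (-1) 1
  have j3 := integrable_exp_mul i3 1 0
  have j4 := integrable_exp_mul i3.conj (-1) 0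
  have hF := fieldIntegrand_dressing hd0 h1 h2 hΘ' hΘ h
  refine ⟨fun t => ⟨(heisenbergForm_dressing hd0 h1 h2 (Φ := Φ) hΘ t).1,
    (heisenbergForm_dressing hd0 h1 h2 (Φ := Ψ) hΘ' t).1, fun x => ?_⟩,
    isWaveSolution_of_planeWaves hd0 h1 h2 i1 i2 fun t x => ?_⟩
  · refine Integrable.congr (((j1 t x).add (j2 t x)).add ((j3 t x).add (j4 t x))) ?_
    filter_upwards [hF t x] with k hk
    exact hk.symm
  · rw [fieldForm, integral_congr_ae (hF t x)]
    congr 1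
    refine (integral_add ((j1 t x).add (j2 t x)) ((j3 t x).add (j4 t x))).trans ?_
    congr 1
    · exact integral_add (j1 t x) (j2 t x)
    · exact integral_add (j3 t x) (j4 t x)

end Field

end VanHove

end

open VanHove
theorem theorem1 (d : ℕ) (hd : 3 ≤ d) (ρ : Space d → ℝ) (h1 : CondA1 ρ) (h2 : CondA2 ρ) :
    HasUnitaryGroup (hamiltonian ρ h1) ∧
    HasUnitaryGroup (dressingGenerator ρ h2) ∧
    (∀ Φ ∈ (dGammaPow (fun k : Space d => ‖k‖) ((d : ℝ) / 2 + 2)).domain,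
      ∀ Ψ ∈ (dGammaPow (fun k : Space d => ‖k‖) ((d : ℝ) / 2 + 2)).domain,
        ⟪Φ, Ψ⟫_ℂ = 1 →
          FieldWellDefined ρ h1 (dressing ρ h2 Φ) (dressing ρ h2 Ψ) ∧
          IsWaveSolution ρ (fieldForm ρ h1 (dressing ρ h2 Φ) (dressing ρ h2 Ψ))) ∧
    (∀ Ψ ∈ (dGammaPow (fun k : Space d => ‖k‖) ((d : ℝ) / 2 + 2)).domain,
      ‖Ψ‖ = 1 →
        FieldWellDefined ρ h1 (dressing ρ h2 Ψ) (dressing ρ h2 Ψ) ∧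
        IsWaveSolution ρ (fieldForm ρ h1 (dressing ρ h2 Ψ) (dressing ρ h2 Ψ))) := by
  refine ⟨(exists_hamiltonian_group (by omega) h1 h2).1, hasUnitaryGroup_dressingGenerator h2,
    fun Φ hΦ Ψ hΨ h => dressed_field hd h1 h2 hΦ hΨ h,
    fun Ψ hΨ h => dressed_field hd h1 h2 hΨ hΨ ?_⟩
  rw [inner_self_eq_norm_sq_to_K, h]
  simp
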